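/- Write $\mathbb R^2_+=\{(x_1,x_2)\in\mathbb R^2 : x_1>0\}$ and let $\nu=(-1,0)$ be its outward normal. Let $U=\mathbb R^2$ or $U=\mathbb R^2_+$, and let $\tilde{\mathbf F}:\overline U\to\mathbb R^2$ be continuously differentiable with $\operatorname{curl}\tilde{\mathbf F}=\partial_1\tilde F_2-\partial_2\tilde F_1=1$ in $U$. For $U=\mathbb R^2_+$, let $\mathcal H$ be the Neumann realization of $(-i\nabla+\tilde{\mathbf F})^2$ on $L^2(\mathbb R^2_+)$, that is, this operator with domain $$\big\{u\in L^2(\mathbb R^2_+) : (-i\nabla+\tilde{\mathbf F})^2u\in L^2(\mathbb R^2_+),\ \nu\cdot(-i\nabla+\tilde{\mathbf F})u\big|_{\partial\mathbb R^2_+}=0\big\},$$ where the boundary condition means that $(-i\nabla+\tilde{\mathbf F})u$ and its divergence are square integrable on bounded parts of $\mathbb R^2_+$ and that its normal trace, defined by the Gauss–Green formula, is zero. Put $\Theta_0=\inf\operatorname{Spec}\mathcal H$ (by gauge invariance, this number does not depend on the choice of $\tilde{\mathbf F}$). Let $\lambda\in\mathbb R$, $S\ge 0$, and let $\psi\in L^\infty(U;\mathbb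 C)$ satisfy, in the sense of distributions, one of the following. 1. $U=\mathbb R^2$, $\lambda<1$, and $(-i\nabla+\tilde{\mathbf F})^2\psi=\lambda\psi$ on $\mathbb R^2$. 2. $U=\mathbb R^2$, $0\le\lambda\le1$, $S\neq0$ if $\lambda=1$, and $(-i\nabla+\tilde{\mathbf F})^2\psi=\lambda(1-S^2|\psi|^2)\psi$ on $\mathbb R^2$. 3. $U=\mathbb R^2_+$, $\lambda<\Theta_0$, $\psi\in H^2(\mathbb R^2_+\cap B(0,R))$ for all $R>0$, $(-i\nabla+\tilde{\mathbf F})^2\psi=\lambda\psi$ on $\mathbb R^2_+$, and $\nu\cdot(-i\nabla+\tilde{\mathbf F})\psi\big|_{\partial\mathbb R^2_+}=0$. 4. $U=\mathbb R^2_+$, $0\le\lambda\le\Theta_0$, $S\neq0$ if $\lambda=\Theta_0$, $\psi\in H^2(\mathbb R^2_+\cap B(0,R))$ for all $R>0$, $(-i\nabla+\tilde{\mathbf F})^2\psi=\lambda(1-S^2|\psi|^2)\psi$ on $\mathbb R^2_+$, and $\nu\cdot(-i\nabla+\tilde{\mathbf F})\psi\big|_{\partial\mathbb R^2_+}=0$.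 Then $\psi=0$ almost everywhere in $U$. -/

import Mathlib

open MeasureTheory Set
open scoped ContDiff ENNReal

noncomputable section

/-- The plane `ℝ²`; the paper's coordinates `x₁, x₂` are `x 0, x 1`. -/
abbrev Plane : Type := EuclideanSpace ℝ (Fin 2)

/-- The open half-plane `{x₁ > 0}`. -/
def halfPlane : Set Plane := {x | 0 < x 0}

/-- The classical partial derivative `∂_j f (x)` of a complex-valued function. -/
def partialDeriv (j : Fin 2) (f : Plane → ℂ) (x : Plane) : ℂ :=
  fderiv ℝ f x (EuclideanSpace.single j 1)

/-- `curl F = ∂₁F₂ - ∂₂F₁`. -/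
def planeCurl (F : Plane → Plane) (x : Plane) : ℝ :=
  fderiv ℝ F x (EuclideanSpace.single 0 1) 1 - fderiv ℝ F x (EuclideanSpace.single 1 1) 0

/-- `F` is a real vector potential on `U`, continuously differentiable up to the boundary of `U`,
of the constant magnetic field `1`. -/
def IsUnitFieldPotential (U : Set Plane) (F : Plane → Plane) : Prop :=
  ContDiffOn ℝ 1 F (closure U) ∧ ∀ x ∈ U, planeCurl F x = 1

/-- Complex-valued smooth compactly supported functions on `ℝ²`. Those with `tsupport φ ⊆ U` are
the elements of `C_c^∞(U)`. -/
def IsTestFunction (φ : Plane → ℂ) : Prop :=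
  ContDiff ℝ ∞ φ ∧ HasCompactSupport φ

/-- `f` is square integrable on all bounded parts of `U` (up to the boundary of `U`). -/
def MemL2Loc (U : Set Plane) (f : Plane → ℂ) : Prop :=
  ∀ R : ℝ, MemLp f 2 (volume.restrict (U ∩ Metric.ball 0 R))

/-- `∂_j f = g` in the sense of distributions on `U`. -/
def HasWeakPartial (U : Set Plane) (j : Fin 2) (f g : Plane → ℂ) : Prop :=
  ∀ φ : Plane → ℂ, IsTestFunction φ → tsupport φ ⊆ U →
    ∫ x in U, f x * partialDeriv j φ x = -∫ x in U, g x * φ x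

/-- `f ∈ H²(U ∩ B(0,R))` for all `R`: `f` and its weak partial derivatives of order one and two
are square integrable on all bounded parts of `U`. -/
def MemH2Loc (U : Set Plane) (f : Plane → ℂ) : Prop :=
  MemL2Loc U f ∧ ∃ g : Fin 2 → Plane → ℂ, ∃ h : Fin 2 → Fin 2 → Plane → ℂ,
    (∀ j, MemL2Loc U (g j) ∧ HasWeakPartial U j f (g j)) ∧
    (∀ j k, MemL2Loc U (h j k) ∧ HasWeakPartial U k (g j) (h j k))

/-- The formal transpose `φ ↦ i ∂_j φ + F_j φ` of the magnetic derivative `-i ∂_j + F_j` for the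
bilinear pairing `∫ u φ`. -/
def magneticTranspose (F : Plane → Plane) (j : Fin 2) (φ : Plane → ℂ) (x : Plane) : ℂ :=
  Complex.I * partialDeriv j φ x + (F x j : ℂ) * φ x

/-- `(-i ∂_j + F_j) u = v` in the sense of distributions on `U`. -/
def HasMagneticDeriv (U : Set Plane) (F : Plane → Plane) (j : Fin 2) (u v : Plane → ℂ) : Prop :=
  ∀ φ : Plane → ℂ, IsTestFunction φ → tsupport φ ⊆ U →
    ∫ x in U, u x * magneticTranspose F j φ x = ∫ x in U, v x * φ x

/-- `(-i∇ + F)² u = w` in the sense of distributions on `U`. -/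
def HasMagneticLaplacian (U : Set Plane) (F : Plane → Plane) (u w : Plane → ℂ) : Prop :=
  ∀ φ : Plane → ℂ, IsTestFunction φ → tsupport φ ⊆ U →
    ∫ x in U, u x * ∑ j : Fin 2, magneticTranspose F j (magneticTranspose F j φ) x =
      ∫ x in U, w x * φ x

/-- The field `V` on the half-plane has normal trace `ν · V = τ` on the boundary `{x₁ = 0}`, where
`ν = (-1, 0)` is the outward normal: `V` and its distributional divergence `d` are square integrable
on bounded parts of the half-plane, and the Gauss-Green formula
`∫_{x₁ > 0} (V · ∇η + d η) = ∫_ℝ τ(y) η(0, y) dy` holds for all `η ∈ C_c^∞(ℝ²)`. (Taking `η`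
supported in the open half-plane, `d` is indeed the divergence of `V`. If the components of `V` are
in `H¹` on bounded parts of the half-plane, then `τ` is the usual trace of `ν · V`.) -/
def HasNormalTrace (V : Fin 2 → Plane → ℂ) (τ : ℝ → ℂ) : Prop :=
  (∀ j, MemL2Loc halfPlane (V j)) ∧ LocallyIntegrable τ volume ∧
    ∃ d : Plane → ℂ, MemL2Loc halfPlane d ∧
      ∀ η : Plane → ℂ, IsTestFunction η →
        ∫ x in halfPlane, ((∑ j : Fin 2, V j x * partialDeriv j η x) + d x * η x) =
          ∫ y : ℝ, τ y * η !₂[0, y]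

/-- The magnetic Neumann condition `ν · (-i∇ + F) u = 0` on the boundary of the half-plane. -/
def MagneticNeumann (F : Plane → Plane) (u : Plane → ℂ) : Prop :=
  ∃ V : Fin 2 → Plane → ℂ,
    (∀ j, HasMagneticDeriv halfPlane F j u (V j)) ∧ HasNormalTrace V (fun _ => 0)

/-- The Hilbert space `L²(ℝ²₊)`. -/
abbrev L2HalfPlane : Type := Lp ℂ 2 (volume.restrict halfPlane)

/-- The Neumann realization `ℋ` of `(-i∇ + F)²` on `L²(ℝ²₊)`, given by its graph: `u` is in the
domain and `ℋ u = w` if and only if `u, w ∈ L²(ℝ²₊)`, `(-i∇ + F)² u = w`, and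
`ν · (-i∇ + F) u = 0` on the boundary. -/
def neumannGraph (F : Plane → Plane) : Set (L2HalfPlane × L2HalfPlane) :=
  {p | HasMagneticLaplacian halfPlane F p.1 p.2 ∧ MagneticNeumann F p.1}

/-- The spectrum of the (unbounded) operator `T` on `E` with graph `G`: the set of those `z` for
which `T - z : D(T) → E` does not have an everywhere defined bounded inverse `R`, that is, an `R`
with `u ∈ D(T)` and `(T - z) u = f` if and only if `u = R f`. -/
def graphSpectrum {E : Type*} [NormedAddCommGroup E] [NormedSpace ℂ E] (G : Set (E × E)) : Set ℂ :=
  {z | ¬ ∃ R : E →L[ℂ] E, ∀ u f : E, (u, f + z • u) ∈ G ↔ u = R f}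

/-- `Θ₀ = inf Spec ℋ`. The operator `ℋ` is self-adjoint, so that its spectrum is real. Potentials
`F` of the same field `1` are related by a gauge transformation, so the number is the same for all
of them. -/
def thetaZero (F : Plane → Plane) : ℝ :=
  sInf {t : ℝ | (t : ℂ) ∈ graphSpectrum (neumannGraph F)}

end

open Filter Topology
open scoped Convolution ComplexConjugate

noncomputable section

/-! Write D_j = -i∂_j + F_j, and let ψ be bounded by M with (-i∇+F)²ψ = w, where w = (l - b|ψ|²)ψ
and b ≥ 0. For a real cutoff χ, pairing the equation with χ²ψ gives the localization formula ∑_j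
∫|D_j(χψ)|² = Re ∫ w χ² conj ψ + ∫ |∇χ|²|ψ|². If the quadratic form on functions of bounded support
is at least θ times the squared norm, then ∫ χ² (θ - l + b|ψ|²)|ψ|² ≤ M² ∫ |∇χ|². In dimension two
there are cutoffs that are 1 on ever larger discs and have Dirichlet energy tending to 0: averages
of bumps over n + 1 dyadic scales (`logCutoff`). So the left-hand density vanishes, and ψ = 0 as
soon as l ≤ θ and one of l < θ, b > 0 holds (`ae_eq_zero_of_integral_sq_mul_le_gradSq`,
`ae_eq_zero_of_energy_le`). What remains is the energy inequality, with the right θ.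

Plane, θ = 1. The lower bound is the commutator estimate: D_1 and D_2 commute up to ±i curl F
(`integral_norm_sq_le_magneticTranspose`). The equation is only distributional, so D_jψ need not be
a function a priori. The equation is mollified instead: the error is a flux in divergence form plus
a source, and the flux tends to 0 in L²_loc. Young's inequality absorbs the flux into the energy, so
no bound on the gradients of the mollifications is needed (`integral_mollify_weak`,
`energy_le_of_flux`, `HasMagneticLaplacian.energy_le`).

Half-plane, θ = max(Θ₀, 0). The Neumann condition supplies D_jψ in L²_loc and a weak equation tested
on all of C_c^∞(ℝ²). Kernels supported in {x₁ < 0} regularize up to the boundary, which extends the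
weak equation to test functions in the magnetic Sobolev space (`IsNeumannSolution.green`). If Θ₀ >
0, the resolvent R at -1 exists; the energy formula makes it positive, hence self-adjoint, and the
absence of spectrum below Θ₀ yields ‖R‖ ≤ 1/(Θ₀+1) (`norm_resolvent_le`). A duality argument turns
this into the form bound (`thetaZero_mul_integral_norm_sq_le`). If Θ₀ ≤ 0, nonnegativity of the form
is enough. Positivity of Θ₀ is never proved: in the degenerate case l = b = 0 the same cutoff
argument gives D_jψ = 0, and the commutator then gives ψ = 0. -/

/-! ### Mollification and its convergence in L² -/

/-- Convolution of a complex-valued function on the plane with a real kernel. -/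
def smear (k : Plane → ℝ) (f : Plane → ℂ) : Plane → ℂ :=
  k ⋆[ContinuousLinearMap.lsmul ℝ ℝ, volume] f

theorem smear_apply (k : Plane → ℝ) (f : Plane → ℂ) (x : Plane) :
    smear k f x = ∫ t, k t • f (x - t) := rfl

theorem smear_apply_swap (k : Plane → ℝ) (f : Plane → ℂ) (x : Plane) :
    smear k f x = ∫ z, k (x - z) • f z := convolution_lsmul_swap ..

theorem contDiff_smear {k : Plane → ℝ} (hk : ContDiff ℝ ∞ k) (hks : HasCompactSupport k)
    {f : Plane → ℂ} (hf : LocallyIntegrable f) : ContDiff ℝ ∞ (smear k f) :=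
  hks.contDiff_convolution_left _ hk hf

theorem partialDeriv_smear {k : Plane → ℝ} (hk : ContDiff ℝ ∞ k) (hks : HasCompactSupport k)
    {f : Plane → ℂ} (hf : LocallyIntegrable f) (j : Fin 2) :
    partialDeriv j (smear k f) =
      smear (fun y => fderiv ℝ k y (EuclideanSpace.single j 1)) f := by
  ext x
  have hd := hks.hasFDerivAt_convolution_left (ContinuousLinearMap.lsmul ℝ ℝ : ℝ →L[ℝ] ℂ →L[ℝ] ℂ)
    (hk.of_le (by simp)) hf x
  unfold partialDeriv smear
  rw [hd.fderiv]
  have hint := (hks.fderiv ℝ).convolutionExists_left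
    ((ContinuousLinearMap.lsmul ℝ ℝ : ℝ →L[ℝ] ℂ →L[ℝ] ℂ).precompL Plane)
    (hk.continuous_fderiv (by simp)) hf x
  exact (ContinuousLinearMap.integral_apply hint _)

theorem continuous_fderiv_apply {k : Plane → ℝ} (hk : ContDiff ℝ ∞ k) (v : Plane) :
    ContDiff ℝ ∞ (fun y => fderiv ℝ k y v) :=
  (hk.fderiv_right (m := ∞) (by simp)).clm_apply contDiff_const

/-- The mollification error at x is the mean of f(x - t) - f(x) over the probability measure k(t)
dt. Jensen's inequality bounds its square by the mean square, and Tonelli moves the x-integral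
inside. -/
theorem lintegral_sq_enorm_smear_sub_le {k : Plane → ℝ} (hk : Continuous k) (hk0 : ∀ x, 0 ≤ k x)
    (hk1 : ∫ x, k x = 1) {f : Plane → ℂ} (hf : MemLp f 2) {δ : ℝ≥0∞}
    (hδ : ∀ t ∈ Function.support k, ∫⁻ x, ‖f (x - t) - f x‖ₑ ^ 2 ≤ δ)
    (hks : HasCompactSupport k) :
    ∫⁻ x, ‖smear k f x - f x‖ₑ ^ 2 ≤ δ := by
  -- Tonelli needs joint measurability of (x, t) ↦ f(x - t), hence an everywhere measurable
  -- representative.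
  wlog hfm : StronglyMeasurable f generalizing f
  · obtain ⟨g, hg, hfg⟩ := hf.1
    have h1 : smear k f = smear k g := convolution_congr _ (ae_eq_refl _) hfg
    have h2 : ∀ t : Plane, (fun x => f (x - t)) =ᵐ[volume] fun x => g (x - t) := fun t =>
      (measurePreserving_sub_right volume t).quasiMeasurePreserving.ae_eq_comp hfg
    have := this (f := g) (hf.ae_eq hfg) (fun t ht => by
      refine le_trans (le_of_eq ?_) (hδ t ht)
      apply lintegral_congr_ae
      filter_upwards [h2 t, hfg] with x hx hx'
      rw [hx, hx']) hg
    refine le_trans (le_of_eq ?_) this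
    apply lintegral_congr_ae
    filter_upwards [hfg] with x hx
    rw [h1, hx]
  have hkm : Measurable (fun t => ENNReal.ofReal (k t)) := hk.measurable.ennreal_ofReal
  have hmass : ∫⁻ t, ENNReal.ofReal (k t) = 1 := by
    rw [← ofReal_integral_eq_lintegral_ofReal (hk.integrable_of_hasCompactSupport hks)
      (ae_of_all _ hk0), hk1, ENNReal.ofReal_one]
  set ν : Measure Plane := volume.withDensity (fun t => ENNReal.ofReal (k t)) with hν
  have hprob : IsProbabilityMeasure ν := ⟨by rw [hν, withDensity_apply _ MeasurableSet.univ]; simpa⟩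
  have hfl : LocallyIntegrable f := hf.locallyIntegrable (by norm_num)
  have key : ∀ x, ‖smear k f x - f x‖ₑ ^ 2 ≤
      ∫⁻ t, ENNReal.ofReal (k t) * ‖f (x - t) - f x‖ₑ ^ 2 := by
    intro x
    have hi1 : Integrable (fun t => k t • f (x - t)) := hks.convolutionExists_left
      (ContinuousLinearMap.lsmul ℝ ℝ : ℝ →L[ℝ] ℂ →L[ℝ] ℂ) hk hfl x
    have hi2 : Integrable (fun t => k t • f x) :=
      (hk.integrable_of_hasCompactSupport hks).smul_const _
    have e1 : smear k f x - f x = ∫ t, k t • (f (x - t) - f x) := by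
      have : f x = ∫ t, k t • f x := by rw [integral_smul_const, hk1, one_smul]
      rw [smear_apply]
      simp only [smul_sub]
      rw [integral_sub hi1 hi2, ← this]
    have hm : Measurable fun t => ‖f (x - t) - f x‖ₑ :=
      ((hfm.measurable.comp (measurable_const.sub measurable_id)).sub_const _).enorm
    have e2 : ‖smear k f x - f x‖ₑ ≤ ∫⁻ t, ‖f (x - t) - f x‖ₑ ∂ν := by
      rw [e1, hν, lintegral_withDensity_eq_lintegral_mul _ hkm hm]
      refine (enorm_integral_le_lintegral_enorm _).trans (le_of_eq ?_)
      apply lintegral_congr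
      intro t
      rw [enorm_smul, Real.enorm_eq_ofReal (hk0 t)]; rfl
    have e3 : (∫⁻ t, ‖f (x - t) - f x‖ₑ ∂ν) ^ 2 ≤ ∫⁻ t, ‖f (x - t) - f x‖ₑ ^ 2 ∂ν := by
      have := eLpNorm_le_eLpNorm_of_exponent_le (μ := ν) (p := 1) (q := 2) (by norm_num)
        (f := fun t => f (x - t) - f x)
        ((hfm.comp_measurable (measurable_const.sub measurable_id)).sub
          stronglyMeasurable_const).aestronglyMeasurable
      rw [eLpNorm_one_eq_lintegral_enorm] at this
      have h2 := pow_le_pow_left₀ (zero_le) this 2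
      refine h2.trans (le_of_eq ?_)
      have := eLpNorm_nnreal_pow_eq_lintegral (μ := ν) (p := 2) (by norm_num)
        (f := fun t => f (x - t) - f x)
      simpa using this
    calc _ ≤ _ := pow_le_pow_left₀ (zero_le) e2 2
      _ ≤ _ := e3
      _ = _ := by rw [hν, lintegral_withDensity_eq_lintegral_mul _ hkm (hm.pow_const 2)]; rfl
  calc ∫⁻ x, ‖smear k f x - f x‖ₑ ^ 2
      ≤ ∫⁻ x, ∫⁻ t, ENNReal.ofReal (k t) * ‖f (x - t) - f x‖ₑ ^ 2 := lintegral_mono key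
    _ = ∫⁻ t, ∫⁻ x, ENNReal.ofReal (k t) * ‖f (x - t) - f x‖ₑ ^ 2 := by
        apply lintegral_lintegral_swap
        have h1 : Measurable fun p : Plane × Plane => f (p.1 - p.2) :=
          hfm.measurable.comp (measurable_fst.sub measurable_snd)
        have h2 : Measurable fun p : Plane × Plane => f p.1 := hfm.measurable.comp measurable_fst
        exact ((hkm.comp measurable_snd).mul ((h1.sub h2).enorm.pow_const 2)).aemeasurable
    _ ≤ ∫⁻ t, ENNReal.ofReal (k t) * δ := by
        apply lintegral_mono
        intro t
        dsimp only
        rw [lintegral_const_mul']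
        · by_cases ht : k t = 0
          · simp [ht]
          · exact mul_le_mul_right (hδ t ht) _
        · exact ENNReal.ofReal_ne_top
    _ = δ := by rw [lintegral_mul_const _ hkm, hmass, one_mul]

/-- Continuity of translations in `L²`. -/
theorem tendsto_lintegral_sq_enorm_translate_sub {f : Plane → ℂ} (hf : MemLp f 2) :
    Tendsto (fun t : Plane => ∫⁻ x, ‖f (x - t) - f x‖ₑ ^ 2) (𝓝 0) (𝓝 0) := by
  let g : Plane → C(Plane, Plane) := fun t => ⟨fun x => x - t, by fun_prop⟩
  have hg : Continuous g :=
    ContinuousMap.continuous_of_continuous_uncurry _ (by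
      simp only [g, Function.uncurry_def, ContinuousMap.coe_mk]; fun_prop)
  have hmp : ∀ t, MeasurePreserving (g t) volume volume := fun t =>
    measurePreserving_sub_right volume t
  have hc : Continuous fun t => Lp.compMeasurePreserving (g t) (hmp t) (hf.toLp f) :=
    continuous_const.compMeasurePreservingLp hg hmp (by norm_num)
  have h1 := hc.tendsto 0
  have h0 : Lp.compMeasurePreserving (g 0) (hmp 0) (hf.toLp f) = hf.toLp f := by
    have : (hf.comp_measurePreserving (hmp 0)).toLp _ = hf.toLp f := by
      congr 1
      ext x; simp [g]
    refine Eq.trans ?_ this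
    rw [Lp.toLp_compMeasurePreserving]
  rw [h0] at h1
  have h2 := (Lp.tendsto_Lp_iff_tendsto_eLpNorm'' _
    (fun t => hf.comp_measurePreserving (hmp t)) f hf).1 h1
  have h3 := ENNReal.Tendsto.pow (n := 2) h2
  simp only [ne_eq, OfNat.ofNat_ne_zero, not_false_eq_true, zero_pow] at h3
  refine h3.congr fun t => ?_
  have := eLpNorm_nnreal_pow_eq_lintegral (μ := (volume : Measure Plane)) (p := 2) (by norm_num)
        (f := f ∘ ⇑(g t) - f)
  simpa [g] using this

/-! ### Kernels supported on one side of the boundary -/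

/-- Smooth bumps shrinking to the origin from the left. -/
def leftBump (n : ℕ) : ContDiffBump (EuclideanSpace.single 0 (-(1 / ((n : ℝ) + 1))) : Plane) where
  rIn := 1 / (4 * ((n : ℝ) + 1))
  rOut := 1 / (2 * ((n : ℝ) + 1))
  rIn_pos := by positivity
  rIn_lt_rOut := by
    apply one_div_lt_one_div_of_lt <;> nlinarith [Nat.cast_nonneg (α := ℝ) n]

/-- The normalized smooth kernels supported in `{x₁ < 0}` that shrink to the origin. -/
def leftKernel (n : ℕ) : Plane → ℝ := (leftBump n).normed volume

/-- Mollification with `leftKernel`; on the half-plane it only involves values of the function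
in the open half-plane. -/
def mollify (n : ℕ) (f : Plane → ℂ) : Plane → ℂ := smear (leftKernel n) f

theorem contDiff_leftKernel (n : ℕ) : ContDiff ℝ ∞ (leftKernel n) := (leftBump n).contDiff_normed

theorem hasCompactSupport_leftKernel (n : ℕ) : HasCompactSupport (leftKernel n) :=
  (leftBump n).hasCompactSupport_normed

theorem norm_coord_le (x : Plane) (i : Fin 2) : |x i| ≤ ‖x‖ := by
  simpa using PiLp.norm_apply_le x i

/-- With ε = 1/(n+1), the bump has centre (-ε, 0) and radius ε/2, so on its support t₁ ≤ -ε/2 and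
|t| ≤ 3ε/2 < 2ε. -/
theorem tsupport_leftKernel_subset (n : ℕ) :
    tsupport (leftKernel n) ⊆ {t | t 0 < 0} ∩ Metric.ball 0 (2 / ((n : ℝ) + 1)) := by
  intro t ht
  rw [leftKernel, (leftBump n).tsupport_normed_eq, mem_closedBall_iff_norm] at ht
  have hr : (leftBump n).rOut = 1 / (2 * ((n : ℝ) + 1)) := rfl
  rw [hr] at ht
  have hn : (0 : ℝ) < (n : ℝ) + 1 := by positivity
  have e : 1 / (2 * ((n : ℝ) + 1)) = (1 / ((n : ℝ) + 1)) / 2 := by field_simp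
  have hp : 0 < 1 / ((n : ℝ) + 1) := by positivity
  rw [e] at ht
  constructor
  · have := (norm_coord_le _ 0).trans ht
    simp only [PiLp.sub_apply, PiLp.single_apply, if_true] at this
    have := (abs_le.1 this).2
    simp only [mem_ofPred_eq]
    linarith
  · rw [mem_ball_zero_iff]
    have h1 := norm_le_norm_add_norm_sub' t (EuclideanSpace.single 0 (-(1 / ((n : ℝ) + 1))) : Plane)
    rw [PiLp.norm_single, norm_neg, Real.norm_of_nonneg hp.le] at h1
    have : 2 / ((n : ℝ) + 1) = 2 * (1 / ((n : ℝ) + 1)) := by ring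
    linarith

theorem leftKernel_nonneg (n : ℕ) (x : Plane) : 0 ≤ leftKernel n x := (leftBump n).nonneg_normed x

theorem integral_leftKernel (n : ℕ) : ∫ x, leftKernel n x = 1 := (leftBump n).integral_normed

theorem tendsto_lintegral_mollify_sub {f : Plane → ℂ} (hf : MemLp f 2) :
    Tendsto (fun n => ∫⁻ x, ‖mollify n f x - f x‖ₑ ^ 2) atTop (𝓝 0) := by
  rw [ENNReal.tendsto_nhds_zero]
  intro ε hε
  have h := (ENNReal.tendsto_nhds_zero.1 (tendsto_lintegral_sq_enorm_translate_sub hf)) ε hε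
  obtain ⟨r, hr, hb⟩ := Metric.eventually_nhds_iff_ball.1 h
  have hlim : Tendsto (fun n : ℕ => 2 / ((n : ℝ) + 1)) atTop (𝓝 0) :=
    tendsto_const_nhds.div_atTop (tendsto_natCast_atTop_atTop.atTop_add tendsto_const_nhds)
  filter_upwards [hlim.eventually (gt_mem_nhds hr)] with n hn
  refine lintegral_sq_enorm_smear_sub_le (contDiff_leftKernel n).continuous (leftKernel_nonneg n)
    (integral_leftKernel n) hf (fun t ht => hb t ?_) (hasCompactSupport_leftKernel n)
  exact Metric.ball_subset_ball hn.le (tsupport_leftKernel_subset n (subset_tsupport _ ht)).2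

theorem tendsto_eLpNorm_mollify_sub {f : Plane → ℂ} (hf : MemLp f 2) :
    Tendsto (fun n => eLpNorm (mollify n f - f) 2 volume) atTop (𝓝 0) := by
  have h := (tendsto_lintegral_mollify_sub hf)
  have h2 : ∀ n, ∫⁻ x, ‖mollify n f x - f x‖ₑ ^ 2 = eLpNorm (mollify n f - f) 2 volume ^ 2 := by
    intro n
    have := eLpNorm_nnreal_pow_eq_lintegral (μ := (volume : Measure Plane)) (p := 2) (by norm_num)
        (f := mollify n f - f)
    simpa using this.symm
  simp_rw [h2] at h
  have h3 := (ENNReal.continuous_rpow_const (y := (1 / 2 : ℝ))).tendsto _ |>.comp h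
  simp only [ENNReal.zero_rpow_of_pos (show (0 : ℝ) < 1 / 2 by norm_num)] at h3
  refine h3.congr fun n => ?_
  simp only [Function.comp]
  rw [← ENNReal.rpow_natCast, ← ENNReal.rpow_mul]
  norm_num

theorem memLp_mollify {f : Plane → ℂ} (hf : MemLp f 2) (n : ℕ) : MemLp (mollify n f) 2 := by
  have hc : Continuous (mollify n f) := (contDiff_smear (contDiff_leftKernel n)
    (hasCompactSupport_leftKernel n) (hf.locallyIntegrable (by norm_num))).continuous
  -- Translations preserve the L² norm, so the triangle inequality gives a bound uniform in t;
  -- finiteness is all that is needed.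
  have hδ : ∀ t ∈ Function.support (leftKernel n),
      ∫⁻ x, ‖f (x - t) - f x‖ₑ ^ 2 ≤ (2 * eLpNorm f 2 volume) ^ 2 := by
    intro t _
    have hmp := measurePreserving_sub_right (volume : Measure Plane) t
    have := eLpNorm_nnreal_pow_eq_lintegral (μ := (volume : Measure Plane)) (p := 2) (by norm_num)
        (f := fun x => f (x - t) - f x)
    have h0 : ∫⁻ x, ‖f (x - t) - f x‖ₑ ^ 2 = eLpNorm (fun x => f (x - t) - f x) 2 volume ^ 2 := by
      simpa using this.symm
    rw [h0]
    apply pow_le_pow_left₀ (zero_le)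
    refine (eLpNorm_sub_le (hf.comp_measurePreserving hmp).1 hf.1 (by norm_num)).trans ?_
    rw [eLpNorm_comp_measurePreserving hf.1 hmp, two_mul]
  have h := lintegral_sq_enorm_smear_sub_le (contDiff_leftKernel n).continuous
    (leftKernel_nonneg n) (integral_leftKernel n) hf hδ (hasCompactSupport_leftKernel n)
  have h1 : MemLp (mollify n f - f) 2 := by
    refine ⟨hc.aestronglyMeasurable.sub hf.1, ?_⟩
    have := eLpNorm_nnreal_pow_eq_lintegral (μ := (volume : Measure Plane)) (p := 2) (by norm_num)
        (f := mollify n f - f)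
    have h2 : eLpNorm (mollify n f - f) 2 volume ^ 2 = ∫⁻ x, ‖mollify n f x - f x‖ₑ ^ 2 := by
      simpa using this
    have h3 : eLpNorm (mollify n f - f) 2 volume ^ 2 < ⊤ := by
      rw [h2]
      exact h.trans_lt (ENNReal.pow_lt_top (ENNReal.mul_lt_top (by norm_num) hf.2))
    exact (ENNReal.pow_lt_top_iff.1 h3).resolve_right (by norm_num)
  simpa using h1.add hf

/-! ### Limits of pairings in `L²` -/

theorem tendsto_integral_conj_mul {α : Type*} [MeasurableSpace α] {μ : Measure α}
    {f g : ℕ → α → ℂ} {f₀ g₀ : α → ℂ}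
    (hf : ∀ n, MemLp (f n) 2 μ) (hf₀ : MemLp f₀ 2 μ) (hg : ∀ n, MemLp (g n) 2 μ)
    (hg₀ : MemLp g₀ 2 μ) (hfl : Tendsto (fun n => eLpNorm (f n - f₀) 2 μ) atTop (𝓝 0))
    (hgl : Tendsto (fun n => eLpNorm (g n - g₀) 2 μ) atTop (𝓝 0)) :
    Tendsto (fun n => ∫ x, conj (f n x) * g n x ∂μ) atTop (𝓝 (∫ x, conj (f₀ x) * g₀ x ∂μ)) := by
  have h1 := (Lp.tendsto_Lp_iff_tendsto_eLpNorm'' f hf f₀ hf₀).2 hfl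
  have h2 := (Lp.tendsto_Lp_iff_tendsto_eLpNorm'' g hg g₀ hg₀).2 hgl
  have h3 := Filter.Tendsto.inner (𝕜 := ℂ) h1 h2
  have e : ∀ {u v : α → ℂ} (hu : MemLp u 2 μ) (hv : MemLp v 2 μ),
      inner ℂ (hu.toLp u) (hv.toLp v) = ∫ x, conj (u x) * v x ∂μ := by
    intro u v hu hv
    rw [L2.inner_def]
    apply integral_congr_ae
    filter_upwards [hu.coeFn_toLp, hv.coeFn_toLp] with x hx hx'
    rw [hx, hx', RCLike.inner_apply, mul_comm]
  simpa only [e] using h3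

theorem MeasureTheory.MemLp.conj {α : Type*} [MeasurableSpace α] {μ : Measure α} {p : ℝ≥0∞}
    {f : α → ℂ} (hf : MemLp f p μ) : MemLp (fun x => conj (f x)) p μ :=
  hf.of_le (Complex.continuous_conj.comp_aestronglyMeasurable hf.1)
    (ae_of_all _ fun x => by simp)

theorem eLpNorm_conj_sub {α : Type*} [MeasurableSpace α] {μ : Measure α} (f g : α → ℂ) :
    eLpNorm ((fun x => conj (f x)) - fun x => conj (g x)) 2 μ = eLpNorm (f - g) 2 μ := by
  apply eLpNorm_congr_norm_ae
  refine ae_of_all _ fun x => ?_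
  simp only [Pi.sub_apply]
  rw [← map_sub, RCLike.norm_conj]

theorem tendsto_integral_mul {α : Type*} [MeasurableSpace α] {μ : Measure α}
    {f g : ℕ → α → ℂ} {f₀ g₀ : α → ℂ}
    (hf : ∀ n, MemLp (f n) 2 μ) (hf₀ : MemLp f₀ 2 μ) (hg : ∀ n, MemLp (g n) 2 μ)
    (hg₀ : MemLp g₀ 2 μ) (hfl : Tendsto (fun n => eLpNorm (f n - f₀) 2 μ) atTop (𝓝 0))
    (hgl : Tendsto (fun n => eLpNorm (g n - g₀) 2 μ) atTop (𝓝 0)) :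
    Tendsto (fun n => ∫ x, f n x * g n x ∂μ) atTop (𝓝 (∫ x, f₀ x * g₀ x ∂μ)) := by
  have := tendsto_integral_conj_mul (fun n => (hf n).conj) hf₀.conj hg hg₀
    (by simpa only [eLpNorm_conj_sub] using hfl) hgl
  simpa using this

/-! ### Cutoff functions of small Dirichlet energy -/

/-- The squared length of the gradient of a real function. -/
def gradSq (χ : Plane → ℝ) (x : Plane) : ℝ :=
  ∑ j : Fin 2, fderiv ℝ χ x (EuclideanSpace.single j 1) ^ 2

theorem gradSq_nonneg (χ : Plane → ℝ) (x : Plane) : 0 ≤ gradSq χ x :=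
  Finset.sum_nonneg fun _ _ => sq_nonneg _

theorem gradSq_le (χ : Plane → ℝ) (x : Plane) : gradSq χ x ≤ 2 * ‖fderiv ℝ χ x‖ ^ 2 := by
  have : ∀ j : Fin 2, fderiv ℝ χ x (EuclideanSpace.single j 1) ^ 2 ≤ ‖fderiv ℝ χ x‖ ^ 2 := by
    intro j
    rw [← sq_abs]
    apply pow_le_pow_left₀ (abs_nonneg _)
    have := (fderiv ℝ χ x).le_opNorm (EuclideanSpace.single j 1)
    simpa using this
  simp only [gradSq, Fin.sum_univ_two]
  linarith [this 0, this 1]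

theorem continuous_gradSq {χ : Plane → ℝ} (hχ : ContDiff ℝ ∞ χ) : Continuous (gradSq χ) :=
  continuous_finsetSum _ fun _ _ => (continuous_fderiv_apply hχ _).continuous.pow 2

theorem hasCompactSupport_gradSq {χ : Plane → ℝ} (hs : HasCompactSupport χ) :
    HasCompactSupport (gradSq χ) :=
  (hs.fderiv ℝ).mono fun x hx => by
    contrapose! hx
    simp only [Function.mem_support, not_not] at hx ⊢
    simp [gradSq, hx]

/-- A smooth bump equal to `1` on the unit disc and supported in the disc of radius `2`. -/
def discBump : ContDiffBump (0 : Plane) := ⟨1, 2, one_pos, one_lt_two⟩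

/-- On the closed unit disc the bump attains its maximum and for |y| ≥ 2 its minimum, so the
derivative also vanishes on the bounding circles. The strict inequalities make the dyadic annuli
disjoint. -/
theorem annulus_of_fderiv_discBump_ne_zero {y : Plane} (hy : fderiv ℝ discBump y ≠ 0) :
    1 < ‖y‖ ∧ ‖y‖ < 2 := by
  by_contra hcon
  rw [not_and_or, not_lt, not_lt] at hcon
  apply hy
  rcases hcon with h | h
  · apply IsLocalMax.fderiv_eq_zero
    refine Eventually.of_forall fun z => ?_
    rw [discBump.one_of_mem_closedBall (x := y) (by simpa [discBump] using h)]
    exact discBump.le_one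
  · apply IsLocalMin.fderiv_eq_zero
    refine Eventually.of_forall fun z => ?_
    rw [discBump.zero_of_le_dist (x := y) (by simpa [discBump] using h)]
    exact discBump.nonneg

/-- The bump `discBump` at scale `2 ^ k`. -/
def dyadicBump (k : ℕ) (x : Plane) : ℝ := discBump (((2 : ℝ) ^ k)⁻¹ • x)

theorem contDiff_dyadicBump (k : ℕ) : ContDiff ℝ ∞ (dyadicBump k) :=
  discBump.contDiff.comp (contDiff_const_smul _)

theorem hasCompactSupport_dyadicBump (k : ℕ) : HasCompactSupport (dyadicBump k) :=
  discBump.hasCompactSupport.comp_smul (inv_ne_zero (by positivity))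

theorem fderiv_dyadicBump (k : ℕ) (x : Plane) :
    fderiv ℝ (dyadicBump k) x = ((2 : ℝ) ^ k)⁻¹ • fderiv ℝ discBump (((2 : ℝ) ^ k)⁻¹ • x) :=
  fderiv_comp_smul _

theorem annulus_of_fderiv_dyadicBump_ne_zero {k : ℕ} {x : Plane}
    (hx : fderiv ℝ (dyadicBump k) x ≠ 0) : 2 ^ k < ‖x‖ ∧ ‖x‖ < 2 ^ (k + 1) := by
  rw [fderiv_dyadicBump] at hx
  have h1 := annulus_of_fderiv_discBump_ne_zero (right_ne_zero_of_smul hx)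
  rw [norm_smul, norm_inv, norm_pow, Real.norm_of_nonneg (by norm_num : (0 : ℝ) ≤ 2),
    inv_mul_eq_div, one_lt_div (by positivity), div_lt_iff₀ (by positivity)] at h1
  exact ⟨h1.1, by rw [pow_succ]; linarith [h1.2]⟩

theorem eq_of_fderiv_dyadicBump_ne_zero {k l : ℕ} {x : Plane}
    (hk : fderiv ℝ (dyadicBump k) x ≠ 0) (hl : fderiv ℝ (dyadicBump l) x ≠ 0) : k = l := by
  have h1 := annulus_of_fderiv_dyadicBump_ne_zero hk
  have h2 := annulus_of_fderiv_dyadicBump_ne_zero hl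
  have a1 : k < l + 1 := (pow_lt_pow_iff_right₀ (one_lt_two (α := ℝ))).1 (h1.1.trans h2.2)
  have a2 : l < k + 1 := (pow_lt_pow_iff_right₀ (one_lt_two (α := ℝ))).1 (h2.1.trans h1.2)
  omega

/-- Scale invariance of the Dirichlet energy in dimension two: the factor 2^(-2k) from the squared
gradient cancels the Jacobian 2^(2k). -/
theorem integral_norm_sq_fderiv_dyadicBump (k : ℕ) :
    ∫ x, ‖fderiv ℝ (dyadicBump k) x‖ ^ 2 = ∫ x, ‖fderiv ℝ discBump x‖ ^ 2 := by
  simp only [fderiv_dyadicBump, norm_smul, mul_pow]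
  rw [integral_const_mul]
  have := Measure.integral_comp_smul (volume : Measure Plane)
    (fun y => ‖fderiv ℝ discBump y‖ ^ 2) (((2 : ℝ) ^ k)⁻¹)
  rw [this, finrank_euclideanSpace_fin, smul_eq_mul, ← mul_assoc]
  have hp : (0 : ℝ) < 2 ^ k := by positivity
  rw [abs_of_pos (by positivity), Real.norm_of_nonneg (by positivity)]
  field_simp

theorem exists_norm_fderiv_dyadicBump_le :
    ∃ C, ∀ k x, ‖fderiv ℝ (dyadicBump k) x‖ ≤ C := by
  have hd : ContDiff ℝ ∞ (discBump : Plane → ℝ) := discBump.contDiff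
  obtain ⟨C, hC⟩ := (discBump.hasCompactSupport.fderiv ℝ).exists_bound_of_continuous
    (hd.continuous_fderiv (by simp))
  refine ⟨C, fun k x => ?_⟩
  rw [fderiv_dyadicBump, norm_smul]
  have h1 : ‖((2 : ℝ) ^ k)⁻¹‖ ≤ 1 := by
    rw [Real.norm_of_nonneg (by positivity)]
    exact inv_le_one_of_one_le₀ (one_le_pow₀ one_le_two)
  exact (mul_le_of_le_one_left (norm_nonneg _) h1).trans (hC _)

/-- The average of `n + 1` dyadic bumps at scales `2 ^ n, …, 2 ^ (2 n)`. -/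
def logCutoff (n : ℕ) (x : Plane) : ℝ :=
  ((n : ℝ) + 1)⁻¹ * ∑ k ∈ Finset.Ico n (2 * n + 1), dyadicBump k x

theorem card_dyadic_range (n : ℕ) : ((Finset.Ico n (2 * n + 1)).card : ℝ) = (n : ℝ) + 1 := by
  rw [Nat.card_Ico, show 2 * n + 1 - n = n + 1 by omega]
  push_cast
  ring

theorem contDiff_logCutoff (n : ℕ) : ContDiff ℝ ∞ (logCutoff n) :=
  contDiff_const.mul (ContDiff.sum fun k _ => contDiff_dyadicBump k)

theorem hasCompactSupport_logCutoff (n : ℕ) : HasCompactSupport (logCutoff n) := by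
  have : HasCompactSupport fun x => ∑ k ∈ Finset.Ico n (2 * n + 1), dyadicBump k x := by
    induction Finset.Ico n (2 * n + 1) using Finset.induction_on with
    | empty =>
      simp only [Finset.sum_empty]
      exact HasCompactSupport.zero
    | insert a s ha ih =>
      simp only [Finset.sum_insert ha]
      exact (hasCompactSupport_dyadicBump a).add ih
  exact this.mul_left

theorem logCutoff_nonneg (n : ℕ) (x : Plane) : 0 ≤ logCutoff n x :=
  mul_nonneg (by positivity) (Finset.sum_nonneg fun _ _ => discBump.nonneg)

theorem logCutoff_le_one (n : ℕ) (x : Plane) : logCutoff n x ≤ 1 := by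
  have hn : (0 : ℝ) < (n : ℝ) + 1 := by positivity
  have : ∑ k ∈ Finset.Ico n (2 * n + 1), dyadicBump k x ≤ (n : ℝ) + 1 := by
    rw [← card_dyadic_range n]
    simpa using Finset.sum_le_card_nsmul (Finset.Ico n (2 * n + 1)) (fun k => dyadicBump k x) 1
      fun k _ => discBump.le_one
  calc _ ≤ ((n : ℝ) + 1)⁻¹ * ((n : ℝ) + 1) := mul_le_mul_of_nonneg_left this (by positivity)
    _ = 1 := inv_mul_cancel₀ hn.ne'

theorem logCutoff_eq_one {n : ℕ} {x : Plane} (hx : ‖x‖ ≤ n) : logCutoff n x = 1 := by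
  have hn : (0 : ℝ) < (n : ℝ) + 1 := by positivity
  have : ∀ k ∈ Finset.Ico n (2 * n + 1), dyadicBump k x = 1 := by
    intro k hk
    apply discBump.one_of_mem_closedBall
    rw [mem_closedBall_zero_iff, norm_smul, Real.norm_of_nonneg (by positivity)]
    have h1 : (n : ℝ) ≤ 2 ^ k := by
      have : n ≤ 2 ^ k := (Nat.lt_two_pow_self (n := n)).le.trans
        (Nat.pow_le_pow_right (by norm_num) (Finset.mem_Ico.1 hk).1)
      exact_mod_cast this
    change ((2 : ℝ) ^ k)⁻¹ * ‖x‖ ≤ 1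
    rw [inv_mul_le_one₀ (by positivity)]
    exact hx.trans h1
  rw [logCutoff, Finset.sum_congr rfl this, Finset.sum_const, nsmul_eq_mul, mul_one,
    card_dyadic_range, inv_mul_cancel₀ hn.ne']

theorem fderiv_logCutoff (n : ℕ) (x : Plane) : fderiv ℝ (logCutoff n) x =
    ((n : ℝ) + 1)⁻¹ • ∑ k ∈ Finset.Ico n (2 * n + 1), fderiv ℝ (dyadicBump k) x :=
  ((HasFDerivAt.fun_sum fun k _ =>
    ((contDiff_dyadicBump k).differentiable (by simp) x).hasFDerivAt).const_mul _).fderiv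

/-- The annuli carrying the gradients are disjoint, so at most one summand is nonzero at x and there
are no cross terms. -/
theorem norm_sum_fderiv_dyadicBump_sq_le (s : Finset ℕ) (x : Plane) :
    ‖∑ k ∈ s, fderiv ℝ (dyadicBump k) x‖ ^ 2 ≤ ∑ k ∈ s, ‖fderiv ℝ (dyadicBump k) x‖ ^ 2 := by
  by_cases h : ∃ k ∈ s, fderiv ℝ (dyadicBump k) x ≠ 0
  · obtain ⟨k, hk, hkx⟩ := h
    rw [Finset.sum_eq_single_of_mem k hk fun l _ hlk => by
      by_contra hl; exact hlk (eq_of_fderiv_dyadicBump_ne_zero hl hkx)]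
    exact Finset.single_le_sum (f := fun k => ‖fderiv ℝ (dyadicBump k) x‖ ^ 2)
      (fun _ _ => sq_nonneg _) hk
  · push Not at h
    rw [Finset.sum_eq_zero h]
    simpa using Finset.sum_nonneg fun k _ => sq_nonneg ‖fderiv ℝ (dyadicBump k) x‖

theorem gradSq_logCutoff_le (n : ℕ) (x : Plane) : gradSq (logCutoff n) x ≤
    2 * ((((n : ℝ) + 1)⁻¹) ^ 2 *
      ∑ k ∈ Finset.Ico n (2 * n + 1), ‖fderiv ℝ (dyadicBump k) x‖ ^ 2) := by
  refine (gradSq_le _ _).trans ?_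
  rw [fderiv_logCutoff, norm_smul, mul_pow, Real.norm_of_nonneg (by positivity)]
  gcongr
  exact norm_sum_fderiv_dyadicBump_sq_le _ _

/-- The uniform bound serves square integrable functions, for which ∫|∇χ|²|u|² must tend to 0;
bounded functions need the integral bound `tendsto_integral_gradSq_logCutoff`. -/
theorem exists_gradSq_logCutoff_le : ∃ C, ∀ (n : ℕ) x,
    gradSq (logCutoff n) x ≤ C / ((n : ℝ) + 1) := by
  obtain ⟨C, hC⟩ := exists_norm_fderiv_dyadicBump_le
  refine ⟨2 * C ^ 2, fun n x => (gradSq_logCutoff_le n x).trans ?_⟩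
  have hn : (0 : ℝ) < (n : ℝ) + 1 := by positivity
  have h : ∑ k ∈ Finset.Ico n (2 * n + 1), ‖fderiv ℝ (dyadicBump k) x‖ ^ 2 ≤
      ((n : ℝ) + 1) * C ^ 2 := by
    rw [← card_dyadic_range n, ← nsmul_eq_mul]
    exact Finset.sum_le_card_nsmul _ _ _ fun k _ => pow_le_pow_left₀ (norm_nonneg _) (hC k x) 2
  calc _ ≤ 2 * ((((n : ℝ) + 1)⁻¹) ^ 2 * (((n : ℝ) + 1) * C ^ 2)) := by gcongr
    _ = _ := by field_simp

/-- The n + 1 bumps contribute equal energies D with disjoint gradients, and the average carries the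
factor (n+1)⁻², so the energy is at most 2D/(n+1). -/
theorem tendsto_integral_gradSq_logCutoff :
    Tendsto (fun n => ∫ x, gradSq (logCutoff n) x) atTop (𝓝 0) := by
  set D : ℝ := ∫ y, ‖fderiv ℝ discBump y‖ ^ 2 with hD
  have hi : ∀ k, Integrable fun x => ‖fderiv ℝ (dyadicBump k) x‖ ^ 2 := fun k =>
    (((contDiff_dyadicBump k).continuous_fderiv (by simp)).norm.pow
      2).integrable_of_hasCompactSupport
      (((hasCompactSupport_dyadicBump k).fderiv ℝ).mono fun x hx => by
        contrapose! hx
        simp only [Function.mem_support, not_not] at hx ⊢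
        simp [hx])
  have hub : ∀ n, ∫ x, gradSq (logCutoff n) x ≤ 2 * D * (1 / ((n : ℝ) + 1)) := by
    intro n
    have hn : (0 : ℝ) < (n : ℝ) + 1 := by positivity
    calc ∫ x, gradSq (logCutoff n) x
        ≤ ∫ x, 2 * ((((n : ℝ) + 1)⁻¹) ^ 2 *
            ∑ k ∈ Finset.Ico n (2 * n + 1), ‖fderiv ℝ (dyadicBump k) x‖ ^ 2) := by
          apply integral_mono_of_nonneg (ae_of_all _ fun x => gradSq_nonneg _ x)
          · exact ((integrable_finsetSum _ fun k _ => hi k).const_mul _).const_mul _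
          · exact ae_of_all _ (gradSq_logCutoff_le n)
      _ = 2 * ((((n : ℝ) + 1)⁻¹) ^ 2 * ∑ k ∈ Finset.Ico n (2 * n + 1), D) := by
          rw [integral_const_mul, integral_const_mul, integral_finsetSum _ fun k _ => hi k]
          simp only [integral_norm_sq_fderiv_dyadicBump, hD]
      _ = _ := by
          rw [Finset.sum_const, nsmul_eq_mul, card_dyadic_range]
          field_simp
  have hl : Tendsto (fun n : ℕ => 2 * D * (1 / ((n : ℝ) + 1))) atTop (𝓝 0) := by
    simpa using tendsto_one_div_add_atTop_nhds_zero_nat.const_mul (2 * D)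
  exact squeeze_zero (fun n => integral_nonneg fun x => gradSq_nonneg _ x) hub hl

/-- The plane has zero capacity at infinity: a nonnegative density that is controlled by the
Dirichlet energy of cutoff functions vanishes. -/
theorem ae_eq_zero_of_integral_sq_mul_le_gradSq {U : Set Plane} {p : Plane → ℝ}
    (hp0 : ∀ x, 0 ≤ p x) (hpi : ∀ R, IntegrableOn p (U ∩ Metric.ball 0 R)) (hU : MeasurableSet U)
    {K : ℝ} (h : ∀ χ : Plane → ℝ, ContDiff ℝ ∞ χ → HasCompactSupport χ →
      ∫ x in U, χ x ^ 2 * p x ≤ K * ∫ x, gradSq χ x) :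
    ∀ᵐ x ∂volume.restrict U, p x = 0 := by
  have hball : ∀ m : ℕ, ∫ x in U ∩ Metric.ball 0 m, p x = 0 := by
    intro m
    refine le_antisymm ?_ (integral_nonneg hp0)
    have hl : Tendsto (fun n => K * ∫ x, gradSq (logCutoff n) x) atTop (𝓝 0) := by
      simpa using tendsto_integral_gradSq_logCutoff.const_mul K
    refine ge_of_tendsto hl ?_
    filter_upwards [eventually_ge_atTop m] with n hn
    refine le_trans ?_ (h (logCutoff n) (contDiff_logCutoff n) (hasCompactSupport_logCutoff n))
    obtain ⟨R, hR⟩ := (hasCompactSupport_logCutoff n).isCompact.isBounded.subset_ball 0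
    have hi : IntegrableOn (fun x => logCutoff n x ^ 2 * p x) U := by
      have h1 : IntegrableOn (fun x => logCutoff n x ^ 2 * p x) (U ∩ Metric.ball 0 R) :=
        (hpi R).bdd_mul (c := 1) ((contDiff_logCutoff n).continuous.pow 2).aestronglyMeasurable
          (ae_of_all _ fun x => by
            rw [Real.norm_of_nonneg (sq_nonneg _)]
            exact pow_le_one₀ (logCutoff_nonneg n x) (logCutoff_le_one n x))
      refine (h1.of_forall_sdiff_eq_zero hU fun x hx => ?_)
      have : logCutoff n x = 0 := by
        by_contra hne
        exact hx.2 ⟨hx.1, hR (subset_tsupport _ hne)⟩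
      simp [this]
    calc ∫ x in U ∩ Metric.ball 0 m, p x = ∫ x in U ∩ Metric.ball 0 m, logCutoff n x ^ 2 * p x := by
          apply setIntegral_congr_fun (hU.inter Metric.isOpen_ball.measurableSet)
          intro x hx
          have : logCutoff n x = 1 := logCutoff_eq_one ((mem_ball_zero_iff.1 hx.2).le.trans (by exact_mod_cast hn))
          simp [this]
      _ ≤ ∫ x in U, logCutoff n x ^ 2 * p x :=
          setIntegral_mono_set hi (ae_of_all _ fun x => mul_nonneg (sq_nonneg _) (hp0 x))
            inter_subset_left.eventuallyLE
  have hae : ∀ m : ℕ, ∀ᵐ x ∂volume.restrict U, x ∈ Metric.ball 0 (m : ℝ) → p x = 0 := by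
    intro m
    have := (integral_eq_zero_iff_of_nonneg hp0 (hpi m)).1 (hball m)
    rw [inter_comm, ← Measure.restrict_restrict Metric.isOpen_ball.measurableSet] at this
    exact (ae_restrict_iff' Metric.isOpen_ball.measurableSet).1 this
  filter_upwards [ae_all_iff.2 hae] with x hx
  obtain ⟨m, hm⟩ := exists_nat_gt ‖x‖
  exact hx m (mem_ball_zero_iff.2 hm)

/-! ### Partial derivatives -/

theorem partialDeriv_mul {f g : Plane → ℂ} {x : Plane} (hf : DifferentiableAt ℝ f x)
    (hg : DifferentiableAt ℝ g x) (j : Fin 2) :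
    partialDeriv j (fun y => f y * g y) x = f x * partialDeriv j g x + partialDeriv j f x * g x := by
  unfold partialDeriv
  rw [fderiv_fun_mul hf hg]
  simp [mul_comm]

theorem partialDeriv_ofReal {χ : Plane → ℝ} {x : Plane} (h : DifferentiableAt ℝ χ x) (j : Fin 2) :
    partialDeriv j (fun y => (χ y : ℂ)) x = (fderiv ℝ χ x (EuclideanSpace.single j 1) : ℂ) := by
  unfold partialDeriv
  have := (Complex.ofRealCLM.hasFDerivAt (x := χ x)).comp x h.hasFDerivAt
  have h2 : HasFDerivAt (fun y => (χ y : ℂ)) (Complex.ofRealCLM.comp (fderiv ℝ χ x)) x := this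
  rw [h2.fderiv]
  rfl

theorem partialDeriv_conj {f : Plane → ℂ} {x : Plane} (h : DifferentiableAt ℝ f x) (j : Fin 2) :
    partialDeriv j (fun y => conj (f y)) x = conj (partialDeriv j f x) := by
  unfold partialDeriv
  have := (Complex.conjCLE.toContinuousLinearMap.hasFDerivAt (x := f x)).comp x h.hasFDerivAt
  have h2 : HasFDerivAt (fun y => conj (f y))
    (Complex.conjCLE.toContinuousLinearMap.comp (fderiv ℝ f x)) x := this
  rw [h2.fderiv]
  rfl

theorem continuous_partialDeriv {f : Plane → ℂ} (hf : ContDiff ℝ 1 f) (j : Fin 2) :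
    Continuous (partialDeriv j f) :=
  (hf.continuous_fderiv one_ne_zero).clm_apply continuous_const

theorem contDiff_partialDeriv {f : Plane → ℂ} (hf : ContDiff ℝ ∞ f) (j : Fin 2) :
    ContDiff ℝ ∞ (partialDeriv j f) :=
  (hf.fderiv_right (m := ∞) (by simp)).clm_apply contDiff_const

theorem tsupport_partialDeriv_subset (f : Plane → ℂ) (j : Fin 2) :
    tsupport (partialDeriv j f) ⊆ tsupport f :=
  closure_minimal (fun x hx => by
    apply support_fderiv_subset ℝ
    rw [Function.mem_support] at hx ⊢
    contrapose! hx
    simp [partialDeriv, hx]) (isClosed_tsupport f)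

theorem HasCompactSupport.partialDeriv {f : Plane → ℂ} (hf : HasCompactSupport f) (j : Fin 2) :
    HasCompactSupport (partialDeriv j f) :=
  hf.of_isClosed_subset (isClosed_tsupport _) (tsupport_partialDeriv_subset f j)

theorem integral_mul_partialDeriv {f g : Plane → ℂ} (hf : ContDiff ℝ 1 f) (hg : ContDiff ℝ 1 g)
    (hs : HasCompactSupport g) (j : Fin 2) :
    ∫ x, f x * partialDeriv j g x = -∫ x, partialDeriv j f x * g x := by
  apply integral_mul_fderiv_eq_neg_fderiv_mul_of_integrable
  · exact ((continuous_partialDeriv hf j).mul hg.continuous).integrable_of_hasCompactSupport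
      hs.mul_left
  · exact (hf.continuous.mul (continuous_partialDeriv hg j)).integrable_of_hasCompactSupport
      (hs.partialDeriv j).mul_left
  · exact (hf.continuous.mul hg.continuous).integrable_of_hasCompactSupport hs.mul_left
  · exact fun x _ => (hf.differentiable one_ne_zero) x
  · exact fun x _ => (hg.differentiable one_ne_zero) x

/-! ### Local square integrability -/

theorem HasCompactSupport.exists_eq_zero_of_norm_le {α : Type*} [Zero α] {f : Plane → α}
    (hf : HasCompactSupport f) : ∃ R, ∀ x, R ≤ ‖x‖ → f x = 0 := by
  obtain ⟨R, hR⟩ := hf.isCompact.isBounded.subset_ball 0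
  refine ⟨R, fun x hx => ?_⟩
  by_contra h
  exact absurd (mem_ball_zero_iff.1 (hR (subset_tsupport _ h))) hx.not_gt

theorem MemL2Loc.memLp_indicator {U : Set Plane} (hU : MeasurableSet U) {a : Plane → ℂ}
    (ha : MemL2Loc U a) (R : ℝ) : MemLp ((U ∩ Metric.ball 0 R).indicator a) 2 :=
  (memLp_indicator_iff_restrict (hU.inter Metric.isOpen_ball.measurableSet)).2 (ha R)

theorem setIntegral_mul_eq_integral_indicator {U : Set Plane} (hU : MeasurableSet U)
    {a g : Plane → ℂ} {R : ℝ} (hg : ∀ x, R ≤ ‖x‖ → g x = 0) :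
    ∫ x in U, a x * g x = ∫ x, (U ∩ Metric.ball 0 R).indicator a x * g x := by
  rw [← integral_indicator hU]
  congr 1
  ext x
  by_cases hx : x ∈ U <;> by_cases hR : x ∈ Metric.ball 0 R
  · simp [hx, hR, indicator]
  · have : g x = 0 := hg x (by simpa using hR)
    simp [this, indicator]
  all_goals simp [hx, indicator]

theorem MemL2Loc.memLp_of_eq_zero {U : Set Plane} (hU : MeasurableSet U) {a : Plane → ℂ}
    (ha : MemL2Loc U a) {R : ℝ} (hz : ∀ x, R ≤ ‖x‖ → a x = 0) :
    MemLp a 2 (volume.restrict U) := by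
  have h := (ha.memLp_indicator hU R)
  rw [← memLp_indicator_iff_restrict hU]
  have e : U.indicator a = (U ∩ Metric.ball 0 R).indicator a := by
    funext x
    by_cases hx : x ∈ U <;> by_cases hR : x ∈ Metric.ball 0 R
    · simp [hx, hR, indicator]
    · have : a x = 0 := hz x (by simpa using hR)
      simp [this, indicator]
    all_goals simp [hx, indicator]
  rwa [e]

theorem MeasureTheory.MemLp.memL2Loc {U : Set Plane} {a : Plane → ℂ}
    (ha : MemLp a 2 (volume.restrict U)) : MemL2Loc U a := fun _ =>
  ha.mono_measure (Measure.restrict_mono inter_subset_left le_rfl)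

theorem MemL2Loc.integrableOn_mul {U : Set Plane} (hU : MeasurableSet U) {a g : Plane → ℂ}
    (ha : MemL2Loc U a) (hg : MemL2Loc U g) {R : ℝ} (hz : ∀ x, R ≤ ‖x‖ → g x = 0) :
    IntegrableOn (fun x => a x * g x) U := by
  have h : IntegrableOn (fun x => a x * g x) (U ∩ Metric.ball 0 R) :=
    (ha R).integrable_mul (hg R)
  refine h.of_forall_sdiff_eq_zero hU fun x hx => ?_
  have : g x = 0 := hz x (by
    by_contra hlt
    exact hx.2 ⟨hx.1, mem_ball_zero_iff.2 (not_le.1 hlt)⟩)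
  simp [this]

theorem ContinuousOn.memL2Loc {U : Set Plane} (hU : MeasurableSet U) {g : Plane → ℂ}
    (hg : ContinuousOn g (closure U)) : MemL2Loc U g := by
  intro R
  have hK : IsCompact (closure U ∩ Metric.closedBall (0 : Plane) R) :=
    (isCompact_closedBall _ _).inter_left isClosed_closure
  obtain ⟨C, hC⟩ := hK.exists_bound_of_continuousOn (hg.mono inter_subset_left)
  have hsub : U ∩ Metric.ball 0 R ⊆ closure U ∩ Metric.closedBall (0 : Plane) R :=
    inter_subset_inter subset_closure Metric.ball_subset_closedBall
  have hm : MeasurableSet (U ∩ Metric.ball (0 : Plane) R) :=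
    hU.inter Metric.isOpen_ball.measurableSet
  have : IsFiniteMeasure (volume.restrict (U ∩ Metric.ball (0 : Plane) R)) :=
    ⟨by
      rw [Measure.restrict_apply_univ]
      exact (measure_mono inter_subset_right).trans_lt measure_ball_lt_top⟩
  exact MemLp.of_bound ((hg.mono (hsub.trans inter_subset_left)).aestronglyMeasurable hm) C
    ((ae_restrict_iff' hm).2 (ae_of_all _ fun x hx => hC x (hsub hx)))

theorem Continuous.memL2Loc {U : Set Plane} (hU : MeasurableSet U) {g : Plane → ℂ}
    (hg : Continuous g) : MemL2Loc U g := ContinuousOn.memL2Loc hU hg.continuousOn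

theorem MemL2Loc.continuousOn_mul {U : Set Plane} (hU : MeasurableSet U) {a g : Plane → ℂ}
    (ha : MemL2Loc U a) (hg : ContinuousOn g (closure U)) :
    MemL2Loc U (fun x => g x * a x) := by
  intro R
  have hK : IsCompact (closure U ∩ Metric.closedBall (0 : Plane) R) :=
    (isCompact_closedBall _ _).inter_left isClosed_closure
  obtain ⟨C, hC⟩ := hK.exists_bound_of_continuousOn (hg.mono inter_subset_left)
  have hsub : U ∩ Metric.ball 0 R ⊆ closure U ∩ Metric.closedBall (0 : Plane) R :=
    inter_subset_inter subset_closure Metric.ball_subset_closedBall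
  have hm : MeasurableSet (U ∩ Metric.ball (0 : Plane) R) :=
    hU.inter Metric.isOpen_ball.measurableSet
  refine MemLp.of_le_mul (c := C) (ha R)
    (((hg.mono (hsub.trans inter_subset_left)).aestronglyMeasurable hm).mul (ha R).1)
    ((ae_restrict_iff' hm).2 (ae_of_all _ fun x hx => ?_))
  rw [norm_mul]
  exact mul_le_mul_of_nonneg_right (hC x (hsub hx)) (norm_nonneg _)

theorem MemL2Loc.continuous_mul {U : Set Plane} (hU : MeasurableSet U) {a g : Plane → ℂ}
    (ha : MemL2Loc U a) (hg : Continuous g) : MemL2Loc U (fun x => g x * a x) :=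
  ha.continuousOn_mul hU hg.continuousOn

theorem MemL2Loc.add {U : Set Plane} {a b : Plane → ℂ} (ha : MemL2Loc U a) (hb : MemL2Loc U b) :
    MemL2Loc U (fun x => a x + b x) := fun R => (ha R).add (hb R)

theorem MemL2Loc.sub {U : Set Plane} {a b : Plane → ℂ} (ha : MemL2Loc U a) (hb : MemL2Loc U b) :
    MemL2Loc U (fun x => a x - b x) := fun R => (ha R).sub (hb R)

theorem MemL2Loc.const_mul {U : Set Plane} {a : Plane → ℂ} (ha : MemL2Loc U a) (c : ℂ) :
    MemL2Loc U (fun x => c * a x) := fun R => (ha R).const_mul c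

theorem MemL2Loc.conj {U : Set Plane} {a : Plane → ℂ} (ha : MemL2Loc U a) :
    MemL2Loc U (fun x => conj (a x)) := fun R => (ha R).conj

/-- Multiplication by the components of a vector potential preserves local square
integrability. -/
theorem IsUnitFieldPotential.memL2Loc_mul {U : Set Plane} (hU : MeasurableSet U)
    {F : Plane → Plane} (hF : IsUnitFieldPotential U F) {a : Plane → ℂ} (ha : MemL2Loc U a)
    (j : Fin 2) : MemL2Loc U (fun x => (F x j : ℂ) * a x) := by
  refine ha.continuousOn_mul hU ?_
  have h1 : ContinuousOn F (closure U) := hF.1.continuousOn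
  have h2 : Continuous fun y : Plane => ((y j : ℝ) : ℂ) := by fun_prop
  exact h2.comp_continuousOn h1

/-! ### Mollification and pairings -/

theorem mollify_eq_zero {f : Plane → ℂ} {R : ℝ} (hf : ∀ x, R ≤ ‖x‖ → f x = 0) (n : ℕ) {x : Plane}
    (hx : R + 2 ≤ ‖x‖) : mollify n f x = 0 := by
  rw [mollify, smear_apply]
  refine integral_eq_zero_of_ae (ae_of_all _ fun t => ?_)
  by_cases ht : leftKernel n t = 0
  · simp [ht]
  · have h1 := (tsupport_leftKernel_subset n (subset_tsupport _ ht)).2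
    rw [mem_ball_zero_iff] at h1
    have h2 : 2 / ((n : ℝ) + 1) ≤ 2 := div_le_self zero_le_two (by
      linarith [Nat.cast_nonneg (α := ℝ) n])
    have h3 := norm_sub_norm_le x t
    have : f (x - t) = 0 := hf _ (by linarith)
    simp [this]

theorem contDiff_mollify {f : Plane → ℂ} (hf : LocallyIntegrable f) (n : ℕ) :
    ContDiff ℝ ∞ (mollify n f) :=
  contDiff_smear (contDiff_leftKernel n) (hasCompactSupport_leftKernel n) hf

theorem isTestFunction_mollify {f : Plane → ℂ} (hf : LocallyIntegrable f) {R : ℝ}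
    (hz : ∀ x, R ≤ ‖x‖ → f x = 0) (n : ℕ) : IsTestFunction (mollify n f) :=
  ⟨contDiff_mollify hf n, HasCompactSupport.intro (isCompact_closedBall 0 (R + 2)) fun x hx =>
    mollify_eq_zero hz n (by
      rw [mem_closedBall_zero_iff, not_le] at hx
      exact hx.le)⟩

/-- Since f and all its mollifications vanish beyond radius R + 2, only the restriction of a to a
bounded set matters, and the pairing is an inner product in L²(ℝ²). -/
theorem tendsto_setIntegral_mul_mollify {U : Set Plane} (hU : MeasurableSet U) {a f : Plane → ℂ}
    (ha : MemL2Loc U a) (hf : MemLp f 2) {R : ℝ} (hz : ∀ x, R ≤ ‖x‖ → f x = 0) :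
    Tendsto (fun n => ∫ x in U, a x * mollify n f x) atTop (𝓝 (∫ x in U, a x * f x)) := by
  have h1 : ∀ n, ∫ x in U, a x * mollify n f x =
      ∫ x, (U ∩ Metric.ball 0 (R + 2)).indicator a x * mollify n f x := fun n =>
    setIntegral_mul_eq_integral_indicator hU fun x hx => mollify_eq_zero hz n hx
  have h2 : ∫ x in U, a x * f x = ∫ x, (U ∩ Metric.ball 0 (R + 2)).indicator a x * f x :=
    setIntegral_mul_eq_integral_indicator hU fun x hx => hz x (by linarith)
  simp only [h1, h2]
  have hm := ha.memLp_indicator hU (R + 2)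
  exact tendsto_integral_mul (fun _ => hm) hm (memLp_mollify hf) hf (by simp)
    (tendsto_eLpNorm_mollify_sub hf)

theorem IsUnitFieldPotential.integrableOn_mul_magneticTranspose {U : Set Plane}
    (hU : MeasurableSet U) {F : Plane → Plane} (hF : IsUnitFieldPotential U F) {a φ : Plane → ℂ}
    (ha : MemL2Loc U a) (hφ : ContDiff ℝ 1 φ) (hs : HasCompactSupport φ) (j : Fin 2) :
    IntegrableOn (fun x => a x * magneticTranspose F j φ x) U := by
  obtain ⟨R, hR⟩ := hs.exists_eq_zero_of_norm_le
  obtain ⟨R', hR'⟩ := (hs.partialDeriv j).exists_eq_zero_of_norm_le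
  have h1 := (ha.const_mul Complex.I).integrableOn_mul hU
    ((continuous_partialDeriv hφ j).memL2Loc hU) hR'
  have h2 := (hF.memL2Loc_mul hU ha j).integrableOn_mul hU (hφ.continuous.memL2Loc hU) hR
  refine (h1.add h2).congr_fun (fun x _ => ?_) hU
  simp only [magneticTranspose, Pi.add_apply]
  ring

/-- Differentiation has to commute with mollification only on U. This covers C¹ functions of compact
support, and also extensions by zero from the half-plane, whose jump at the boundary the one-sided
kernels do not see. -/
theorem IsUnitFieldPotential.tendsto_setIntegral_mul_magneticTranspose_mollify {U : Set Plane}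
    (hU : MeasurableSet U) {F : Plane → Plane} (hF : IsUnitFieldPotential U F)
    {a f g : Plane → ℂ} (ha : MemL2Loc U a) (hf : MemLp f 2) (hg : MemLp g 2) {R : ℝ}
    (hfz : ∀ x, R ≤ ‖x‖ → f x = 0) (hgz : ∀ x, R ≤ ‖x‖ → g x = 0) {j : Fin 2}
    (hd : ∀ n, ∀ x ∈ U, partialDeriv j (mollify n f) x = mollify n g x) :
    Tendsto (fun n => ∫ x in U, a x * magneticTranspose F j (mollify n f) x) atTop
      (𝓝 (∫ x in U, a x * (Complex.I * g x + (F x j : ℂ) * f x))) := by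
  have h1 := tendsto_setIntegral_mul_mollify hU (ha.const_mul Complex.I) hg hgz
  have h2 := tendsto_setIntegral_mul_mollify hU (hF.memL2Loc_mul hU ha j) hf hfz
  have hlim := h1.add h2
  have hfl : MemL2Loc U f := fun R => hf.restrict _
  have hgl : MemL2Loc U g := fun R => hg.restrict _
  rw [← integral_add ((ha.const_mul Complex.I).integrableOn_mul hU hgl hgz)
    ((hF.memL2Loc_mul hU ha j).integrableOn_mul hU hfl hfz)] at hlim
  have e2 : ∫ x in U, a x * (Complex.I * g x + (F x j : ℂ) * f x) =
      ∫ x in U, (Complex.I * a x * g x + (F x j : ℂ) * a x * f x) := by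
    congr 1; ext x; ring
  rw [e2]
  refine hlim.congr fun n => ?_
  have hfm : MemL2Loc U (mollify n f) := fun R => (memLp_mollify hf n).restrict _
  have hgm : MemL2Loc U (mollify n g) := fun R => (memLp_mollify hg n).restrict _
  rw [← integral_add ((ha.const_mul Complex.I).integrableOn_mul hU hgm
      fun x hx => mollify_eq_zero hgz n hx)
    ((hF.memL2Loc_mul hU ha j).integrableOn_mul hU hfm fun x hx => mollify_eq_zero hfz n hx)]
  apply setIntegral_congr_fun hU
  intro x hx
  simp only [magneticTranspose]
  rw [hd n x hx]
  ring

theorem partialDeriv_mollify_of_contDiff {φ : Plane → ℂ} (hφ : ContDiff ℝ 1 φ)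
    (hs : HasCompactSupport φ) (n : ℕ) (j : Fin 2) :
    partialDeriv j (mollify n φ) = mollify n (partialDeriv j φ) := by
  ext x
  have hk := (contDiff_leftKernel n).continuous.locallyIntegrable (μ := volume)
  have hd := hs.hasFDerivAt_convolution_right
    (ContinuousLinearMap.lsmul ℝ ℝ : ℝ →L[ℝ] ℂ →L[ℝ] ℂ) hk hφ x
  have h2 := convolution_precompR_apply (ContinuousLinearMap.lsmul ℝ ℝ : ℝ →L[ℝ] ℂ →L[ℝ] ℂ) hk
    (hs.fderiv ℝ) (hφ.continuous_fderiv one_ne_zero) x (EuclideanSpace.single j (1 : ℝ))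
  unfold partialDeriv
  unfold mollify smear
  rw [hd.fderiv]
  exact h2

theorem eventually_tsupport_mollify_subset {U : Set Plane} (hU : IsOpen U) {φ : Plane → ℂ}
    (hs : HasCompactSupport φ) (hsub : tsupport φ ⊆ U) :
    ∀ᶠ n in atTop, tsupport (mollify n φ) ⊆ U := by
  obtain ⟨δ, hδ, hδU⟩ := hs.isCompact.exists_cthickening_subset_open hU hsub
  have hlim : Tendsto (fun n : ℕ => 2 / ((n : ℝ) + 1)) atTop (𝓝 0) :=
    tendsto_const_nhds.div_atTop (tendsto_natCast_atTop_atTop.atTop_add tendsto_const_nhds)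
  filter_upwards [hlim.eventually (gt_mem_nhds hδ)] with n hn
  refine (closure_minimal (fun x hx => ?_) Metric.isClosed_cthickening).trans hδU
  have hx' := support_convolution_subset _ hx
  obtain ⟨t, ht, y, hy, rfl⟩ := hx'
  refine Metric.mem_cthickening_of_dist_le _ y _ _ (subset_tsupport _ hy) ?_
  have := (tsupport_leftKernel_subset n (subset_tsupport _ ht)).2
  rw [mem_ball_zero_iff] at this
  simp only [dist_eq_norm, add_sub_cancel_right]
  linarith

/-- Magnetic derivatives may be tested against continuously differentiable functions. -/
theorem HasMagneticDeriv.integral_eq_of_contDiff_one {U : Set Plane} (hU : IsOpen U)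
    {F : Plane → Plane} (hF : IsUnitFieldPotential U F) {u v : Plane → ℂ} (hu : MemL2Loc U u)
    (hv : MemL2Loc U v) {j : Fin 2} (h : HasMagneticDeriv U F j u v) {φ : Plane → ℂ}
    (hφ : ContDiff ℝ 1 φ) (hs : HasCompactSupport φ) (hsub : tsupport φ ⊆ U) :
    ∫ x in U, u x * magneticTranspose F j φ x = ∫ x in U, v x * φ x := by
  obtain ⟨R, hR⟩ := hs.exists_eq_zero_of_norm_le
  obtain ⟨R', hR'⟩ := (hs.partialDeriv j).exists_eq_zero_of_norm_le
  have hφ2 : MemLp φ 2 := hφ.continuous.memLp_of_hasCompactSupport hs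
  have hp2 : MemLp (partialDeriv j φ) 2 :=
    (continuous_partialDeriv hφ j).memLp_of_hasCompactSupport (hs.partialDeriv j)
  have h1 := hF.tendsto_setIntegral_mul_magneticTranspose_mollify hU.measurableSet hu hφ2 hp2
    (R := max R R') (fun x hx => hR x ((le_max_left _ _).trans hx))
    (fun x hx => hR' x ((le_max_right _ _).trans hx)) (j := j)
    (fun n x _ => congrFun (partialDeriv_mollify_of_contDiff hφ hs n j) x)
  have h2 := tendsto_setIntegral_mul_mollify hU.measurableSet hv hφ2 hR
  refine tendsto_nhds_unique_of_eventuallyEq h1 h2 ?_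
  filter_upwards [eventually_tsupport_mollify_subset hU hs hsub] with n hn
  exact h _ (isTestFunction_mollify (hφ2.locallyIntegrable (by norm_num)) hR n) hn

theorem tsupport_magneticTranspose_subset (F : Plane → Plane) (j : Fin 2) (φ : Plane → ℂ) :
    tsupport (magneticTranspose F j φ) ⊆ tsupport φ :=
  closure_minimal (fun x hx => by
    by_contra hcon
    apply hx
    have h1 : partialDeriv j φ x = 0 := by
      by_contra hne
      exact hcon (tsupport_partialDeriv_subset φ j (subset_tsupport _ hne))
    have h2 : φ x = 0 := image_eq_zero_of_notMem_tsupport hcon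
    simp [magneticTranspose, h1, h2]) (isClosed_tsupport φ)

theorem IsUnitFieldPotential.contDiffAt {U : Set Plane} (hU : IsOpen U) {F : Plane → Plane}
    (hF : IsUnitFieldPotential U F) {x : Plane} (hx : x ∈ U) (j : Fin 2) :
    ContDiffAt ℝ 1 (fun y => (F y j : ℂ)) x := by
  have h1 : ContDiffAt ℝ 1 F x :=
    hF.1.contDiffAt (mem_of_superset (hU.mem_nhds hx) subset_closure)
  have h2 : ContDiff ℝ 1 fun y : Plane => ((y j : ℝ) : ℂ) :=
    Complex.ofRealCLM.contDiff.comp (by fun_prop)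
  exact h2.contDiffAt.comp x h1

/-- The potential is only C¹, so one magnetic derivative of a test function is only C¹. This is why
the weak definitions have to be extended to C¹ test functions before two derivatives can be
separated. -/
theorem contDiff_magneticTranspose {U : Set Plane} (hU : IsOpen U) {F : Plane → Plane}
    (hF : IsUnitFieldPotential U F) {φ : Plane → ℂ} (hφ : ContDiff ℝ ∞ φ) (hsub : tsupport φ ⊆ U)
    (j : Fin 2) : ContDiff ℝ 1 (magneticTranspose F j φ) := by
  rw [contDiff_iff_contDiffAt]
  intro x
  by_cases hx : x ∈ tsupport φ
  · have h1 : ContDiff ℝ 1 (partialDeriv j φ) := (contDiff_partialDeriv hφ j).of_le (by simp)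
    have h2 : ContDiff ℝ 1 φ := hφ.of_le (by simp)
    exact (contDiffAt_const.mul h1.contDiffAt).add
      ((hF.contDiffAt hU (hsub hx) j).mul h2.contDiffAt)
  · have : magneticTranspose F j φ =ᶠ[𝓝 x] fun _ => 0 := by
      have := notMem_tsupport_iff_eventuallyEq.1
        (fun h => hx (tsupport_magneticTranspose_subset F j φ h))
      exact this
    exact contDiffAt_const.congr_of_eventuallyEq this

/-! ### The half-plane: regularization up to the boundary and Green's formula -/

theorem isOpen_halfPlane : IsOpen halfPlane :=
  isOpen_lt continuous_const (by fun_prop : Continuous fun x : Plane => x 0)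

theorem measurableSet_halfPlane : MeasurableSet halfPlane := isOpen_halfPlane.measurableSet

theorem contDiff_reflect {k : Plane → ℝ} (hk : ContDiff ℝ ∞ k) (x : Plane) :
    ContDiff ℝ ∞ fun z : Plane => k (x - z) := hk.comp (contDiff_const.sub contDiff_id)

theorem partialDeriv_reflect {k : Plane → ℝ} (hk : ContDiff ℝ ∞ k) (x : Plane) (j : Fin 2)
    (z : Plane) : partialDeriv j (fun z => (k (x - z) : ℂ)) z =
      -(fderiv ℝ k (x - z) (EuclideanSpace.single j 1) : ℂ) := by
  rw [partialDeriv_ofReal ((contDiff_reflect hk x).differentiable (by simp) z)]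
  have h1 : HasFDerivAt (fun z => k (x - z)) ((fderiv ℝ k (x - z)).comp
      (-ContinuousLinearMap.id ℝ Plane)) z :=
    ((hk.differentiable (by simp)) (x - z)).hasFDerivAt.comp z ((hasFDerivAt_id z).const_sub x)
  rw [h1.fderiv]
  simp

theorem isTestFunction_reflect {k : Plane → ℝ} (hk : ContDiff ℝ ∞ k) (hs : HasCompactSupport k)
    (x : Plane) : IsTestFunction fun z => (k (x - z) : ℂ) :=
  ⟨Complex.ofRealCLM.contDiff.comp (contDiff_reflect hk x),
    (hs.comp_homeomorph (Homeomorph.subLeft x)).comp_left (g := fun r : ℝ => (r : ℂ)) (by simp)⟩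

/-- The complex conjugate of the ordinary derivative that corresponds to the magnetic
derivative `Z` of `v`. -/
def conjDeriv (F : Plane → Plane) (j : Fin 2) (v Z : Plane → ℂ) (x : Plane) : ℂ :=
  -Complex.I * (conj (Z x) - (F x j : ℂ) * conj (v x))

/-- For x in the half-plane, z ↦ κ(x - z) is a test function supported in the open half-plane, so
the weak derivative of v may be tested against it and extension by zero leaves no boundary term. The
conjugates appear because Green's formula pairs with conj v, while the weak derivatives are defined
by a bilinear pairing. -/
theorem partialDeriv_mollify_halfPlane {F : Plane → Plane} (hF : IsUnitFieldPotential halfPlane F)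
    {v Z : Plane → ℂ} (hv : MemL2Loc halfPlane v) (hZ : MemL2Loc halfPlane Z) {R : ℝ}
    (hvz : ∀ x, R ≤ ‖x‖ → v x = 0) {j : Fin 2}
    (hd : HasMagneticDeriv halfPlane F j v Z) (n : ℕ) {x : Plane} (hx : x ∈ halfPlane) :
    partialDeriv j (mollify n (halfPlane.indicator fun y => conj (v y))) x =
      mollify n (halfPlane.indicator (conjDeriv F j v Z)) x := by
  have hU := measurableSet_halfPlane
  set κ := leftKernel n with hκ
  have hκd := contDiff_leftKernel n
  have hκs := hasCompactSupport_leftKernel n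
  have hvi : LocallyIntegrable (halfPlane.indicator fun y => conj (v y)) := by
    have h1 : MemLp (fun y => conj (v y)) 2 (volume.restrict halfPlane) :=
      hv.conj.memLp_of_eq_zero hU (R := R) fun x hx => by simp [hvz x hx]
    exact ((memLp_indicator_iff_restrict hU).2 h1).locallyIntegrable (by norm_num)
  unfold mollify
  rw [partialDeriv_smear hκd hκs hvi, smear_apply_swap, smear_apply_swap]
  have ind : ∀ (c : Plane → ℝ) (b : Plane → ℂ), ∫ z, c z • halfPlane.indicator b z =
      ∫ z in halfPlane, b z * (c z : ℂ) := by
    intro c b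
    rw [← integral_indicator hU]
    congr 1
    funext z
    by_cases hz : z ∈ halfPlane
    · simp [hz, mul_comm]
    · simp [hz]
  refine (ind (fun z => fderiv ℝ κ (x - z) (EuclideanSpace.single j 1)) _).trans
    (Eq.trans ?_ (ind (fun z => κ (x - z)) _).symm)
  have hφ : IsTestFunction fun z => (κ (x - z) : ℂ) := isTestFunction_reflect hκd hκs x
  -- On the support x₁ - z₁ < 0, so z₁ > x₁ > 0.
  have hφsub : tsupport (fun z => (κ (x - z) : ℂ)) ⊆ halfPlane := by
    have h1 : tsupport (fun z => (κ (x - z) : ℂ)) ⊆ (fun z => x - z) ⁻¹' tsupport κ :=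
      closure_minimal (fun z hz => by
        apply subset_tsupport
        intro h0
        exact hz (by simp [h0])) ((isClosed_tsupport κ).preimage (by fun_prop))
    intro z hz
    have h2 := (tsupport_leftKernel_subset n (h1 hz)).1
    simp only [mem_ofPred_eq, PiLp.sub_apply] at h2
    have h3 : 0 < x 0 := hx
    change 0 < z 0
    linarith
  have hder : ∀ z, partialDeriv j (fun z => (κ (x - z) : ℂ)) z =
      -(fderiv ℝ κ (x - z) (EuclideanSpace.single j 1) : ℂ) :=
    partialDeriv_reflect hκd x j
  have key := congrArg conj (hd _ hφ hφsub)
  rw [← integral_conj, ← integral_conj] at key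
  have hc1 : ∀ z, conj (v z * magneticTranspose F j (fun z => (κ (x - z) : ℂ)) z) =
      Complex.I * (conj (v z) * (fderiv ℝ κ (x - z) (EuclideanSpace.single j 1) : ℂ)) +
        (F z j : ℂ) * conj (v z) * (κ (x - z) : ℂ) := by
    intro z
    rw [magneticTranspose, hder]
    simp
    ring
  have hc2 : ∀ z, conj (Z z * (κ (x - z) : ℂ)) = conj (Z z) * (κ (x - z) : ℂ) := by
    intro z; simp
  simp only [hc1, hc2] at key
  obtain ⟨R₁, hR₁⟩ := hφ.2.exists_eq_zero_of_norm_le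
  have hc : Continuous fun z => (κ (x - z) : ℂ) := hφ.1.continuous
  have hc' : Continuous fun z => (fderiv ℝ κ (x - z) (EuclideanSpace.single j 1) : ℂ) :=
    Complex.continuous_ofReal.comp ((continuous_fderiv_apply hκd _).continuous.comp
      (continuous_const.sub continuous_id))
  have i1 : IntegrableOn (fun z => conj (v z) *
      (fderiv ℝ κ (x - z) (EuclideanSpace.single j 1) : ℂ)) halfPlane := by
    have hz : ∃ R₃, ∀ z, R₃ ≤ ‖z‖ →
        (fderiv ℝ κ (x - z) (EuclideanSpace.single j 1) : ℂ) = 0 := by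
      have := (hφ.2.partialDeriv j).exists_eq_zero_of_norm_le
      simpa only [hder, neg_eq_zero] using this
    obtain ⟨R₃, hR₃⟩ := hz
    exact hv.conj.integrableOn_mul hU (hc'.memL2Loc hU) hR₃
  have i2 : IntegrableOn (fun z => (F z j : ℂ) * conj (v z) * (κ (x - z) : ℂ)) halfPlane :=
    (hF.memL2Loc_mul hU hv.conj j).integrableOn_mul hU (hc.memL2Loc hU) hR₁
  have i3 : IntegrableOn (fun z => conj (Z z) * (κ (x - z) : ℂ)) halfPlane :=
    hZ.conj.integrableOn_mul hU (hc.memL2Loc hU) hR₁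
  rw [integral_add (i1.const_mul _) i2, integral_const_mul] at key
  have e : ∫ z in halfPlane, conjDeriv F j v Z z * (κ (x - z) : ℂ) =
      -Complex.I * (∫ z in halfPlane, conj (Z z) * (κ (x - z) : ℂ)) -
        -Complex.I * ∫ z in halfPlane, (F z j : ℂ) * conj (v z) * (κ (x - z) : ℂ) := by
    rw [← integral_const_mul, ← integral_const_mul,
      ← integral_sub (i3.const_mul _) (i2.const_mul _)]
    congr 1
    funext z
    rw [conjDeriv]
    ring
  rw [e, ← key]
  linear_combination (∫ z in halfPlane, conj (v z) *
      (fderiv ℝ κ (x - z) (EuclideanSpace.single j 1) : ℂ)) * Complex.I_mul_I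

/-- `u` is a weak solution of `(-i∇ + F)² u = w` on the half-plane with magnetic Neumann boundary
condition and `V = (-i∇ + F) u`. -/
structure IsNeumannSolution (F : Plane → Plane) (u : Plane → ℂ) (V : Fin 2 → Plane → ℂ)
    (w : Plane → ℂ) : Prop where
  memL2Loc_fun : MemL2Loc halfPlane u
  memL2Loc_deriv : ∀ j, MemL2Loc halfPlane (V j)
  memL2Loc_rhs : MemL2Loc halfPlane w
  hasDeriv : ∀ j, HasMagneticDeriv halfPlane F j u (V j)
  integral_eq : ∀ η, IsTestFunction η →
    ∑ j : Fin 2, ∫ x in halfPlane, V j x * magneticTranspose F j η x =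
      ∫ x in halfPlane, w x * η x

theorem MemL2Loc.locallyIntegrableOn {U : Set Plane} (hU : IsOpen U) {a : Plane → ℂ}
    (ha : MemL2Loc U a) : LocallyIntegrableOn a U := by
  intro x hx
  have hfin : IsFiniteMeasure (volume.restrict (U ∩ Metric.ball (0 : Plane) (‖x‖ + 1))) :=
    ⟨by
      rw [Measure.restrict_apply_univ]
      exact (measure_mono inter_subset_right).trans_lt measure_ball_lt_top⟩
  refine ⟨U ∩ Metric.ball 0 (‖x‖ + 1), ?_, (ha _).integrable (by norm_num)⟩
  exact mem_nhdsWithin_of_mem_nhds ((hU.inter Metric.isOpen_ball).mem_nhds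
    ⟨hx, by rw [mem_ball_zero_iff]; linarith⟩)

theorem MemL2Loc.ae_eq_of_integral_eq {U : Set Plane} (hU : IsOpen U) {a b : Plane → ℂ}
    (ha : MemL2Loc U a) (hb : MemL2Loc U b)
    (h : ∀ φ, IsTestFunction φ → tsupport φ ⊆ U →
      ∫ x in U, a x * φ x = ∫ x in U, b x * φ x) : a =ᵐ[volume.restrict U] b := by
  have h0 : ∀ᵐ x, x ∈ U → a x - b x = 0 := by
    apply IsOpen.ae_eq_zero_of_integral_contDiff_smul_eq_zero hU
      ((ha.sub hb).locallyIntegrableOn hU)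
    intro g hg hgs hgU
    have hφ : IsTestFunction fun x => (g x : ℂ) :=
      ⟨Complex.ofRealCLM.contDiff.comp hg, hgs.comp_left (g := fun r : ℝ => (r : ℂ)) (by simp)⟩
    have hsub : tsupport (fun x => (g x : ℂ)) ⊆ U :=
      (closure_mono fun x hx => by
        intro h0; exact hx (by simp [h0])).trans hgU
    have h1 := h _ hφ hsub
    obtain ⟨R, hR⟩ := hφ.2.exists_eq_zero_of_norm_le
    have hl := hφ.1.continuous.memL2Loc hU.measurableSet
    rw [← sub_eq_zero, ← integral_sub (ha.integrableOn_mul hU.measurableSet hl hR)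
      (hb.integrableOn_mul hU.measurableSet hl hR)] at h1
    rw [← h1, ← setIntegral_eq_integral_of_forall_compl_eq_zero (s := U)]
    · congr 1
      funext x
      simp only [Complex.real_smul]
      ring
    · intro x hx
      have : g x = 0 := by
        by_contra hne
        exact hx (hgU (subset_tsupport _ hne))
      simp [this]
  rw [EventuallyEq, ae_restrict_iff' hU.measurableSet]
  filter_upwards [h0] with x hx hxU
  exact sub_eq_zero.1 (hx hxU)

/-- One of the two magnetic derivatives is moved back onto u, by testing the definition of V_j with
the C¹ function `magneticTranspose F j φ`. -/
theorem HasMagneticLaplacian.integral_deriv_eq {U : Set Plane} (hU : IsOpen U)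
    {F : Plane → Plane} (hF : IsUnitFieldPotential U F) {u w : Plane → ℂ} (hu : MemL2Loc U u)
    {V : Fin 2 → Plane → ℂ} (hV : ∀ j, MemL2Loc U (V j)) (hd : ∀ j, HasMagneticDeriv U F j u (V j))
    (h : HasMagneticLaplacian U F u w) {φ : Plane → ℂ} (hφ : IsTestFunction φ)
    (hsub : tsupport φ ⊆ U) :
    ∑ j : Fin 2, ∫ x in U, V j x * magneticTranspose F j φ x = ∫ x in U, w x * φ x := by
  have hc : ∀ j, ContDiff ℝ 1 (magneticTranspose F j φ) :=
    contDiff_magneticTranspose hU hF hφ.1 hsub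
  have hs : ∀ j, HasCompactSupport (magneticTranspose F j φ) := fun j =>
    hφ.2.of_isClosed_subset (isClosed_tsupport _) (tsupport_magneticTranspose_subset F j φ)
  rw [← h φ hφ hsub]
  simp only [Finset.mul_sum]
  rw [integral_finsetSum _ fun j _ =>
    hF.integrableOn_mul_magneticTranspose hU.measurableSet hu (hc j) (hs j) j]
  refine Finset.sum_congr rfl fun j _ => ?_
  exact ((hd j).integral_eq_of_contDiff_one hU hF hu (hV j) (hc j) (hs j)
    ((tsupport_magneticTranspose_subset F j φ).trans hsub)).symm

/-- A vanishing normal trace means that Gauss–Green has no boundary term even for η not vanishing on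
the boundary. It gives the weak equation with right-hand side -i div V + F·V, which is identified
with w by interior test functions. -/
theorem MagneticNeumann.exists_isNeumannSolution {F : Plane → Plane}
    (hF : IsUnitFieldPotential halfPlane F) {u w : Plane → ℂ} (hu : MemL2Loc halfPlane u)
    (hw : MemL2Loc halfPlane w) (hL : HasMagneticLaplacian halfPlane F u w)
    (hN : MagneticNeumann F u) : ∃ V, IsNeumannSolution F u V w := by
  have hU := measurableSet_halfPlane
  obtain ⟨V, hd, hV, -, d, hdL, hG⟩ := hN
  have hw' : MemL2Loc halfPlane fun x =>
      -Complex.I * d x + ((F x 0 : ℂ) * V 0 x + (F x 1 : ℂ) * V 1 x) :=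
    (hdL.const_mul _).add ((hF.memL2Loc_mul hU (hV 0) 0).add (hF.memL2Loc_mul hU (hV 1) 1))
  have key : ∀ η, IsTestFunction η →
      ∑ j : Fin 2, ∫ x in halfPlane, V j x * magneticTranspose F j η x =
        ∫ x in halfPlane,
          (-Complex.I * d x + ((F x 0 : ℂ) * V 0 x + (F x 1 : ℂ) * V 1 x)) * η x := by
    intro η hη
    have hη1 : ContDiff ℝ 1 η := hη.1.of_le (by simp)
    have hint : ∀ j, IntegrableOn (fun x => V j x * magneticTranspose F j η x) halfPlane := fun j =>
      hF.integrableOn_mul_magneticTranspose hU (hV j) hη1 hη.2 j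
    obtain ⟨R, hR⟩ := hη.2.exists_eq_zero_of_norm_le
    have hint2 : IntegrableOn (fun x =>
        (-Complex.I * d x + ((F x 0 : ℂ) * V 0 x + (F x 1 : ℂ) * V 1 x)) * η x) halfPlane :=
      hw'.integrableOn_mul hU (hη1.continuous.memL2Loc hU) hR
    rw [← integral_finsetSum _ fun j _ => hint j, ← sub_eq_zero,
      ← integral_sub (integrable_finsetSum _ fun j _ => hint j) hint2]
    have hG' := hG η hη
    simp only [zero_mul, integral_zero] at hG'
    -- The number 0 is rewritten as i times the Gauss–Green integral, after which the integrands
    -- agree pointwise.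
    rw [← mul_zero Complex.I, ← hG', ← integral_const_mul]
    congr 1
    funext x
    simp only [Fin.sum_univ_two, magneticTranspose]
    ring
  have hae := hw.ae_eq_of_integral_eq isOpen_halfPlane hw' fun φ hφ hsub => by
    rw [← hL.integral_deriv_eq isOpen_halfPlane hF hu hV hd hφ hsub, key φ hφ]
  refine ⟨V, hu, hV, hw, hd, fun η hη => (key η hη).trans ?_⟩
  apply integral_congr_ae
  filter_upwards [hae] with x hx
  rw [hx]

/-- Green's formula for test functions in the magnetic Sobolev space with bounded support. -/
theorem IsNeumannSolution.green {F : Plane → Plane} (hF : IsUnitFieldPotential halfPlane F)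
    {u w : Plane → ℂ} {V : Fin 2 → Plane → ℂ} (h : IsNeumannSolution F u V w)
    {v : Plane → ℂ} {Z : Fin 2 → Plane → ℂ} (hv : MemL2Loc halfPlane v)
    (hZ : ∀ j, MemL2Loc halfPlane (Z j)) (hd : ∀ j, HasMagneticDeriv halfPlane F j v (Z j))
    {R : ℝ} (hvz : ∀ x, R ≤ ‖x‖ → v x = 0) (hZz : ∀ j x, R ≤ ‖x‖ → Z j x = 0) :
    ∑ j, ∫ x in halfPlane, V j x * conj (Z j x) = ∫ x in halfPlane, w x * conj (v x) := by
  have hU := measurableSet_halfPlane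
  set f : Plane → ℂ := halfPlane.indicator fun y => conj (v y) with hf
  set g : Fin 2 → Plane → ℂ := fun j => halfPlane.indicator (conjDeriv F j v (Z j)) with hg
  have hgL : ∀ j, MemL2Loc halfPlane (conjDeriv F j v (Z j)) := fun j =>
    ((hZ j).conj.sub (hF.memL2Loc_mul hU hv.conj j)).const_mul _
  have hfz : ∀ x, R ≤ ‖x‖ → f x = 0 := by
    intro x hx
    simp [f, indicator, hvz x hx]
  have hgz0 : ∀ j x, R ≤ ‖x‖ → conjDeriv F j v (Z j) x = 0 := by
    intro j x hx
    simp [conjDeriv, hvz x hx, hZz j x hx]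
  have hgz : ∀ j x, R ≤ ‖x‖ → g j x = 0 := by
    intro j x hx
    simp [g, indicator, hgz0 j x hx]
  have hf2 : MemLp f 2 := (memLp_indicator_iff_restrict hU).2
    (hv.conj.memLp_of_eq_zero hU (R := R) fun x hx => by simp [hvz x hx])
  have hg2 : ∀ j, MemLp (g j) 2 := fun j => (memLp_indicator_iff_restrict hU).2
    ((hgL j).memLp_of_eq_zero hU (hgz0 j))
  -- In the limit i g_j + F_j f = conj Z_j on the half-plane, by the definition of `conjDeriv`.
  have lim1 : Tendsto (fun n => ∑ j, ∫ x in halfPlane, V j x *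
      magneticTranspose F j (mollify n f) x) atTop (𝓝 (∑ j, ∫ x in halfPlane, V j x *
        (Complex.I * g j x + (F x j : ℂ) * f x))) :=
    tendsto_finsetSum _ fun j _ =>
      hF.tendsto_setIntegral_mul_magneticTranspose_mollify hU (h.memL2Loc_deriv j) hf2 (hg2 j) hfz
        (hgz j) fun n x hx => partialDeriv_mollify_halfPlane hF hv (hZ j) hvz (hd j) n hx
  have lim2 := tendsto_setIntegral_mul_mollify hU h.memL2Loc_rhs hf2 hfz
  -- The mollifications are test functions on the whole plane whose supports may cross the boundary;
  -- the Neumann condition enters here.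
  have heq : ∀ n, ∑ j, ∫ x in halfPlane, V j x * magneticTranspose F j (mollify n f) x =
      ∫ x in halfPlane, w x * mollify n f x := fun n =>
    h.integral_eq _ (isTestFunction_mollify (hf2.locallyIntegrable (by norm_num)) hfz n)
  simp only [heq] at lim1
  have := tendsto_nhds_unique lim1 lim2
  calc _ = ∑ j, ∫ x in halfPlane, V j x * (Complex.I * g j x + (F x j : ℂ) * f x) := by
        refine Finset.sum_congr rfl fun j _ => setIntegral_congr_fun hU fun x hx => ?_
        simp only [f, g, indicator_of_mem hx, conjDeriv]
        linear_combination (V j x * ((starRingEnd ℂ) (Z j x) - F x j * (starRingEnd ℂ) (v x))) *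
          Complex.I_mul_I
    _ = _ := this
    _ = _ := setIntegral_congr_fun hU fun x hx => by simp only [f, indicator_of_mem hx]

/-! ### Cutting off -/

/-- The magnetic derivative of `χ u` when `V` is the magnetic derivative of `u`. -/
def cutDeriv (χ : Plane → ℝ) (u : Plane → ℂ) (V : Fin 2 → Plane → ℂ) (j : Fin 2) (x : Plane) : ℂ :=
  χ x * V j x - Complex.I * (fderiv ℝ χ x (EuclideanSpace.single j 1) : ℂ) * u x

/-- Leibniz rule in weak form: χφ is again an admissible test function for u. -/
theorem HasMagneticDeriv.cut {U : Set Plane} (hU : MeasurableSet U) {F : Plane → Plane}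
    (hF : IsUnitFieldPotential U F) {u : Plane → ℂ} {V : Fin 2 → Plane → ℂ} (hu : MemL2Loc U u)
    {χ : Plane → ℝ} (hχ : ContDiff ℝ ∞ χ) {j : Fin 2} (hV : MemL2Loc U (V j))
    (h : HasMagneticDeriv U F j u (V j)) :
    HasMagneticDeriv U F j (fun x => χ x * u x) (cutDeriv χ u V j) := by
  intro φ hφ hsub
  have hχc : ContDiff ℝ ∞ fun x => (χ x : ℂ) := Complex.ofRealCLM.contDiff.comp hχ
  have hψ : IsTestFunction fun x => (χ x : ℂ) * φ x := ⟨hχc.mul hφ.1, hφ.2.mul_left⟩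
  have hψsub : tsupport (fun x => (χ x : ℂ) * φ x) ⊆ U :=
    (closure_mono (Function.support_mul_subset_right _ _)).trans hsub
  have h1 := h _ hψ hψsub
  obtain ⟨R, hR⟩ := hφ.2.exists_eq_zero_of_norm_le
  obtain ⟨R', hR'⟩ := hψ.2.exists_eq_zero_of_norm_le
  have hψ1 : ContDiff ℝ 1 fun x => (χ x : ℂ) * φ x := hψ.1.of_le (by simp)
  have i1 := hF.integrableOn_mul_magneticTranspose hU hu hψ1 hψ.2 j
  have hdc : Continuous fun x => (fderiv ℝ χ x (EuclideanSpace.single j 1) : ℂ) :=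
    Complex.continuous_ofReal.comp (continuous_fderiv_apply hχ _).continuous
  have i2 : IntegrableOn (fun x => Complex.I * ((fderiv ℝ χ x (EuclideanSpace.single j 1) : ℂ) *
      u x) * φ x) U :=
    ((hu.continuous_mul hU hdc).const_mul Complex.I).integrableOn_mul hU
      (hφ.1.continuous.memL2Loc hU) hR
  have i3 : IntegrableOn (fun x => V j x * ((χ x : ℂ) * φ x)) U :=
    hV.integrableOn_mul hU (hψ.1.continuous.memL2Loc hU) hR'
  calc _ = ∫ x in U, (u x * magneticTranspose F j (fun x => (χ x : ℂ) * φ x) x -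
        Complex.I * ((fderiv ℝ χ x (EuclideanSpace.single j 1) : ℂ) * u x) * φ x) := by
        congr 1
        funext x
        simp only [magneticTranspose]
        rw [partialDeriv_mul (hχc.differentiable (by simp) x) (hφ.1.differentiable (by simp) x),
          partialDeriv_ofReal (hχ.differentiable (by simp) x)]
        ring
    _ = ∫ x in U, (V j x * ((χ x : ℂ) * φ x) -
        Complex.I * ((fderiv ℝ χ x (EuclideanSpace.single j 1) : ℂ) * u x) * φ x) := by
        rw [integral_sub i1 i2, h1, integral_sub i3 i2]
    _ = _ := by
        congr 1
        funext x
        simp only [cutDeriv]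
        ring

theorem MemL2Loc.cutDeriv {U : Set Plane} (hU : MeasurableSet U) {u : Plane → ℂ}
    {V : Fin 2 → Plane → ℂ} (hu : MemL2Loc U u) {χ : Plane → ℝ} (hχ : ContDiff ℝ ∞ χ) {j : Fin 2}
    (hV : MemL2Loc U (V j)) : MemL2Loc U (cutDeriv χ u V j) := by
  have hχc : Continuous fun x => (χ x : ℂ) := Complex.continuous_ofReal.comp hχ.continuous
  have hdc : Continuous fun x =>
      Complex.I * (fderiv ℝ χ x (EuclideanSpace.single j 1) : ℂ) :=
    continuous_const.mul
      (Complex.continuous_ofReal.comp (continuous_fderiv_apply hχ _).continuous)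
  exact (hV.continuous_mul hU hχc).sub (hu.continuous_mul hU hdc)

theorem cutDeriv_eq_zero {χ : Plane → ℝ} {x : Plane} (h : x ∉ tsupport χ) (u : Plane → ℂ)
    (V : Fin 2 → Plane → ℂ) (j : Fin 2) : cutDeriv χ u V j x = 0 := by
  have h1 : χ x = 0 := image_eq_zero_of_notMem_tsupport h
  have h2 : fderiv ℝ χ x = 0 := by
    by_contra hne
    exact h (support_fderiv_subset ℝ hne)
  simp [cutDeriv, h1, h2]

theorem HasCompactSupport.exists_notMem_tsupport {α : Type*} [Zero α] {f : Plane → α}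
    (hf : HasCompactSupport f) : ∃ R, ∀ x, R ≤ ‖x‖ → x ∉ tsupport f := by
  obtain ⟨R, hR⟩ := hf.isCompact.isBounded.subset_ball 0
  exact ⟨R, fun x hx h => absurd (mem_ball_zero_iff.1 (hR h)) hx.not_gt⟩

/-! ### Energy identities -/

theorem fderiv_sq_apply {χ : Plane → ℝ} {x : Plane} (h : DifferentiableAt ℝ χ x) (v : Plane) :
    fderiv ℝ (fun y => χ y ^ 2) x v = 2 * χ x * fderiv ℝ χ x v := by
  rw [fderiv_fun_pow 2 h]
  simp

/-- The localization formula holds pointwise: the cross terms between χ V_j and (∂_jχ) u are purely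
imaginary. The real part yields the energy identity, the imaginary part the symmetry of the
operator. -/
theorem mul_conj_cutDeriv_sq {χ : Plane → ℝ} (hχ : ContDiff ℝ ∞ χ) (u : Plane → ℂ)
    (V : Fin 2 → Plane → ℂ) (j : Fin 2) (x : Plane) :
    V j x * conj (cutDeriv (fun y => χ y ^ 2) u V j x) =
      ((‖cutDeriv χ u V j x‖ ^ 2 -
        fderiv ℝ χ x (EuclideanSpace.single j 1) ^ 2 * ‖u x‖ ^ 2 : ℝ) : ℂ) +
      Complex.I * (2 * fderiv ℝ χ x (EuclideanSpace.single j 1) *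
        (cutDeriv χ u V j x * conj (u x)).re : ℝ) := by
  simp only [cutDeriv]
  rw [fderiv_sq_apply (hχ.differentiable (by simp) x)]
  generalize fderiv ℝ χ x (EuclideanSpace.single j 1) = c
  generalize χ x = r
  generalize u x = a
  generalize V j x = b
  rw [Complex.sq_norm, Complex.sq_norm, Complex.normSq_apply, Complex.normSq_apply]
  apply Complex.ext
  · simp [pow_two]
    ring
  · simp [pow_two]
    ring

theorem two_mul_re_mul_conj_le {s : ℝ} (hs : 0 < s) (a b : ℂ) :
    2 * (a * conj b).re ≤ s * ‖a‖ ^ 2 + ‖b‖ ^ 2 / s := by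
  have h1 : (a * conj b).re ≤ ‖a‖ * ‖b‖ := by
    have := Complex.re_le_norm (a * conj b)
    rwa [norm_mul, RCLike.norm_conj] at this
  have h2 : 0 ≤ (s * ‖a‖ - ‖b‖) ^ 2 / s := by positivity
  have h3 : (s * ‖a‖ - ‖b‖) ^ 2 / s = s * ‖a‖ ^ 2 - 2 * (‖a‖ * ‖b‖) + ‖b‖ ^ 2 / s := by
    field_simp
    ring
  linarith

theorem MeasureTheory.MemLp.integrable_mul_conj {α : Type*} [MeasurableSpace α] {μ : Measure α}
    {a b : α → ℂ} (ha : MemLp a 2 μ) (hb : MemLp b 2 μ) :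
    Integrable (fun x => a x * conj (b x)) μ := ha.integrable_mul hb.conj

theorem MeasureTheory.MemLp.integrable_norm_sq {α : Type*} [MeasurableSpace α] {μ : Measure α}
    {a : α → ℂ} (ha : MemLp a 2 μ) : Integrable (fun x => ‖a x‖ ^ 2) μ :=
  (memLp_two_iff_integrable_sq_norm ha.1).1 ha

theorem integral_mul_conj_self {α : Type*} [MeasurableSpace α] {μ : Measure α} (f : α → ℂ) :
    ∫ x, f x * conj (f x) ∂μ = ((∫ x, ‖f x‖ ^ 2 ∂μ : ℝ) : ℂ) := by
  rw [← integral_complex_ofReal]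
  congr 1
  funext x
  rw [Complex.mul_conj, Complex.normSq_eq_norm_sq]

theorem re_integral_eq {α : Type*} [MeasurableSpace α] {μ : Measure α} {f : α → ℂ}
    (hf : Integrable f μ) : (∫ x, f x ∂μ).re = ∫ x, (f x).re ∂μ := (integral_re hf).symm

theorem im_integral_eq {α : Type*} [MeasurableSpace α] {μ : Measure α} {f : α → ℂ}
    (hf : Integrable f μ) : (∫ x, f x ∂μ).im = ∫ x, (f x).im ∂μ := (integral_im hf).symm

theorem MemL2Loc.memLp_cut {U : Set Plane} (hU : MeasurableSet U) {u : Plane → ℂ}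
    (hu : MemL2Loc U u) {χ : Plane → ℝ} (hχ : Continuous χ) (hs : HasCompactSupport χ) :
    MemLp (fun x => χ x * u x) 2 (volume.restrict U) := by
  obtain ⟨R, hR⟩ := hs.exists_eq_zero_of_norm_le
  exact (hu.continuous_mul hU (Complex.continuous_ofReal.comp hχ)).memLp_of_eq_zero hU
    (R := R) fun x hx => by simp [hR x hx]

theorem MemL2Loc.memLp_cutDeriv {U : Set Plane} (hU : MeasurableSet U) {u : Plane → ℂ}
    {V : Fin 2 → Plane → ℂ} (hu : MemL2Loc U u) {χ : Plane → ℝ} (hχ : ContDiff ℝ ∞ χ)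
    (hs : HasCompactSupport χ) {j : Fin 2} (hV : MemL2Loc U (V j)) :
    MemLp (_root_.cutDeriv χ u V j) 2 (volume.restrict U) := by
  obtain ⟨R, hR⟩ := hs.exists_notMem_tsupport
  exact (hu.cutDeriv hU hχ hV).memLp_of_eq_zero hU fun x hx => cutDeriv_eq_zero (hR x hx) u V j

theorem MemL2Loc.integrableOn_grad_sq_mul {U : Set Plane} (hU : MeasurableSet U) {u : Plane → ℂ}
    (hu : MemL2Loc U u) {χ : Plane → ℝ} (hχ : ContDiff ℝ ∞ χ) (hs : HasCompactSupport χ)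
    (j : Fin 2) :
    IntegrableOn (fun x => fderiv ℝ χ x (EuclideanSpace.single j 1) ^ 2 * ‖u x‖ ^ 2) U := by
  have h1 : HasCompactSupport fun x => fderiv ℝ χ x (EuclideanSpace.single j 1) :=
    (hs.fderiv ℝ).mono fun x hx => by
      contrapose! hx
      simp only [Function.mem_support, not_not] at hx ⊢
      simp [hx]
  have := (hu.memLp_cut hU (continuous_fderiv_apply hχ (EuclideanSpace.single j 1)).continuous
    h1).integrable_norm_sq
  refine this.congr (ae_of_all _ fun x => ?_)
  simp [mul_pow]

section Solution

variable {F : Plane → Plane} {u w : Plane → ℂ} {V : Fin 2 → Plane → ℂ}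

theorem IsNeumannSolution.green_sq (hF : IsUnitFieldPotential halfPlane F)
    (h : IsNeumannSolution F u V w) {χ : Plane → ℝ} (hχ : ContDiff ℝ ∞ χ)
    (hs : HasCompactSupport χ) :
    ∑ j, ∫ x in halfPlane, V j x * conj (cutDeriv (fun y => χ y ^ 2) u V j x) =
      ∫ x in halfPlane, w x * conj (((χ x ^ 2 : ℝ) : ℂ) * u x) := by
  have hχ2 : ContDiff ℝ ∞ fun y => χ y ^ 2 := hχ.pow 2
  have hs2 : HasCompactSupport fun y => χ y ^ 2 := by
    simp only [sq]
    exact hs.mul_left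
  obtain ⟨R, hR⟩ := hs2.exists_notMem_tsupport
  have hU := measurableSet_halfPlane
  exact h.green hF (v := fun x => ((χ x ^ 2 : ℝ) : ℂ) * u x)
    (h.memL2Loc_fun.continuous_mul hU (Complex.continuous_ofReal.comp hχ2.continuous))
    (fun j => h.memL2Loc_fun.cutDeriv hU hχ2 (h.memL2Loc_deriv j))
    (fun j => (h.hasDeriv j).cut hU hF h.memL2Loc_fun hχ2 (h.memL2Loc_deriv j))
    (R := R) (fun x hx => by
      have : χ x ^ 2 = 0 := image_eq_zero_of_notMem_tsupport (f := fun y => χ y ^ 2) (hR x hx)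
      simp [this])
    (fun j x hx => cutDeriv_eq_zero (hR x hx) u V j)

theorem IsNeumannSolution.integrableOn_mul_conj_cutDeriv
    (h : IsNeumannSolution F u V w) {χ : Plane → ℝ} (hχ : ContDiff ℝ ∞ χ)
    (hs : HasCompactSupport χ) (j : Fin 2) :
    IntegrableOn (fun x => V j x * conj (cutDeriv (fun y => χ y ^ 2) u V j x)) halfPlane := by
  have hχ2 : ContDiff ℝ ∞ fun y => χ y ^ 2 := hχ.pow 2
  have hs2 : HasCompactSupport fun y => χ y ^ 2 := by
    simp only [sq]
    exact hs.mul_left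
  obtain ⟨R, hR⟩ := hs2.exists_notMem_tsupport
  have hU := measurableSet_halfPlane
  exact (h.memL2Loc_deriv j).integrableOn_mul hU
    (h.memL2Loc_fun.cutDeriv hU hχ2 (h.memL2Loc_deriv j)).conj (R := R)
    fun x hx => by rw [cutDeriv_eq_zero (hR x hx) u V j, map_zero]

/-- Green's formula with v = χ²u, whose real part is given by `mul_conj_cutDeriv_sq`. -/
theorem IsNeumannSolution.energy (hF : IsUnitFieldPotential halfPlane F)
    (h : IsNeumannSolution F u V w) {χ : Plane → ℝ} (hχ : ContDiff ℝ ∞ χ)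
    (hs : HasCompactSupport χ) :
    ∑ j, ∫ x in halfPlane, ‖cutDeriv χ u V j x‖ ^ 2 =
      (∫ x in halfPlane, w x * conj (((χ x ^ 2 : ℝ) : ℂ) * u x)).re +
        ∫ x in halfPlane, gradSq χ x * ‖u x‖ ^ 2 := by
  have hU := measurableSet_halfPlane
  rw [← h.green_sq hF hχ hs, Complex.re_sum]
  simp only [gradSq, Finset.sum_mul]
  rw [integral_finsetSum _ fun j _ => h.memL2Loc_fun.integrableOn_grad_sq_mul hU hχ hs j,
    ← Finset.sum_add_distrib]
  refine Finset.sum_congr rfl fun j _ => ?_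
  have hi := h.integrableOn_mul_conj_cutDeriv hχ hs j
  have hi' : IntegrableOn
    (fun x => (V j x * conj (cutDeriv (fun y => χ y ^ 2) u V j x)).re) halfPlane := hi.re
  rw [re_integral_eq hi, ← integral_add hi'
    (h.memL2Loc_fun.integrableOn_grad_sq_mul hU hχ hs j)]
  congr 1
  funext x
  rw [mul_conj_cutDeriv_sq hχ]
  simp only [Complex.add_re, Complex.ofReal_re, Complex.I_mul_re, Complex.ofReal_im]
  ring

/-- The imaginary part contains a factor ∂_jχ. Young's inequality with weight δ leaves a small
multiple of the energy and a gradient term that disappears as the cutoff is removed. -/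
theorem IsNeumannSolution.abs_im_le (hF : IsUnitFieldPotential halfPlane F)
    (h : IsNeumannSolution F u V w) {χ : Plane → ℝ} (hχ : ContDiff ℝ ∞ χ)
    (hs : HasCompactSupport χ) {δ : ℝ} (hδ : 0 < δ) :
    |(∫ x in halfPlane, w x * conj (((χ x ^ 2 : ℝ) : ℂ) * u x)).im| ≤
      δ * (∑ j, ∫ x in halfPlane, ‖cutDeriv χ u V j x‖ ^ 2) +
        (∫ x in halfPlane, gradSq χ x * ‖u x‖ ^ 2) / δ := by
  have hU := measurableSet_halfPlane
  rw [← h.green_sq hF hχ hs, Complex.im_sum]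
  simp only [gradSq, Finset.sum_mul]
  rw [integral_finsetSum _ fun j _ => h.memL2Loc_fun.integrableOn_grad_sq_mul hU hχ hs j,
    Finset.mul_sum, Finset.sum_div, ← Finset.sum_add_distrib]
  refine (Finset.abs_sum_le_sum_abs _ _).trans (Finset.sum_le_sum fun j _ => ?_)
  have hi := h.integrableOn_mul_conj_cutDeriv hχ hs j
  have hD := (h.memL2Loc_fun.memLp_cutDeriv hU hχ hs (h.memL2Loc_deriv j)).integrable_norm_sq
  have hg := h.memL2Loc_fun.integrableOn_grad_sq_mul hU hχ hs j
  rw [im_integral_eq hi, ← integral_const_mul, ← integral_div,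
    ← integral_add (hD.const_mul δ) (hg.div_const δ)]
  refine abs_integral_le_integral_abs.trans
    (integral_mono hi.im.abs ((hD.const_mul δ).add (hg.div_const δ)) fun x => ?_)
  simp only
  change |(V j x * conj (cutDeriv (fun y => χ y ^ 2) u V j x)).im| ≤ _
  rw [mul_conj_cutDeriv_sq hχ]
  simp only [Complex.add_im, Complex.ofReal_im, Complex.I_mul_im, Complex.ofReal_re, zero_add]
  generalize fderiv ℝ χ x (EuclideanSpace.single j 1) = c
  generalize cutDeriv χ u V j x = d
  have h1 : |(d * conj (u x)).re| ≤ ‖d‖ * ‖u x‖ := by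
    have := Complex.abs_re_le_norm (d * conj (u x))
    rwa [norm_mul, RCLike.norm_conj] at this
  rw [abs_mul, abs_mul, abs_two]
  have h2 : 0 ≤ (δ * ‖d‖ - |c| * ‖u x‖) ^ 2 / δ := by positivity
  have h3 : (δ * ‖d‖ - |c| * ‖u x‖) ^ 2 / δ =
      δ * ‖d‖ ^ 2 - 2 * |c| * (‖d‖ * ‖u x‖) + c ^ 2 * ‖u x‖ ^ 2 / δ := by
    rw [← sq_abs c]
    field_simp
    ring
  have h4 : 2 * |c| * |(d * conj (u x)).re| ≤ 2 * |c| * (‖d‖ * ‖u x‖) := by gcongr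
  linarith

/-! ### Removing the cutoff for square integrable solutions -/

theorem tendsto_setIntegral_mul_conj_logCutoff {U : Set Plane} {u w : Plane → ℂ}
    (hu : MemLp u 2 (volume.restrict U)) (hw : MemLp w 2 (volume.restrict U)) :
    Tendsto (fun n => ∫ x in U, w x * conj (((logCutoff n x ^ 2 : ℝ) : ℂ) * u x)) atTop
      (𝓝 (∫ x in U, w x * conj (u x))) := by
  apply tendsto_integral_of_dominated_convergence (fun x => ‖w x * conj (u x)‖)
  · intro n
    exact hw.1.mul (Complex.continuous_conj.comp_aestronglyMeasurable
      (((Complex.continuous_ofReal.comp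
        ((contDiff_logCutoff n).continuous.pow 2)).aestronglyMeasurable).mul hu.1))
  · exact (hw.integrable_mul_conj hu).norm
  · intro n
    refine ae_of_all _ fun x => ?_
    simp only [norm_mul, RCLike.norm_conj, Complex.norm_real]
    have : ‖logCutoff n x ^ 2‖ ≤ 1 := by
      rw [Real.norm_of_nonneg (sq_nonneg _)]
      exact pow_le_one₀ (logCutoff_nonneg n x) (logCutoff_le_one n x)
    exact mul_le_mul_of_nonneg_left (mul_le_of_le_one_left (norm_nonneg _) this) (norm_nonneg _)
  · refine ae_of_all _ fun x => ?_
    apply tendsto_const_nhds.congr'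
    obtain ⟨m, hm⟩ := exists_nat_ge ‖x‖
    filter_upwards [eventually_ge_atTop m] with n hn
    rw [logCutoff_eq_one (hm.trans (by exact_mod_cast hn))]
    simp

theorem tendsto_setIntegral_gradSq_logCutoff_mul {U : Set Plane} {u : Plane → ℂ}
    (hu : MemLp u 2 (volume.restrict U)) :
    Tendsto (fun n => ∫ x in U, gradSq (logCutoff n) x * ‖u x‖ ^ 2) atTop (𝓝 0) := by
  obtain ⟨C, hC⟩ := exists_gradSq_logCutoff_le
  have hl : Tendsto (fun n : ℕ => C / ((n : ℝ) + 1) * ∫ x in U, ‖u x‖ ^ 2) atTop (𝓝 0) := by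
    have : Tendsto (fun n : ℕ => C / ((n : ℝ) + 1)) atTop (𝓝 0) :=
      tendsto_const_nhds.div_atTop (tendsto_natCast_atTop_atTop.atTop_add tendsto_const_nhds)
    simpa using this.mul_const (∫ x in U, ‖u x‖ ^ 2)
  refine squeeze_zero (fun n => integral_nonneg fun x =>
    mul_nonneg (gradSq_nonneg _ _) (sq_nonneg _)) (fun n => ?_) hl
  rw [← integral_const_mul]
  refine integral_mono_of_nonneg (ae_of_all _ fun x =>
    mul_nonneg (gradSq_nonneg _ _) (sq_nonneg _)) (hu.integrable_norm_sq.const_mul _)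
    (ae_of_all _ fun x => ?_)
  exact mul_le_mul_of_nonneg_right (hC n x) (sq_nonneg _)

/-- Serves as a substitute for ∑‖V_j‖² = Re⟨w, u⟩ without V being known to be globally square
integrable. -/
theorem IsNeumannSolution.tendsto_energy (hF : IsUnitFieldPotential halfPlane F)
    (h : IsNeumannSolution F u V w) (hu : MemLp u 2 (volume.restrict halfPlane))
    (hw : MemLp w 2 (volume.restrict halfPlane)) :
    Tendsto (fun n => ∑ j, ∫ x in halfPlane, ‖cutDeriv (logCutoff n) u V j x‖ ^ 2) atTop
      (𝓝 (∫ x in halfPlane, w x * conj (u x)).re) := by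
  have h1 := (Complex.continuous_re.tendsto _).comp (tendsto_setIntegral_mul_conj_logCutoff hu hw)
  have h2 := h1.add (tendsto_setIntegral_gradSq_logCutoff_mul hu)
  rw [add_zero] at h2
  exact h2.congr fun n => (h.energy hF (contDiff_logCutoff n) (hasCompactSupport_logCutoff n)).symm

theorem IsNeumannSolution.re_nonneg (hF : IsUnitFieldPotential halfPlane F)
    (h : IsNeumannSolution F u V w) (hu : MemLp u 2 (volume.restrict halfPlane))
    (hw : MemLp w 2 (volume.restrict halfPlane)) :
    0 ≤ (∫ x in halfPlane, w x * conj (u x)).re :=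
  ge_of_tendsto' (h.tendsto_energy hF hu hw) fun _ =>
    Finset.sum_nonneg fun _ _ => integral_nonneg fun _ => sq_nonneg _

/-- First n → ∞ at fixed δ removes the gradient term, leaving |Im| ≤ δE; then δ → 0. -/
theorem IsNeumannSolution.im_eq_zero (hF : IsUnitFieldPotential halfPlane F)
    (h : IsNeumannSolution F u V w) (hu : MemLp u 2 (volume.restrict halfPlane))
    (hw : MemLp w 2 (volume.restrict halfPlane)) :
    (∫ x in halfPlane, w x * conj (u x)).im = 0 := by
  set E := (∫ x in halfPlane, w x * conj (u x)).re with hE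
  have key : ∀ δ : ℝ, 0 < δ → |(∫ x in halfPlane, w x * conj (u x)).im| ≤ δ * E := by
    intro δ hδ
    have h1 := ((Complex.continuous_im.tendsto _).comp
      (tendsto_setIntegral_mul_conj_logCutoff hu hw)).abs
    have h2 := ((h.tendsto_energy hF hu hw).const_mul δ).add
      ((tendsto_setIntegral_gradSq_logCutoff_mul hu).div_const δ)
    rw [zero_div, add_zero] at h2
    exact le_of_tendsto_of_tendsto' h1 h2 fun n =>
      h.abs_im_le hF (contDiff_logCutoff n) (hasCompactSupport_logCutoff n) hδ
  have hlim : Tendsto (fun δ : ℝ => δ * E) (𝓝[>] 0) (𝓝 0) := by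
    have : Tendsto (fun δ : ℝ => δ * E) (𝓝 0) (𝓝 (0 * E)) := tendsto_id.mul_const E
    rw [zero_mul] at this
    exact this.mono_left nhdsWithin_le_nhds
  have := ge_of_tendsto hlim (eventually_nhdsWithin_of_forall fun δ hδ => key δ hδ)
  exact abs_eq_zero.1 (le_antisymm this (abs_nonneg _))

end Solution

/-! ### The spectral bound -/

/-- Below its infimum, there is no spectrum. -/
theorem exists_resolvent {F : Plane → Plane} (hpos : 0 < thetaZero F) {t : ℝ}
    (ht : t < thetaZero F) : ∃ R : L2HalfPlane →L[ℂ] L2HalfPlane, ∀ u f : L2HalfPlane,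
      (u, f + (t : ℂ) • u) ∈ neumannGraph F ↔ u = R f := by
  -- The real infimum of a set unbounded below is 0 by convention, so Θ₀ > 0 excludes that case.
  have hb : BddBelow {t : ℝ | (t : ℂ) ∈ graphSpectrum (neumannGraph F)} := by
    by_contra hb
    have : thetaZero F = 0 := Real.sInf_of_not_bddBelow hb
    exact hpos.ne' this
  by_contra hcon
  exact absurd (csInf_le hb (show t ∈ _ from hcon)) (not_le.2 ht)

/-- A nonzero r is in the spectrum of R = (H+1)⁻¹ only if t = -1 + 1/r is in that of H. For real r
with |r| > 1/(Θ+1) this t lies below Θ, where resolvents exist. The spectral radius of a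
self-adjoint operator is its norm. -/
theorem norm_resolvent_le {E : Type*} [NormedAddCommGroup E] [InnerProductSpace ℂ E]
    [CompleteSpace E] {G : Set (E × E)} {Θ : ℝ} (hΘ : 0 < Θ)
    (hres : ∀ t : ℝ, t < Θ → ∃ R : E →L[ℂ] E, ∀ u f : E, (u, f + (t : ℂ) • u) ∈ G ↔ u = R f)
    {R : E →L[ℂ] E} (hR : ∀ u f : E, (u, f + ((-1 : ℝ) : ℂ) • u) ∈ G ↔ u = R f)
    (hsa : IsSelfAdjoint R) : ‖R‖ ≤ 1 / (Θ + 1) := by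
  have hc : 0 ≤ 1 / (Θ + 1) := by positivity
  have hspec : ∀ k ∈ spectrum ℂ R, ‖k‖ ≤ 1 / (Θ + 1) := by
    intro k hk
    have hre : k = (k.re : ℂ) := hsa.mem_spectrum_eq_re hk
    set r := k.re with hr
    by_contra hlt
    rw [not_le, hre, Complex.norm_real, Real.norm_eq_abs] at hlt
    have hr0 : r ≠ 0 := by
      intro h0
      rw [h0, abs_zero] at hlt
      exact absurd hlt (not_lt.2 hc)
    -- For r < 0 even t < -1; for r > 0 the bound |r| > 1/(Θ+1) is used.
    have ht : -1 + 1 / r < Θ := by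
      rcases lt_or_gt_of_ne hr0 with hneg | hpos
      · have : 1 / r < 0 := one_div_neg.2 hneg
        linarith
      · rw [abs_of_pos hpos] at hlt
        have : 1 / r < Θ + 1 := by
          rw [div_lt_iff₀ (by linarith)] at hlt
          rw [div_lt_iff₀ hpos]
          linarith
        linarith
    obtain ⟨T, hT⟩ := hres _ ht
    have hrc : (r : ℂ) ≠ 0 := Complex.ofReal_ne_zero.2 hr0
    -- Both sides express (H - t)u = f, since t = -1 + 1/r.
    have hTR : ∀ u f : E, u = T f ↔ u = R (f + (r : ℂ)⁻¹ • u) := by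
      intro u f
      rw [← hT, ← hR]
      have : f + ((-1 + 1 / r : ℝ) : ℂ) • u =
          f + (r : ℂ)⁻¹ • u + ((-1 : ℝ) : ℂ) • u := by
        push_cast
        rw [add_smul, one_div]
        abel
      rw [this]
    rw [spectrum.mem_iff] at hk
    apply hk
    rw [ContinuousLinearMap.isUnit_iff_bijective, hre]
    have happ : ∀ x, (algebraMap ℂ (E →L[ℂ] E) (r : ℂ) - R) x = (r : ℂ) • x - R x := by
      intro x
      simp [Algebra.algebraMap_eq_smul_one]
    constructor
    · rw [injective_iff_map_eq_zero]
      intro x hx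
      rw [happ, sub_eq_zero] at hx
      have h1 : x = R (0 + (r : ℂ)⁻¹ • x) := by
        rw [zero_add, map_smul, ← hx, smul_smul, inv_mul_cancel₀ hrc, one_smul]
      rw [(hTR x 0).2 h1, map_zero]
    · intro y
      -- The preimage comes from (r - R)⁻¹ = r⁻¹ + r⁻²(H - t)⁻¹.
      obtain ⟨f, hf⟩ : ∃ f : E, f = ((r : ℂ)⁻¹ * (r : ℂ)⁻¹) • y := ⟨_, rfl⟩
      have h1 : T f = R (f + (r : ℂ)⁻¹ • T f) := (hTR _ f).1 rfl
      have h2 : (r : ℂ) • T f = (r : ℂ) • R f + R (T f) := by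
        nth_rewrite 1 [h1]
        rw [map_add, map_smul, smul_add, smul_smul, mul_inv_cancel₀ hrc, one_smul]
      refine ⟨(r : ℂ)⁻¹ • y + T f, ?_⟩
      have h3 : (r : ℂ) • R f = (r : ℂ)⁻¹ • R y := by
        rw [hf, map_smul, smul_smul, ← mul_assoc, mul_inv_cancel₀ hrc, one_mul]
      have h4 : R ((r : ℂ)⁻¹ • y) = (r : ℂ)⁻¹ • R y := map_smul _ _ _
      rw [happ, smul_add, h2, smul_smul, mul_inv_cancel₀ hrc, one_smul, map_add, h3, h4]
      abel
  have h1 := hsa.spectralRadius_eq_nnnorm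
  have h2 : spectralRadius ℂ R ≤ ENNReal.ofReal (1 / (Θ + 1)) := by
    refine iSup₂_le fun k hk => ?_
    rw [← enorm_eq_nnnorm, ← ofReal_norm]
    exact ENNReal.ofReal_le_ofReal (hspec k hk)
  rw [h1, ← enorm_eq_nnnorm, ← ofReal_norm] at h2
  exact (ENNReal.ofReal_le_ofReal_iff hc).1 h2

theorem mul_integral_conj_eq_inner (f g : L2HalfPlane) :
    ∫ x in halfPlane, f x * conj (g x) = inner ℂ g f := by
  rw [L2.inner_def]
  congr 1

section Resolvent

variable {F : Plane → Plane} {R : L2HalfPlane →L[ℂ] L2HalfPlane}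

theorem resolvent_coeFn (f u : L2HalfPlane) :
    (f + ((-1 : ℝ) : ℂ) • u : L2HalfPlane) =ᵐ[volume.restrict halfPlane] fun x => f x - u x := by
  filter_upwards [Lp.coeFn_add f (((-1 : ℝ) : ℂ) • u), Lp.coeFn_smul ((-1 : ℝ) : ℂ) u]
    with x h1 h2
  rw [h1, Pi.add_apply, h2]
  simp [sub_eq_add_neg]

theorem exists_isNeumannSolution_resolvent (hF : IsUnitFieldPotential halfPlane F)
    (hR : ∀ u f : L2HalfPlane, (u, f + ((-1 : ℝ) : ℂ) • u) ∈ neumannGraph F ↔ u = R f)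
    (f : L2HalfPlane) : ∃ V, IsNeumannSolution F (R f) V
      (f + ((-1 : ℝ) : ℂ) • R f : L2HalfPlane) := by
  obtain ⟨hL, hN⟩ := (hR (R f) f).2 rfl
  exact hN.exists_isNeumannSolution hF (Lp.memLp _).memL2Loc (Lp.memLp _).memL2Loc hL

theorem inner_resolvent (f : L2HalfPlane) : inner ℂ (R f) f =
    (∫ x in halfPlane, (f + ((-1 : ℝ) : ℂ) • R f : L2HalfPlane) x * conj (R f x)) +
      ((‖R f‖ ^ 2 : ℝ) : ℂ) := by
  rw [mul_integral_conj_eq_inner, inner_add_right, inner_smul_right, inner_self_eq_norm_sq_to_K]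
  push_cast
  simp

/-- With u = Rf one has ⟨Rf, f⟩ = ⟨Hu, u⟩ + ‖u‖² up to the order of the arguments, and the first
term is real and nonnegative by the energy identities. Self-adjointness of R is obtained here, not
assumed. -/
theorem isPositive_resolvent (hF : IsUnitFieldPotential halfPlane F)
    (hR : ∀ u f : L2HalfPlane, (u, f + ((-1 : ℝ) : ℂ) • u) ∈ neumannGraph F ↔ u = R f) :
    R.IsPositive := by
  rw [ContinuousLinearMap.isPositive_iff_complex]
  intro f
  obtain ⟨V, h⟩ := exists_isNeumannSolution_resolvent hF hR f
  have him := h.im_eq_zero hF (Lp.memLp _) (Lp.memLp _)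
  have hre := h.re_nonneg hF (Lp.memLp _) (Lp.memLp _)
  rw [inner_resolvent]
  constructor
  · apply Complex.ext
    · simp
    · rw [Complex.add_im, him, zero_add, Complex.ofReal_im, Complex.ofReal_im]
  · simp only [RCLike.re_to_complex, Complex.add_re, Complex.ofReal_re]
    positivity

end Resolvent

theorem cutDeriv_logCutoff_eq {n : ℕ} {x : Plane} (hx : ‖x‖ < n) (u : Plane → ℂ)
    (V : Fin 2 → Plane → ℂ) (j : Fin 2) : cutDeriv (logCutoff n) u V j x = V j x := by
  have h1 : logCutoff n =ᶠ[𝓝 x] fun _ => 1 := by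
    filter_upwards [Metric.isOpen_ball.mem_nhds (mem_ball_zero_iff.2 hx)] with y hy
    exact logCutoff_eq_one (mem_ball_zero_iff.1 hy).le
  rw [cutDeriv, h1.fderiv_eq, h1.self_of_nhds]
  simp

/-- The quadratic form of the Neumann realization is bounded below by `Θ₀` on functions of bounded
support. -/
theorem thetaZero_mul_integral_norm_sq_le {F : Plane → Plane}
    (hF : IsUnitFieldPotential halfPlane F) (hpos : 0 < thetaZero F) {v : Plane → ℂ}
    {Z : Fin 2 → Plane → ℂ} (hv : MemL2Loc halfPlane v) (hZ : ∀ j, MemL2Loc halfPlane (Z j))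
    (hd : ∀ j, HasMagneticDeriv halfPlane F j v (Z j)) {ρ : ℝ} (hvz : ∀ x, ρ ≤ ‖x‖ → v x = 0)
    (hZz : ∀ j x, ρ ≤ ‖x‖ → Z j x = 0) :
    thetaZero F * ∫ x in halfPlane, ‖v x‖ ^ 2 ≤ ∑ j, ∫ x in halfPlane, ‖Z j x‖ ^ 2 := by
  have hU := measurableSet_halfPlane
  -- Any t < Θ₀ has a resolvent; at -1 the form of H + 1 is also known to be positive.
  obtain ⟨R, hR⟩ := exists_resolvent hpos (t := -1) (by linarith)
  have hRpos := isPositive_resolvent hF hR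
  have hnorm := norm_resolvent_le hpos (fun t ht => exists_resolvent hpos ht) hR
    hRpos.isSelfAdjoint
  have hv2 := hv.memLp_of_eq_zero hU hvz
  have hZ2 := fun j => (hZ j).memLp_of_eq_zero hU (hZz j)
  set f : L2HalfPlane := hv2.toLp v with hf
  obtain ⟨V, h⟩ := exists_isNeumannSolution_resolvent hF hR f
  set u : L2HalfPlane := R f with hu
  set w : L2HalfPlane := f + ((-1 : ℝ) : ℂ) • u with hw
  have hu2 : MemLp u 2 (volume.restrict halfPlane) := Lp.memLp u
  have hfv : f =ᵐ[volume.restrict halfPlane] v := hv2.coeFn_toLp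
  set N := ∫ x in halfPlane, ‖v x‖ ^ 2 with hN
  set Q := ∑ j, ∫ x in halfPlane, ‖Z j x‖ ^ 2 with hQ
  have hnormsq : ∀ g : L2HalfPlane, ∫ x in halfPlane, ‖g x‖ ^ 2 = ‖g‖ ^ 2 := by
    intro g
    have h1 := mul_integral_conj_eq_inner g g
    rw [inner_self_eq_norm_sq_to_K] at h1
    have h2 : ∫ x in halfPlane, g x * conj (g x) =
        ((∫ x in halfPlane, ‖g x‖ ^ 2 : ℝ) : ℂ) := integral_mul_conj_self _
    rw [h2] at h1
    refine Complex.ofReal_injective ?_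
    rw [h1]
    simp
  have hNf : N = ‖f‖ ^ 2 := by
    rw [← hnormsq f]
    apply integral_congr_ae
    filter_upwards [hfv] with x hx
    rw [hx]
  have hgreen := h.green hF hv hZ hd hvz hZz
  have hwv : (∫ x in halfPlane, w x * conj (v x)) =
      (N : ℂ) - ∫ x in halfPlane, u x * conj (v x) := by
    have e1 : ∫ x in halfPlane, w x * conj (v x) =
        ∫ x in halfPlane, (v x * conj (v x) - u x * conj (v x)) := by
      apply integral_congr_ae
      filter_upwards [resolvent_coeFn f u, hfv] with x h1 h2
      rw [h1, h2]
      ring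
    rw [e1, integral_sub (hv2.integrable_mul_conj hv2) (hu2.integrable_mul_conj hv2), hN,
      integral_mul_conj_self]
  rw [hwv] at hgreen
  have hE := h.tendsto_energy hF hu2 (Lp.memLp w)
  -- For u = Rf with f = v, this bounds the energy of H + 1 at u by ⟨Rf, f⟩ ≤ ‖R‖‖f‖².
  have hinner : (∫ x in halfPlane, w x * conj (u x)).re + ‖u‖ ^ 2 ≤ 1 / (thetaZero F + 1) * N := by
    have h1 := congrArg Complex.re (inner_resolvent (R := R) f)
    rw [Complex.add_re, Complex.ofReal_re] at h1
    rw [← h1, hNf]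
    calc _ ≤ ‖inner ℂ (R f) f‖ := Complex.re_le_norm _
      _ ≤ ‖R f‖ * ‖f‖ := norm_inner_le_norm _ _
      _ ≤ (‖R‖ * ‖f‖) * ‖f‖ := by gcongr; exact R.le_opNorm f
      _ ≤ (1 / (thetaZero F + 1) * ‖f‖) * ‖f‖ := by gcongr
      _ = _ := by ring
  have hs : 0 < thetaZero F + 1 := by linarith
  set s := thetaZero F + 1 with hsdef
  -- Duality: Green's formula expresses N as the pairing of (V, u) with (Z, v). Young's inequality
  -- with weight s = Θ₀ + 1 is the choice for which the bound N/s on the energy of u contributes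
  -- exactly N, so that N ≤ (Q + N)/s remains, that is Θ₀N ≤ Q.
  have key : ∀ᶠ n in atTop, 2 * N ≤
      s * ((∑ j, ∫ x in halfPlane, ‖cutDeriv (logCutoff n) u V j x‖ ^ 2) + ‖u‖ ^ 2) +
        (Q + N) / s := by
    obtain ⟨m, hm⟩ := exists_nat_ge ρ
    filter_upwards [eventually_ge_atTop m] with n hn
    have hρn : ∀ x : Plane, ‖x‖ < ρ → ‖x‖ < n := fun x hx =>
      hx.trans_le (hm.trans (by exact_mod_cast hn))
    have hD2 : ∀ j, MemLp (cutDeriv (logCutoff n) u V j) 2 (volume.restrict halfPlane) := fun j =>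
      h.memL2Loc_fun.memLp_cutDeriv hU (contDiff_logCutoff n) (hasCompactSupport_logCutoff n)
        (h.memL2Loc_deriv j)
    -- Z vanishes beyond radius ρ and the cutoff is 1 on the disc of radius n ≥ ρ, so V may be
    -- replaced by the square integrable `cutDeriv`.
    have e1 : ∀ j, ∫ x in halfPlane, V j x * conj (Z j x) =
        ∫ x in halfPlane, cutDeriv (logCutoff n) u V j x * conj (Z j x) := by
      intro j
      congr 1
      funext x
      by_cases hx : ‖x‖ < ρ
      · rw [cutDeriv_logCutoff_eq (hρn x hx)]
      · simp [hZz j x (not_lt.1 hx)]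
    simp only [e1] at hgreen
    have e2 : 2 * N = (∑ j, ∫ x in halfPlane,
        2 * (cutDeriv (logCutoff n) u V j x * conj (Z j x)).re) +
          ∫ x in halfPlane, 2 * (u x * conj (v x)).re := by
      have h1 := congrArg Complex.re hgreen
      rw [Complex.re_sum, Complex.sub_re, Complex.ofReal_re,
        re_integral_eq (hu2.integrable_mul_conj hv2)] at h1
      simp only [re_integral_eq ((hD2 _).integrable_mul_conj (hZ2 _))] at h1
      simp only [integral_const_mul, ← Finset.mul_sum]
      rw [h1]
      ring
    rw [e2, hQ, hN, ← hnormsq u, mul_add, Finset.mul_sum, add_div, Finset.sum_div]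
    have b1 : ∀ j, ∫ x in halfPlane, 2 * (cutDeriv (logCutoff n) u V j x * conj (Z j x)).re ≤
        s * (∫ x in halfPlane, ‖cutDeriv (logCutoff n) u V j x‖ ^ 2) +
          (∫ x in halfPlane, ‖Z j x‖ ^ 2) / s := by
      intro j
      rw [← integral_const_mul, ← integral_div,
        ← integral_add ((hD2 j).integrable_norm_sq.const_mul _)
          ((hZ2 j).integrable_norm_sq.div_const _)]
      exact integral_mono (((hD2 j).integrable_mul_conj (hZ2 j)).re.const_mul 2)
        (((hD2 j).integrable_norm_sq.const_mul _).add ((hZ2 j).integrable_norm_sq.div_const _))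
        fun x => two_mul_re_mul_conj_le hs _ _
    have b2 : ∫ x in halfPlane, 2 * (u x * conj (v x)).re ≤
        s * (∫ x in halfPlane, ‖u x‖ ^ 2) + (∫ x in halfPlane, ‖v x‖ ^ 2) / s := by
      rw [← integral_const_mul, ← integral_div,
        ← integral_add (hu2.integrable_norm_sq.const_mul _)
          (hv2.integrable_norm_sq.div_const _)]
      exact integral_mono ((hu2.integrable_mul_conj hv2).re.const_mul 2)
        ((hu2.integrable_norm_sq.const_mul _).add (hv2.integrable_norm_sq.div_const _))
        fun x => two_mul_re_mul_conj_le hs _ _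
    have b3 := Finset.sum_le_sum fun j (_ : j ∈ Finset.univ) => b1 j
    rw [Finset.sum_add_distrib] at b3
    linarith
  have hlim := ((hE.add_const (‖u‖ ^ 2)).const_mul s).add_const ((Q + N) / s)
  have hfin := ge_of_tendsto hlim key
  have h3 : s * (1 / s * N) = N := by field_simp
  have h4 : s * ((∫ x in halfPlane, w x * conj (u x)).re + ‖u‖ ^ 2) ≤ N := by
    rw [← h3]
    gcongr
  have h5 : N ≤ (Q + N) / s := by linarith
  rw [le_div_iff₀ hs] at h5
  have : N * s = thetaZero F * N + N := by rw [hsdef]; ring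
  linarith

/-! ### Bounded functions -/

theorem exists_ae_norm_le_of_memLp_top {α : Type*} [MeasurableSpace α] {μ : Measure α} {ψ : α → ℂ}
    (h : MemLp ψ ∞ μ) : ∃ M : ℝ, 0 ≤ M ∧ ∀ᵐ x ∂μ, ‖ψ x‖ ≤ M := by
  refine ⟨(eLpNorm ψ ∞ μ).toReal, ENNReal.toReal_nonneg, ?_⟩
  have h1 := ae_le_eLpNormEssSup (f := ψ) (μ := μ)
  filter_upwards [h1] with x hx
  rw [← toReal_enorm]
  rw [eLpNorm_exponent_top]
  refine ENNReal.toReal_mono ?_ hx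
  have := h.2.ne
  rwa [eLpNorm_exponent_top] at this

theorem memL2Loc_of_ae_norm_le {U : Set Plane} {ψ : Plane → ℂ}
    (hm : AEStronglyMeasurable ψ (volume.restrict U)) {M : ℝ}
    (hM : ∀ᵐ x ∂volume.restrict U, ‖ψ x‖ ≤ M) : MemL2Loc U ψ := by
  intro R
  have : IsFiniteMeasure (volume.restrict (U ∩ Metric.ball (0 : Plane) R)) :=
    ⟨by
      rw [Measure.restrict_apply_univ]
      exact (measure_mono inter_subset_right).trans_lt measure_ball_lt_top⟩
  exact MemLp.of_bound (hm.mono_measure (Measure.restrict_mono inter_subset_left le_rfl)) M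
    (ae_mono (Measure.restrict_mono inter_subset_left le_rfl) hM)

theorem setIntegral_gradSq_mul_le {U : Set Plane} {ψ : Plane → ℂ} {M : ℝ}
    (hM : ∀ᵐ x ∂volume.restrict U, ‖ψ x‖ ≤ M) {χ : Plane → ℝ} (hχ : ContDiff ℝ ∞ χ)
    (hs : HasCompactSupport χ) :
    ∫ x in U, gradSq χ x * ‖ψ x‖ ^ 2 ≤ M ^ 2 * ∫ x, gradSq χ x := by
  have hi : Integrable (gradSq χ) :=
    (continuous_gradSq hχ).integrable_of_hasCompactSupport (hasCompactSupport_gradSq hs)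
  calc _ ≤ ∫ x in U, M ^ 2 * gradSq χ x := by
        refine integral_mono_of_nonneg (ae_of_all _ fun x =>
          mul_nonneg (gradSq_nonneg _ _) (sq_nonneg _)) (hi.restrict.const_mul _) ?_
        filter_upwards [hM] with x hx
        rw [mul_comm]
        exact mul_le_mul_of_nonneg_right (pow_le_pow_left₀ (norm_nonneg _) hx 2)
          (gradSq_nonneg _ _)
    _ = M ^ 2 * ∫ x in U, gradSq χ x := integral_const_mul _ _
    _ ≤ _ := mul_le_mul_of_nonneg_left
        (setIntegral_le_integral hi (ae_of_all _ (gradSq_nonneg χ))) (sq_nonneg _)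

/-- A bounded function which satisfies the localized energy inequality for the right-hand side
`(l - b |ψ|²) ψ` vanishes if `l ≤ θ` and `0 ≤ b`, with one of the inequalities strict. -/
theorem ae_eq_zero_of_energy_le {U : Set Plane} (hU : MeasurableSet U) {ψ : Plane → ℂ}
    (hm : AEStronglyMeasurable ψ (volume.restrict U)) {M : ℝ}
    (hM : ∀ᵐ x ∂volume.restrict U, ‖ψ x‖ ≤ M) {θ l b : ℝ} (hl : l ≤ θ) (hb : 0 ≤ b)
    (hstrict : l = θ → 0 < b)
    (h : ∀ χ : Plane → ℝ, ContDiff ℝ ∞ χ → HasCompactSupport χ →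
      θ * ∫ x in U, ‖(χ x : ℂ) * ψ x‖ ^ 2 ≤
        (∫ x in U, ((l - b * ‖ψ x‖ ^ 2 : ℝ) : ℂ) * ψ x * conj (((χ x ^ 2 : ℝ) : ℂ) * ψ x)).re +
          ∫ x in U, gradSq χ x * ‖ψ x‖ ^ 2) :
    ∀ᵐ x ∂volume.restrict U, ψ x = 0 := by
  have hL := memL2Loc_of_ae_norm_le hm hM
  -- The density left on the lower side once the right-hand side is subtracted from θ|ψ|²; it is
  -- nonnegative because l ≤ θ and b ≥ 0.
  set p : Plane → ℝ := fun x => (θ - (l - b * ‖ψ x‖ ^ 2)) * ‖ψ x‖ ^ 2 with hp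
  have hp0 : ∀ x, 0 ≤ p x := fun x => mul_nonneg
    (by nlinarith [mul_nonneg hb (sq_nonneg ‖ψ x‖)]) (sq_nonneg _)
  have hqb : ∀ᵐ x ∂volume.restrict U, ‖θ - (l - b * ‖ψ x‖ ^ 2)‖ ≤ (θ - l) + b * M ^ 2 := by
    filter_upwards [hM] with x hx
    rw [Real.norm_of_nonneg (by nlinarith [mul_nonneg hb (sq_nonneg ‖ψ x‖)])]
    have := mul_le_mul_of_nonneg_left (pow_le_pow_left₀ (norm_nonneg _) hx 2) hb
    linarith
  have hqm : AEStronglyMeasurable (fun x => θ - (l - b * ‖ψ x‖ ^ 2)) (volume.restrict U) :=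
    aestronglyMeasurable_const.sub (aestronglyMeasurable_const.sub ((hm.norm.pow 2).const_mul b))
  have hpi : ∀ R, IntegrableOn p (U ∩ Metric.ball 0 R) := fun R =>
    ((hL R).integrable_norm_sq).bdd_mul
      (hqm.mono_measure (Measure.restrict_mono inter_subset_left le_rfl))
      (ae_mono (Measure.restrict_mono inter_subset_left le_rfl) hqb)
  have hzero := ae_eq_zero_of_integral_sq_mul_le_gradSq (K := M ^ 2) hp0 hpi hU fun χ hχ hs => by
    have h1 := h χ hχ hs
    have h2 := setIntegral_gradSq_mul_le hM hχ hs
    have hc := hL.memLp_cut hU hχ.continuous hs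
    have hi1 := hc.integrable_norm_sq
    have hqm' : AEStronglyMeasurable (fun x => l - b * ‖ψ x‖ ^ 2) (volume.restrict U) :=
      aestronglyMeasurable_const.sub ((hm.norm.pow 2).const_mul b)
    have hi2 : IntegrableOn (fun x => (l - b * ‖ψ x‖ ^ 2) * ‖(χ x : ℂ) * ψ x‖ ^ 2) U := by
      refine hi1.bdd_mul (c := |l| + b * M ^ 2) hqm' ?_
      filter_upwards [hM] with x hx
      have := mul_le_mul_of_nonneg_left (pow_le_pow_left₀ (norm_nonneg _) hx 2) hb
      refine (norm_sub_le _ _).trans (add_le_add le_rfl ?_)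
      rwa [Real.norm_of_nonneg (mul_nonneg hb (sq_nonneg _))]
    have e1 : (∫ x in U, ((l - b * ‖ψ x‖ ^ 2 : ℝ) : ℂ) * ψ x *
        conj (((χ x ^ 2 : ℝ) : ℂ) * ψ x)).re =
          ∫ x in U, (l - b * ‖ψ x‖ ^ 2) * ‖(χ x : ℂ) * ψ x‖ ^ 2 := by
      have e2 : ∀ x, ((l - b * ‖ψ x‖ ^ 2 : ℝ) : ℂ) * ψ x * conj (((χ x ^ 2 : ℝ) : ℂ) * ψ x) =
          (((l - b * ‖ψ x‖ ^ 2) * ‖(χ x : ℂ) * ψ x‖ ^ 2 : ℝ) : ℂ) := by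
        intro x
        rw [map_mul, Complex.conj_ofReal, norm_mul, Complex.norm_real, mul_pow, Real.norm_eq_abs,
          sq_abs]
        have := Complex.mul_conj (ψ x)
        rw [Complex.normSq_eq_norm_sq] at this
        rw [show ∀ a b c d : ℂ, a * b * (c * d) = a * (c * (b * d)) by intros; ring, this]
        push_cast
        ring
      simp only [e2]
      rw [integral_complex_ofReal, Complex.ofReal_re]
    rw [e1] at h1
    calc ∫ x in U, χ x ^ 2 * p x = ∫ x in U, (θ * ‖(χ x : ℂ) * ψ x‖ ^ 2 -
          (l - b * ‖ψ x‖ ^ 2) * ‖(χ x : ℂ) * ψ x‖ ^ 2) := by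
          congr 1
          funext x
          rw [norm_mul, Complex.norm_real, mul_pow, Real.norm_eq_abs, sq_abs]
          simp only [p]
          ring
      _ ≤ _ := by
          rw [integral_sub (hi1.const_mul _) hi2, integral_const_mul]
          linarith
  filter_upwards [hzero] with x hx
  -- If ψ(x) ≠ 0, then θ - l + b|ψ|² > 0: from its first part if l < θ, from its second if l = θ.
  rcases mul_eq_zero.1 hx with h0 | h0
  · by_contra hne
    have hpos : 0 < ‖ψ x‖ ^ 2 := by positivity
    rcases lt_or_eq_of_le hl with hlt | heq
    · nlinarith [mul_nonneg hb hpos.le]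
    · nlinarith [mul_pos (hstrict heq) hpos]
  · simpa using h0

/-! ### Second order magnetic derivatives of test functions -/

theorem partialDeriv_coord {F : Plane → Plane} {x : Plane} (h : DifferentiableAt ℝ F x)
    (j k : Fin 2) : partialDeriv k (fun y => (F y j : ℂ)) x =
      (fderiv ℝ F x (EuclideanSpace.single k 1) j : ℂ) := by
  rw [partialDeriv_ofReal (χ := fun y => F y j) (by fun_prop)]
  have h1 : HasFDerivAt (fun y => F y j)
      ((EuclideanSpace.proj j : Plane →L[ℝ] ℝ).comp (fderiv ℝ F x)) x :=
    (EuclideanSpace.proj j : Plane →L[ℝ] ℝ).hasFDerivAt.comp x h.hasFDerivAt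
  rw [h1.fderiv]
  rfl

theorem IsUnitFieldPotential.differentiableAt {U : Set Plane} (hU : IsOpen U) {F : Plane → Plane}
    (hF : IsUnitFieldPotential U F) {x : Plane} (hx : x ∈ U) : DifferentiableAt ℝ F x :=
  (hF.1.contDiffAt (mem_of_superset (hU.mem_nhds hx) subset_closure)).differentiableAt one_ne_zero

/-- Apart from i ∂_kF_j φ, the expansion is symmetric in j and k, so the commutator of two magnetic
derivatives is multiplication by ±i curl F. -/
theorem magneticTranspose_magneticTranspose {F : Plane → Plane} {x : Plane}
    (h : DifferentiableAt ℝ F x) {φ : Plane → ℂ} (hφ : ContDiff ℝ ∞ φ) (k j : Fin 2) :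
    magneticTranspose F k (magneticTranspose F j φ) x =
      -partialDeriv k (partialDeriv j φ) x +
        Complex.I * (fderiv ℝ F x (EuclideanSpace.single k 1) j : ℂ) * φ x +
        Complex.I * ((F x j : ℂ) * partialDeriv k φ x + (F x k : ℂ) * partialDeriv j φ x) +
        (F x k : ℂ) * (F x j : ℂ) * φ x := by
  have hFj : DifferentiableAt ℝ (fun y => (F y j : ℂ)) x :=
    Complex.ofRealCLM.differentiableAt.comp x (by fun_prop)
  have hφ1 : DifferentiableAt ℝ φ x := hφ.differentiable (by simp) x
  have hp1 : DifferentiableAt ℝ (partialDeriv j φ) x :=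
    (contDiff_partialDeriv hφ j).differentiable (by simp) x
  have e : partialDeriv k (magneticTranspose F j φ) x =
      Complex.I * partialDeriv k (partialDeriv j φ) x +
        ((F x j : ℂ) * partialDeriv k φ x +
          (fderiv ℝ F x (EuclideanSpace.single k 1) j : ℂ) * φ x) := by
    rw [← partialDeriv_coord h j k, ← partialDeriv_mul hFj hφ1]
    have h1 := (hp1.hasFDerivAt.const_mul Complex.I).fun_add
      (hFj.fun_mul hφ1).hasFDerivAt
    exact congrArg (fun L : Plane →L[ℝ] ℂ => L (EuclideanSpace.single k 1)) h1.fderiv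
  rw [magneticTranspose, e, magneticTranspose]
  linear_combination (partialDeriv k (partialDeriv j φ) x) * Complex.I_mul_I

theorem partialDeriv_comm {φ : Plane → ℂ} (hφ : ContDiff ℝ ∞ φ) (j k : Fin 2) (x : Plane) :
    partialDeriv j (partialDeriv k φ) x = partialDeriv k (partialDeriv j φ) x := by
  have hd : DifferentiableAt ℝ (fderiv ℝ φ) x :=
    (hφ.fderiv_right (m := ∞) (by simp)).differentiable (by simp) x
  have e : ∀ j k : Fin 2, partialDeriv j (partialDeriv k φ) x =
      fderiv ℝ (fderiv ℝ φ) x (EuclideanSpace.single j 1) (EuclideanSpace.single k 1) := by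
    intro j k
    unfold partialDeriv
    rw [fderiv_clm_apply hd (differentiableAt_const _)]
    simp
  rw [e, e]
  exact ((contDiff_infty.1 hφ 2).contDiffAt.isSymmSndFDerivAt (by simp)) _ _

/-- A function on which the magnetic derivatives vanish is zero. -/
theorem ae_eq_zero_of_hasMagneticDeriv_zero {U : Set Plane} (hU : IsOpen U) {F : Plane → Plane}
    (hF : IsUnitFieldPotential U F) {u : Plane → ℂ} (hu : MemL2Loc U u) {V : Fin 2 → Plane → ℂ}
    (hV : ∀ j, MemL2Loc U (V j)) (hd : ∀ j, HasMagneticDeriv U F j u (V j))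
    (hz : ∀ j, ∀ᵐ x ∂volume.restrict U, V j x = 0) : ∀ᵐ x ∂volume.restrict U, u x = 0 := by
  refine hu.ae_eq_of_integral_eq hU (b := fun _ => 0) (continuous_const.memL2Loc hU.measurableSet)
    fun φ hφ hsub => ?_
  have hc : ∀ j, ContDiff ℝ 1 (magneticTranspose F j φ) :=
    contDiff_magneticTranspose hU hF hφ.1 hsub
  have hs : ∀ j, HasCompactSupport (magneticTranspose F j φ) := fun j =>
    hφ.2.of_isClosed_subset (isClosed_tsupport _) (tsupport_magneticTranspose_subset F j φ)
  have key : ∀ j k, ∫ x in U, u x * magneticTranspose F j (magneticTranspose F k φ) x = 0 := by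
    intro j k
    rw [(hd j).integral_eq_of_contDiff_one hU hF hu (hV j) (hc k) (hs k)
      ((tsupport_magneticTranspose_subset F k φ).trans hsub)]
    apply integral_eq_zero_of_ae
    filter_upwards [hz j] with x hx
    simp [hx]
  have hint : ∀ j k, IntegrableOn
      (fun x => u x * magneticTranspose F j (magneticTranspose F k φ) x) U := fun j k =>
    hF.integrableOn_mul_magneticTranspose hU.measurableSet hu (hc k) (hs k) j
  have hdiff : Complex.I * ∫ x in U, u x * φ x = 0 := by
    -- The right-hand 0 is written as the difference of two vanishing pairings, which produces the
    -- commutator, that is i times curl F = 1.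
    rw [← integral_const_mul, ← sub_self (0 : ℂ), ← key 0 1]
    nth_rewrite 2 [key 0 1]
    rw [← key 1 0, ← integral_sub (hint 0 1) (hint 1 0)]
    apply setIntegral_congr_fun hU.measurableSet
    intro x hx
    have hdx := hF.differentiableAt hU hx
    have hcurl := hF.2 x hx
    rw [planeCurl] at hcurl
    have hcurl' : (fderiv ℝ F x (EuclideanSpace.single 0 1) 1 : ℂ) -
        (fderiv ℝ F x (EuclideanSpace.single 1 1) 0 : ℂ) = 1 := by exact_mod_cast hcurl
    simp only
    rw [magneticTranspose_magneticTranspose hdx hφ.1, magneticTranspose_magneticTranspose hdx hφ.1,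
      partialDeriv_comm hφ.1 1 0]
    linear_combination (-(u x) * Complex.I * φ x) * hcurl'
  have h0 := (mul_eq_zero.1 hdiff).resolve_left Complex.I_ne_zero
  rw [h0]
  simp

/-! ### The half-plane -/

/-- The spectral bound applies when Θ₀ > 0, and the energy is nonnegative in any case; hence the
maximum, which avoids any prior knowledge of the sign of Θ₀. -/
theorem IsNeumannSolution.energy_le {F : Plane → Plane} (hF : IsUnitFieldPotential halfPlane F)
    {u w : Plane → ℂ} {V : Fin 2 → Plane → ℂ} (h : IsNeumannSolution F u V w) {χ : Plane → ℝ}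
    (hχ : ContDiff ℝ ∞ χ) (hs : HasCompactSupport χ) :
    max (thetaZero F) 0 * ∫ x in halfPlane, ‖(χ x : ℂ) * u x‖ ^ 2 ≤
      (∫ x in halfPlane, w x * conj (((χ x ^ 2 : ℝ) : ℂ) * u x)).re +
        ∫ x in halfPlane, gradSq χ x * ‖u x‖ ^ 2 := by
  have hU := measurableSet_halfPlane
  rw [← h.energy hF hχ hs]
  rcases le_or_gt (thetaZero F) 0 with h0 | hpos
  · rw [max_eq_right h0, zero_mul]
    exact Finset.sum_nonneg fun _ _ => integral_nonneg fun _ => sq_nonneg _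
  · rw [max_eq_left hpos.le]
    obtain ⟨ρ, hρ⟩ := hs.exists_notMem_tsupport
    exact thetaZero_mul_integral_norm_sq_le hF hpos
      (h.memL2Loc_fun.continuous_mul hU (Complex.continuous_ofReal.comp hχ.continuous))
      (fun j => h.memL2Loc_fun.cutDeriv hU hχ (h.memL2Loc_deriv j))
      (fun j => (h.hasDeriv j).cut hU hF h.memL2Loc_fun hχ (h.memL2Loc_deriv j)) (ρ := ρ)
      (fun x hx => by simp [image_eq_zero_of_notMem_tsupport (hρ x hx)])
      (fun j x hx => cutDeriv_eq_zero (hρ x hx) u V j)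

/-- Recovers V from the localized derivative: χV_j = D_j(χu) + i(∂_jχ)u. -/
theorem norm_sq_mul_le_cutDeriv (χ : Plane → ℝ) (u : Plane → ℂ) (V : Fin 2 → Plane → ℂ)
    (j : Fin 2) (x : Plane) : χ x ^ 2 * ‖V j x‖ ^ 2 ≤ 2 * ‖cutDeriv χ u V j x‖ ^ 2 +
      2 * (fderiv ℝ χ x (EuclideanSpace.single j 1) ^ 2 * ‖u x‖ ^ 2) := by
  set a := cutDeriv χ u V j x with ha
  set b := Complex.I * (fderiv ℝ χ x (EuclideanSpace.single j 1) : ℂ) * u x with hb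
  have e : (χ x : ℂ) * V j x = a + b := by rw [ha, hb, cutDeriv]; ring
  have e1 : χ x ^ 2 * ‖V j x‖ ^ 2 = ‖a + b‖ ^ 2 := by
    rw [← e, norm_mul, Complex.norm_real, mul_pow, Real.norm_eq_abs, sq_abs]
  have e2 : fderiv ℝ χ x (EuclideanSpace.single j 1) ^ 2 * ‖u x‖ ^ 2 = ‖b‖ ^ 2 := by
    rw [hb, norm_mul, norm_mul, Complex.norm_I, one_mul, Complex.norm_real, mul_pow,
      Real.norm_eq_abs, sq_abs]
  rw [e1, e2]
  have h1 := norm_add_le a b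
  have h2 := pow_le_pow_left₀ (norm_nonneg _) h1 2
  nlinarith [sq_nonneg (‖a‖ - ‖b‖)]

/-- Bounded Neumann solutions of the homogeneous equation vanish. -/
theorem IsNeumannSolution.ae_eq_zero_of_rhs_zero {F : Plane → Plane}
    (hF : IsUnitFieldPotential halfPlane F) {u : Plane → ℂ} {V : Fin 2 → Plane → ℂ}
    (h : IsNeumannSolution F u V fun _ => 0) {M : ℝ}
    (hM : ∀ᵐ x ∂volume.restrict halfPlane, ‖u x‖ ≤ M) :
    ∀ᵐ x ∂volume.restrict halfPlane, u x = 0 := by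
  have hU := measurableSet_halfPlane
  -- With zero right-hand side the energy equals ∫|∇χ|²|u|² ≤ M²∫|∇χ|²; the two terms of
  -- `norm_sq_mul_le_cutDeriv` contribute 2M² each.
  have hzero := ae_eq_zero_of_integral_sq_mul_le_gradSq (U := halfPlane)
    (p := fun x => ∑ j, ‖V j x‖ ^ 2) (K := 4 * M ^ 2)
    (fun x => Finset.sum_nonneg fun _ _ => sq_nonneg _)
    (fun R => integrable_finsetSum _ fun j _ => (h.memL2Loc_deriv j R).integrable_norm_sq) hU
    fun χ hχ hs => by
      have hE := h.energy hF hχ hs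
      simp only [zero_mul, integral_zero, Complex.zero_re, zero_add] at hE
      have hg := setIntegral_gradSq_mul_le hM hχ hs
      have hgi : ∀ j, IntegrableOn
          (fun x => fderiv ℝ χ x (EuclideanSpace.single j 1) ^ 2 * ‖u x‖ ^ 2) halfPlane := fun j =>
        h.memL2Loc_fun.integrableOn_grad_sq_mul hU hχ hs j
      have hDi : ∀ j, IntegrableOn (fun x => ‖cutDeriv χ u V j x‖ ^ 2) halfPlane := fun j =>
        (h.memL2Loc_fun.memLp_cutDeriv hU hχ hs (h.memL2Loc_deriv j)).integrable_norm_sq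
      have hsi : ∀ j, IntegrableOn (fun x => 2 * ‖cutDeriv χ u V j x‖ ^ 2 +
          2 * (fderiv ℝ χ x (EuclideanSpace.single j 1) ^ 2 * ‖u x‖ ^ 2)) halfPlane := fun j =>
        ((hDi j).const_mul 2).add ((hgi j).const_mul 2)
      calc ∫ x in halfPlane, χ x ^ 2 * ∑ j, ‖V j x‖ ^ 2
          ≤ ∫ x in halfPlane, ∑ j, (2 * ‖cutDeriv χ u V j x‖ ^ 2 +
              2 * (fderiv ℝ χ x (EuclideanSpace.single j 1) ^ 2 * ‖u x‖ ^ 2)) := by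
            refine integral_mono_of_nonneg (ae_of_all _ fun x => mul_nonneg (sq_nonneg _)
              (Finset.sum_nonneg fun _ _ => sq_nonneg _))
              (integrable_finsetSum _ fun j _ => hsi j)
              (ae_of_all _ fun x => ?_)
            simp only [Finset.mul_sum]
            exact Finset.sum_le_sum fun j _ => norm_sq_mul_le_cutDeriv χ u V j x
        _ = 2 * (∑ j, ∫ x in halfPlane, ‖cutDeriv χ u V j x‖ ^ 2) +
              2 * ∫ x in halfPlane, gradSq χ x * ‖u x‖ ^ 2 := by
            rw [integral_finsetSum _ fun j _ => hsi j]
            simp only [gradSq, Finset.sum_mul]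
            rw [integral_finsetSum _ fun j _ => hgi j, Finset.mul_sum, Finset.mul_sum,
              ← Finset.sum_add_distrib]
            refine Finset.sum_congr rfl fun j _ => ?_
            rw [integral_add ((hDi j).const_mul 2) ((hgi j).const_mul 2), integral_const_mul,
              integral_const_mul]
        _ ≤ _ := by
            rw [hE]
            linarith
  refine ae_eq_zero_of_hasMagneticDeriv_zero isOpen_halfPlane hF h.memL2Loc_fun h.memL2Loc_deriv
    h.hasDeriv fun j => ?_
  filter_upwards [hzero] with x hx
  have := (Finset.sum_eq_zero_iff_of_nonneg fun j _ => sq_nonneg ‖V j x‖).1 hx j (Finset.mem_univ j)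
  simpa using this

/-- The conclusion on the half-plane for the right-hand side `(l - b |ψ|²) ψ`. -/
theorem ae_eq_zero_of_neumann {F : Plane → Plane} (hF : IsUnitFieldPotential halfPlane F)
    {ψ : Plane → ℂ} (hψ : MemLp ψ ∞ (volume.restrict halfPlane)) {l b : ℝ} (hb : 0 ≤ b)
    (hl : l ≤ max (thetaZero F) 0) (hstrict : l = max (thetaZero F) 0 → b = 0 → l = 0)
    (hL : HasMagneticLaplacian halfPlane F ψ
      fun x => ((l - b * ‖ψ x‖ ^ 2 : ℝ) : ℂ) * ψ x)
    (hN : MagneticNeumann F ψ) : ∀ᵐ x ∂volume.restrict halfPlane, ψ x = 0 := by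
  obtain ⟨M, hM0, hM⟩ := exists_ae_norm_le_of_memLp_top hψ
  have hψ2 := memL2Loc_of_ae_norm_le hψ.1 hM
  have hw2 : MemL2Loc halfPlane fun x => ((l - b * ‖ψ x‖ ^ 2 : ℝ) : ℂ) * ψ x := by
    refine memL2Loc_of_ae_norm_le (M := (|l| + b * M ^ 2) * M)
      ((Complex.continuous_ofReal.comp_aestronglyMeasurable
        (aestronglyMeasurable_const.sub ((hψ.1.norm.pow 2).const_mul b))).mul hψ.1) ?_
    filter_upwards [hM] with x hx
    rw [norm_mul, Complex.norm_real]
    refine mul_le_mul ((norm_sub_le _ _).trans (add_le_add le_rfl ?_)) hx (norm_nonneg _)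
      (by positivity)
    rw [Real.norm_of_nonneg (mul_nonneg hb (sq_nonneg _))]
    exact mul_le_mul_of_nonneg_left (pow_le_pow_left₀ (norm_nonneg _) hx 2) hb
  obtain ⟨V, h⟩ := hN.exists_isNeumannSolution hF hψ2 hw2 hL
  -- The only case without a strict inequality; there `hstrict` forces l = 0, and the equation is
  -- homogeneous.
  by_cases hcase : l = max (thetaZero F) 0 ∧ b = 0
  · have hl0 := hstrict hcase.1 hcase.2
    have hzero : (fun x => ((l - b * ‖ψ x‖ ^ 2 : ℝ) : ℂ) * ψ x) = fun _ => 0 := by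
      funext x
      simp [hl0, hcase.2]
    rw [hzero] at h
    exact h.ae_eq_zero_of_rhs_zero hF hM
  · exact ae_eq_zero_of_energy_le measurableSet_halfPlane hψ.1 hM hl hb
      (fun heq => lt_of_le_of_ne hb fun h0 => hcase ⟨heq, h0.symm⟩)
      fun χ hχ hs => h.energy_le hF hχ hs

/-! ### Smooth functions on the plane -/

theorem integrable_mul_of_hasCompactSupport {f g : Plane → ℂ} (hf : Continuous f)
    (hg : Continuous g) (hs : HasCompactSupport g) : Integrable fun x => f x * g x :=
  (hf.mul hg).integrable_of_hasCompactSupport hs.mul_left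

/-- The magnetic derivative `(-i ∂_j + F_j) u` of a differentiable function. -/
def magneticPartial (F : Plane → Plane) (j : Fin 2) (u : Plane → ℂ) (x : Plane) : ℂ :=
  -Complex.I * partialDeriv j u x + (F x j : ℂ) * u x

theorem IsUnitFieldPotential.contDiff {F : Plane → Plane} (hF : IsUnitFieldPotential univ F) :
    ContDiff ℝ 1 F := contDiffOn_univ.1 (by simpa using hF.1)

theorem IsUnitFieldPotential.contDiff_coord {F : Plane → Plane} (hF : IsUnitFieldPotential univ F)
    (j : Fin 2) : ContDiff ℝ 1 fun y => (F y j : ℂ) :=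
  contDiff_iff_contDiffAt.2 fun _ => hF.contDiffAt isOpen_univ (mem_univ _) j

theorem continuous_magneticPartial {F : Plane → Plane} (hF : IsUnitFieldPotential univ F)
    {u : Plane → ℂ} (hu : ContDiff ℝ 1 u) (j : Fin 2) : Continuous (magneticPartial F j u) :=
  (continuous_const.mul (continuous_partialDeriv hu j)).add
    ((hF.contDiff_coord j).continuous.mul hu.continuous)

theorem hasCompactSupport_magneticTranspose (F : Plane → Plane) {φ : Plane → ℂ}
    (hs : HasCompactSupport φ) (j : Fin 2) : HasCompactSupport (magneticTranspose F j φ) :=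
  hs.of_isClosed_subset (isClosed_tsupport _) (tsupport_magneticTranspose_subset F j φ)

theorem integral_magneticPartial_mul {F : Plane → Plane} (hF : IsUnitFieldPotential univ F)
    {u g : Plane → ℂ} (hu : ContDiff ℝ 1 u) (hg : ContDiff ℝ 1 g) (hs : HasCompactSupport g)
    (j : Fin 2) :
    ∫ x, magneticPartial F j u x * g x = ∫ x, u x * magneticTranspose F j g x := by
  have h1 := integral_mul_partialDeriv hu hg hs j
  have i1 := integrable_mul_of_hasCompactSupport hu.continuous (continuous_partialDeriv hg j)
    (hs.partialDeriv j)
  have i2 := integrable_mul_of_hasCompactSupport (continuous_partialDeriv hu j) hg.continuous hs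
  have i3 : Integrable fun x => (F x j : ℂ) * u x * g x := integrable_mul_of_hasCompactSupport
    ((hF.contDiff_coord j).continuous.mul hu.continuous) hg.continuous hs
  calc _ = ∫ x, (-Complex.I * (partialDeriv j u x * g x) + (F x j : ℂ) * u x * g x) := by
        congr 1; funext x; simp only [magneticPartial]; ring
    _ = ∫ x, (Complex.I * (u x * partialDeriv j g x) + (F x j : ℂ) * u x * g x) := by
        rw [integral_add (i2.const_mul _) i3, integral_add (i1.const_mul _) i3, integral_const_mul,
          integral_const_mul, h1]
        ring
    _ = _ := by
        congr 1; funext x; simp only [magneticTranspose]; ring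

theorem magneticPartial_conj (F : Plane → Plane) (j : Fin 2) {η : Plane → ℂ}
    (hη : ContDiff ℝ 1 η) (x : Plane) :
    magneticPartial F j (fun y => conj (η y)) x = conj (magneticTranspose F j η x) := by
  rw [magneticPartial, magneticTranspose, partialDeriv_conj (hη.differentiable one_ne_zero x)]
  simp

/-- The quadratic form of the magnetic Laplacian with unit field on the plane is bounded below
by `1`. -/
theorem integral_norm_sq_le_magneticTranspose {F : Plane → Plane}
    (hF : IsUnitFieldPotential univ F) {η : Plane → ℂ} (hη : IsTestFunction η) :
    ∫ x, ‖η x‖ ^ 2 ≤ ∑ j, ∫ x, ‖magneticTranspose F j η x‖ ^ 2 := by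
  have hη1 : ContDiff ℝ 1 η := hη.1.of_le (by simp)
  have hηc : ContDiff ℝ 1 fun y => conj (η y) := Complex.conjCLE.contDiff.comp hη1
  have hc : ∀ j, ContDiff ℝ 1 (magneticTranspose F j η) :=
    contDiff_magneticTranspose isOpen_univ hF hη.1 (subset_univ _)
  have hs : ∀ j, HasCompactSupport (magneticTranspose F j η) :=
    hasCompactSupport_magneticTranspose F hη.2
  have hT2 : ∀ j, MemLp (magneticTranspose F j η) 2 := fun j =>
    (hc j).continuous.memLp_of_hasCompactSupport (hs j)
  -- Conjugation exchanges the transpose with the magnetic derivative itself, so integrating by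
  -- parts puts both derivatives on η.
  have key : ∀ j k, ∫ x, magneticTranspose F k η x * conj (magneticTranspose F j η x) =
      ∫ x, conj (η x) * magneticTranspose F j (magneticTranspose F k η) x := by
    intro j k
    rw [← integral_magneticPartial_mul hF hηc (hc k) (hs k) j]
    congr 1
    funext x
    rw [magneticPartial_conj F j hη1 x, mul_comm]
  have hcomm : (∫ x, magneticTranspose F 1 η x * conj (magneticTranspose F 0 η x)) -
      ∫ x, magneticTranspose F 0 η x * conj (magneticTranspose F 1 η x) =
        Complex.I * ((∫ x, ‖η x‖ ^ 2 : ℝ) : ℂ) := by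
    have hi : ∀ j k, Integrable
        fun x => conj (η x) * magneticTranspose F j (magneticTranspose F k η) x := by
      intro j k
      refine integrable_mul_of_hasCompactSupport hηc.continuous ?_
        (hasCompactSupport_magneticTranspose F (hs k) j)
      exact (continuous_const.mul (continuous_partialDeriv (hc k) j)).add
        ((hF.contDiff_coord j).continuous.mul (hc k).continuous)
    rw [key, key, ← integral_sub (hi 0 1) (hi 1 0), ← integral_mul_conj_self,
      ← integral_const_mul]
    congr 1
    funext x
    have hdx := hF.differentiableAt isOpen_univ (mem_univ x)
    have hcurl := hF.2 x (mem_univ x)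
    rw [planeCurl] at hcurl
    have hcurl' : (fderiv ℝ F x (EuclideanSpace.single 0 1) 1 : ℂ) -
        (fderiv ℝ F x (EuclideanSpace.single 1 1) 0 : ℂ) = 1 := by exact_mod_cast hcurl
    rw [magneticTranspose_magneticTranspose hdx hη.1, magneticTranspose_magneticTranspose hdx hη.1,
      partialDeriv_comm hη.1 1 0]
    linear_combination (conj (η x) * Complex.I * η x) * hcurl'
  have i1 := (hT2 1).integrable_mul_conj (hT2 0)
  have i0 := (hT2 0).integrable_mul_conj (hT2 1)
  have i1' : Integrable fun x =>
    (magneticTranspose F 1 η x * conj (magneticTranspose F 0 η x)).im := i1.im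
  have i0' : Integrable fun x =>
    (magneticTranspose F 0 η x * conj (magneticTranspose F 1 η x)).im := i0.im
  have him := congrArg Complex.im hcomm
  rw [Complex.sub_im, im_integral_eq i1, im_integral_eq i0, Complex.I_mul_im, Complex.ofReal_re,
    ← integral_sub i1' i0'] at him
  rw [← him, Fin.sum_univ_two,
    ← integral_add (hT2 0).integrable_norm_sq (hT2 1).integrable_norm_sq]
  refine integral_mono (i1'.sub i0')
    ((hT2 0).integrable_norm_sq.add (hT2 1).integrable_norm_sq) fun x => ?_
  rw [Complex.sq_norm, Complex.sq_norm, Complex.normSq_apply, Complex.normSq_apply,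
    Complex.mul_im, Complex.mul_im, Complex.conj_re, Complex.conj_im, Complex.conj_re,
    Complex.conj_im]
  -- With a_j = `magneticTranspose F j η x`, the two squares add up to |a₀ + i a₁|² ≥ 0.
  nlinarith [sq_nonneg ((magneticTranspose F 0 η x).re - (magneticTranspose F 1 η x).im),
    sq_nonneg ((magneticTranspose F 0 η x).im + (magneticTranspose F 1 η x).re)]

/-! ### The mollified equation -/

/-- The multiplication part of the magnetic Laplacian. -/
def zerothOrder (F : Plane → Plane) (x : Plane) : ℂ :=
  ∑ j : Fin 2, (Complex.I * (fderiv ℝ F x (EuclideanSpace.single j 1) j : ℂ) + (F x j : ℂ) ^ 2)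

theorem continuous_zerothOrder {F : Plane → Plane} (hF : IsUnitFieldPotential univ F) :
    Continuous (zerothOrder F) := by
  refine continuous_finsetSum _ fun j _ => ?_
  have h1 : Continuous fun x => fderiv ℝ F x (EuclideanSpace.single j 1) :=
    (hF.contDiff.continuous_fderiv one_ne_zero).clm_apply continuous_const
  have h2 : Continuous fun x => (fderiv ℝ F x (EuclideanSpace.single j 1) j : ℂ) := by fun_prop
  exact (continuous_const.mul h2).add ((hF.contDiff_coord j).continuous.pow 2)

theorem sum_magneticTranspose_magneticTranspose {F : Plane → Plane}
    (hF : IsUnitFieldPotential univ F) {φ : Plane → ℂ} (hφ : ContDiff ℝ ∞ φ) (x : Plane) :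
    ∑ j : Fin 2, magneticTranspose F j (magneticTranspose F j φ) x =
      (∑ j : Fin 2, (-partialDeriv j (partialDeriv j φ) x +
        2 * Complex.I * (F x j : ℂ) * partialDeriv j φ x)) + zerothOrder F x * φ x := by
  rw [zerothOrder, Finset.sum_mul, ← Finset.sum_add_distrib]
  refine Finset.sum_congr rfl fun j _ => ?_
  rw [magneticTranspose_magneticTranspose (hF.differentiableAt isOpen_univ (mem_univ x)) hφ]
  ring

theorem MemL2Loc.locallyIntegrable {a : Plane → ℂ} (ha : MemL2Loc univ a) :
    LocallyIntegrable a := locallyIntegrableOn_univ.1 (ha.locallyIntegrableOn isOpen_univ)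

theorem MemL2Loc.integrable_mul {a g : Plane → ℂ} (ha : MemL2Loc univ a) (hg : Continuous g)
    (hs : HasCompactSupport g) : Integrable fun x => a x * g x := by
  obtain ⟨R, hR⟩ := hs.exists_eq_zero_of_norm_le
  exact integrableOn_univ.1 (ha.integrableOn_mul MeasurableSet.univ
    (hg.memL2Loc MeasurableSet.univ) hR)

section Mollified

variable {F : Plane → Plane} {ψ w : Plane → ℂ}

/-- The distributional equation is tested with z ↦ κ(x - z). In divergence form it reads -Δψ -
∑∂_j(2iF_jψ) + (i div F + |F|²)ψ = w, which needs only continuity of the first derivatives of F. -/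
theorem mollify_equation (hF : IsUnitFieldPotential univ F) (hψ : MemL2Loc univ ψ)
    (h : HasMagneticLaplacian univ F ψ w) (n : ℕ) (x : Plane) :
    (∑ j : Fin 2, (-partialDeriv j (partialDeriv j (mollify n ψ)) x -
      partialDeriv j (mollify n fun y => 2 * Complex.I * ((F y j : ℂ) * ψ y)) x)) +
        mollify n (fun y => zerothOrder F y * ψ y) x = mollify n w x := by
  have hκ := contDiff_leftKernel n
  have hs := hasCompactSupport_leftKernel n
  set κ := leftKernel n
  have hk1 : ∀ j : Fin 2, ContDiff ℝ ∞ fun y => fderiv ℝ κ y (EuclideanSpace.single j 1) :=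
    fun j => continuous_fderiv_apply hκ _
  have hs1 : ∀ j : Fin 2, HasCompactSupport fun y => fderiv ℝ κ y (EuclideanSpace.single j 1) :=
    fun j => (hs.fderiv ℝ).mono fun x hx => by
      contrapose! hx
      simp only [Function.mem_support, not_not] at hx ⊢
      simp [hx]
  have hG : ∀ j : Fin 2, MemL2Loc univ fun y => 2 * Complex.I * ((F y j : ℂ) * ψ y) := fun j =>
    (hF.memL2Loc_mul MeasurableSet.univ hψ j).const_mul _
  have hH : MemL2Loc univ fun y => zerothOrder F y * ψ y :=
    hψ.continuous_mul MeasurableSet.univ (continuous_zerothOrder hF)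
  have hφ := isTestFunction_reflect hκ hs x
  have key := h _ hφ (subset_univ _)
  simp only [Measure.restrict_univ] at key
  have hp1 : ∀ j : Fin 2, partialDeriv j (fun z => (κ (x - z) : ℂ)) =
      fun z => (((fun y => -fderiv ℝ κ y (EuclideanSpace.single j 1)) (x - z) : ℝ) : ℂ) := by
    intro j
    funext z
    rw [partialDeriv_reflect hκ]
    simp
  have hp2 : ∀ (j : Fin 2) z, partialDeriv j (partialDeriv j (fun z => (κ (x - z) : ℂ))) z =
      (fderiv ℝ (fun y => fderiv ℝ κ y (EuclideanSpace.single j 1)) (x - z)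
        (EuclideanSpace.single j 1) : ℂ) := by
    intro j z
    rw [hp1]
    refine (partialDeriv_reflect (k := fun y => -fderiv ℝ κ y (EuclideanSpace.single j 1))
      (hk1 j).neg x j z).trans ?_
    rw [fderiv_fun_neg]
    simp
  have i0 : ∀ {a : Plane → ℂ}, MemL2Loc univ a → Integrable fun z => a z * (κ (x - z) : ℂ) :=
    fun ha => ha.integrable_mul hφ.1.continuous hφ.2
  have i1 : ∀ {a : Plane → ℂ} (j : Fin 2), MemL2Loc univ a → Integrable fun z =>
      a z * partialDeriv j (fun z => (κ (x - z) : ℂ)) z := fun j ha =>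
    ha.integrable_mul (contDiff_partialDeriv hφ.1 j).continuous (hφ.2.partialDeriv j)
  have i2 : ∀ (j : Fin 2), Integrable fun z =>
      ψ z * partialDeriv j (partialDeriv j fun z => (κ (x - z) : ℂ)) z := fun j =>
    hψ.integrable_mul (contDiff_partialDeriv (contDiff_partialDeriv hφ.1 j) j).continuous
      ((hφ.2.partialDeriv j).partialDeriv j)
  have m0 : ∀ a : Plane → ℂ, mollify n a x = ∫ z, a z * (κ (x - z) : ℂ) := by
    intro a
    rw [mollify, smear_apply_swap]
    congr 1
    funext z
    rw [Complex.real_smul, mul_comm]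
  have m1 : ∀ (j : Fin 2) {a : Plane → ℂ}, MemL2Loc univ a → partialDeriv j (mollify n a) x =
      -∫ z, a z * partialDeriv j (fun z => (κ (x - z) : ℂ)) z := by
    intro j a ha
    unfold mollify
    rw [partialDeriv_smear hκ hs ha.locallyIntegrable, smear_apply_swap, ← integral_neg]
    congr 1
    funext z
    rw [partialDeriv_reflect hκ, Complex.real_smul]
    ring
  have m2 : ∀ j : Fin 2, partialDeriv j (partialDeriv j (mollify n ψ)) x =
      ∫ z, ψ z * partialDeriv j (partialDeriv j fun z => (κ (x - z) : ℂ)) z := by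
    intro j
    unfold mollify
    rw [partialDeriv_smear hκ hs hψ.locallyIntegrable,
      partialDeriv_smear (hk1 j) (hs1 j) hψ.locallyIntegrable, smear_apply_swap]
    congr 1
    funext z
    rw [hp2, Complex.real_smul, mul_comm]
  rw [m0, m0, ← key, Finset.sum_congr rfl fun j _ => by rw [m1 j (hG j), m2 j]]
  have e : ∀ z, ψ z * ∑ j : Fin 2, magneticTranspose F j
      (magneticTranspose F j fun z => (κ (x - z) : ℂ)) z =
      (∑ j : Fin 2, (-(ψ z * partialDeriv j (partialDeriv j fun z => (κ (x - z) : ℂ)) z) +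
        2 * Complex.I * ((F z j : ℂ) * ψ z) * partialDeriv j (fun z => (κ (x - z) : ℂ)) z)) +
          zerothOrder F z * ψ z * (κ (x - z) : ℂ) := by
    intro z
    rw [sum_magneticTranspose_magneticTranspose hF hφ.1, mul_add, Finset.mul_sum]
    congr 1
    · refine Finset.sum_congr rfl fun j _ => ?_
      ring
    · ring
  simp only [e]
  have hij : ∀ j : Fin 2, Integrable fun z =>
      -(ψ z * partialDeriv j (partialDeriv j fun z => (κ (x - z) : ℂ)) z) +
        2 * Complex.I * ((F z j : ℂ) * ψ z) * partialDeriv j (fun z => (κ (x - z) : ℂ)) z :=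
    fun j => (i2 j).neg.add (i1 j (hG j))
  have i2' : ∀ j : Fin 2, Integrable fun z =>
      -(ψ z * partialDeriv j (partialDeriv j fun z => (κ (x - z) : ℂ)) z) := fun j => (i2 j).neg
  rw [integral_add (integrable_finsetSum _ fun j _ => hij j) (i0 hH),
    integral_finsetSum _ fun j _ => hij j]
  congr 1
  refine Finset.sum_congr rfl fun j _ => ?_
  rw [integral_add (i2' j) (i1 j (hG j)), integral_neg]
  ring

/-- The commutator of mollification with the first order part of the magnetic Laplacian. -/
def mollifyFlux (F : Plane → Plane) (ψ : Plane → ℂ) (n : ℕ) (j : Fin 2) (x : Plane) : ℂ :=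
  2 * Complex.I * ((F x j : ℂ) * mollify n ψ x) -
    mollify n (fun y => 2 * Complex.I * ((F y j : ℂ) * ψ y)) x

/-- The right-hand side of the mollified equation. -/
def mollifySource (F : Plane → Plane) (ψ w : Plane → ℂ) (n : ℕ) (x : Plane) : ℂ :=
  zerothOrder F x * mollify n ψ x - mollify n (fun y => zerothOrder F y * ψ y) x + mollify n w x

theorem continuous_mollify {f : Plane → ℂ} (hf : MemL2Loc univ f) (n : ℕ) :
    Continuous (mollify n f) := (contDiff_mollify hf.locallyIntegrable n).continuous

theorem continuous_mollifyFlux (hF : IsUnitFieldPotential univ F) (hψ : MemL2Loc univ ψ)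
    (n : ℕ) (j : Fin 2) : Continuous (mollifyFlux F ψ n j) :=
  (continuous_const.mul ((hF.contDiff_coord j).continuous.mul (continuous_mollify hψ n))).sub
    (continuous_mollify ((hF.memL2Loc_mul MeasurableSet.univ hψ j).const_mul _) n)

/-- For the smooth u = `mollify n ψ`, the commutator of mollification with the first order term is
kept under the derivative. The error is then a flux paired with ∂_jη, and the flux goes to 0 in
L²_loc without control of ∇u. -/
theorem integral_mollify_weak (hF : IsUnitFieldPotential univ F) (hψ : MemL2Loc univ ψ)
    (hw : MemL2Loc univ w) (h : HasMagneticLaplacian univ F ψ w) (n : ℕ) {η : Plane → ℂ}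
    (hη : IsTestFunction η) :
    ∑ j, ∫ x, magneticPartial F j (mollify n ψ) x * magneticTranspose F j η x =
      (∑ j, ∫ x, mollifyFlux F ψ n j x * partialDeriv j η x) +
        ∫ x, mollifySource F ψ w n x * η x := by
  have hu : ContDiff ℝ ∞ (mollify n ψ) := contDiff_mollify hψ.locallyIntegrable n
  have hu1 : ContDiff ℝ 1 (mollify n ψ) := hu.of_le (by simp)
  have hη1 : ContDiff ℝ 1 η := hη.1.of_le (by simp)
  have hG : ∀ j : Fin 2, MemL2Loc univ fun y => 2 * Complex.I * ((F y j : ℂ) * ψ y) := fun j =>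
    (hF.memL2Loc_mul MeasurableSet.univ hψ j).const_mul _
  have hGd : ∀ j : Fin 2, ContDiff ℝ 1 (mollify n fun y => 2 * Complex.I * ((F y j : ℂ) * ψ y)) :=
    fun j => (contDiff_mollify (hG j).locallyIntegrable n).of_le (by simp)
  have hc : ∀ j, ContDiff ℝ 1 (magneticTranspose F j η) :=
    contDiff_magneticTranspose isOpen_univ hF hη.1 (subset_univ _)
  have hs : ∀ j, HasCompactSupport (magneticTranspose F j η) :=
    hasCompactSupport_magneticTranspose F hη.2
  have hp : ∀ j, ContDiff ℝ 1 (partialDeriv j η) := fun j =>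
    (contDiff_partialDeriv hη.1 j).of_le (by simp)
  have hpu : ∀ j, ContDiff ℝ 1 (partialDeriv j (mollify n ψ)) := fun j =>
    (contDiff_partialDeriv hu j).of_le (by simp)
  have hHc := continuous_mollify
    (hψ.continuous_mul MeasurableSet.univ (continuous_zerothOrder hF)) n
  have hwc := continuous_mollify hw n
  -- integrate the mollified equation against `η`
  have step : (∑ j : Fin 2, ((-∫ x, mollify n ψ x * partialDeriv j (partialDeriv j η) x) +
      ∫ x, mollify n (fun y => 2 * Complex.I * ((F y j : ℂ) * ψ y)) x * partialDeriv j η x)) +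
        ∫ x, mollify n (fun y => zerothOrder F y * ψ y) x * η x = ∫ x, mollify n w x * η x := by
    have j1 : ∀ j, Integrable fun x => partialDeriv j (partialDeriv j (mollify n ψ)) x * η x :=
      fun j => integrable_mul_of_hasCompactSupport (continuous_partialDeriv (hpu j) j)
        hη1.continuous hη.2
    have j2 : ∀ j, Integrable fun x =>
        partialDeriv j (mollify n fun y => 2 * Complex.I * ((F y j : ℂ) * ψ y)) x * η x :=
      fun j => integrable_mul_of_hasCompactSupport (continuous_partialDeriv (hGd j) j)
        hη1.continuous hη.2
    have j3 := integrable_mul_of_hasCompactSupport hHc hη1.continuous hη.2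
    have j1' : ∀ j, Integrable fun x =>
        -(partialDeriv j (partialDeriv j (mollify n ψ)) x * η x) := fun j => (j1 j).neg
    have e1 : ∀ j, (-∫ x, mollify n ψ x * partialDeriv j (partialDeriv j η) x) +
        ∫ x, mollify n (fun y => 2 * Complex.I * ((F y j : ℂ) * ψ y)) x * partialDeriv j η x =
        ∫ x, (-(partialDeriv j (partialDeriv j (mollify n ψ)) x * η x) -
          partialDeriv j (mollify n fun y => 2 * Complex.I * ((F y j : ℂ) * ψ y)) x * η x) := by
      intro j
      rw [integral_mul_partialDeriv hu1 (hp j) (hη.2.partialDeriv j),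
        integral_mul_partialDeriv (hpu j) hη1 hη.2, integral_mul_partialDeriv (hGd j) hη1 hη.2,
        integral_sub (j1' j) (j2 j), integral_neg]
      ring
    have j4 : ∀ j, Integrable fun x => -(partialDeriv j (partialDeriv j (mollify n ψ)) x * η x) -
          partialDeriv j (mollify n fun y => 2 * Complex.I * ((F y j : ℂ) * ψ y)) x * η x :=
      fun j => (j1 j).neg.sub (j2 j)
    simp only [e1]
    rw [← integral_finsetSum _ fun j _ => j4 j,
      ← integral_add (integrable_finsetSum _ fun j _ => j4 j) j3]
    congr 1
    funext x
    rw [← mollify_equation hF hψ h n x, add_mul, Finset.sum_mul]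
    congr 1
    refine Finset.sum_congr rfl fun j _ => ?_
    ring
  have k1 : ∀ j, Integrable fun x => mollify n ψ x * partialDeriv j (partialDeriv j η) x := fun j =>
    integrable_mul_of_hasCompactSupport hu.continuous (continuous_partialDeriv (hp j) j)
      ((hη.2.partialDeriv j).partialDeriv j)
  have k2 : ∀ j, Integrable fun x =>
      2 * Complex.I * ((F x j : ℂ) * mollify n ψ x) * partialDeriv j η x := fun j =>
    integrable_mul_of_hasCompactSupport
      (continuous_const.mul ((hF.contDiff_coord j).continuous.mul hu.continuous))
      (hp j).continuous (hη.2.partialDeriv j)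
  have k3 : Integrable fun x => zerothOrder F x * mollify n ψ x * η x :=
    integrable_mul_of_hasCompactSupport ((continuous_zerothOrder hF).mul hu.continuous)
      hη1.continuous hη.2
  have k4 : ∀ j, Integrable fun x =>
      mollify n (fun y => 2 * Complex.I * ((F y j : ℂ) * ψ y)) x * partialDeriv j η x := fun j =>
    integrable_mul_of_hasCompactSupport (hGd j).continuous (hp j).continuous (hη.2.partialDeriv j)
  have k5 := integrable_mul_of_hasCompactSupport hHc hη1.continuous hη.2
  have k6 := integrable_mul_of_hasCompactSupport hwc hη1.continuous hη.2
  have lhs : ∑ j, ∫ x, magneticPartial F j (mollify n ψ) x * magneticTranspose F j η x =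
      (∑ j : Fin 2, ((-∫ x, mollify n ψ x * partialDeriv j (partialDeriv j η) x) +
        ∫ x, 2 * Complex.I * ((F x j : ℂ) * mollify n ψ x) * partialDeriv j η x)) +
        ∫ x, zerothOrder F x * mollify n ψ x * η x := by
    have k7 : ∀ j, Integrable fun x =>
        mollify n ψ x * magneticTranspose F j (magneticTranspose F j η) x := by
      intro j
      refine integrable_mul_of_hasCompactSupport hu.continuous ?_
        (hasCompactSupport_magneticTranspose F (hs j) j)
      exact (continuous_const.mul (continuous_partialDeriv (hc j) j)).add
        ((hF.contDiff_coord j).continuous.mul (hc j).continuous)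
    have k8 : ∀ j : Fin 2, Integrable fun x =>
        -(mollify n ψ x * partialDeriv j (partialDeriv j η) x) +
          2 * Complex.I * ((F x j : ℂ) * mollify n ψ x) * partialDeriv j η x := fun j =>
      (k1 j).neg.add (k2 j)
    have k1' : ∀ j, Integrable fun x =>
        -(mollify n ψ x * partialDeriv j (partialDeriv j η) x) := fun j => (k1 j).neg
    have e2 : ∀ j : Fin 2, (-∫ x, mollify n ψ x * partialDeriv j (partialDeriv j η) x) +
        ∫ x, 2 * Complex.I * ((F x j : ℂ) * mollify n ψ x) * partialDeriv j η x =
        ∫ x, (-(mollify n ψ x * partialDeriv j (partialDeriv j η) x) +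
          2 * Complex.I * ((F x j : ℂ) * mollify n ψ x) * partialDeriv j η x) := by
      intro j
      rw [integral_add (k1' j) (k2 j), integral_neg]
    simp only [e2]
    rw [Finset.sum_congr rfl fun j _ => integral_magneticPartial_mul hF hu1 (hc j) (hs j) j,
      ← integral_finsetSum _ fun j _ => k7 j, ← integral_finsetSum _ fun j _ => k8 j,
      ← integral_add (integrable_finsetSum _ fun j _ => k8 j) k3]
    congr 1
    funext x
    rw [← Finset.mul_sum, sum_magneticTranspose_magneticTranspose hF hη.1, mul_add,
      Finset.mul_sum]
    congr 1
    · refine Finset.sum_congr rfl fun j _ => ?_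
      ring
    · ring
  have rhs1 : ∀ j, ∫ x, mollifyFlux F ψ n j x * partialDeriv j η x =
      (∫ x, 2 * Complex.I * ((F x j : ℂ) * mollify n ψ x) * partialDeriv j η x) -
        ∫ x, mollify n (fun y => 2 * Complex.I * ((F y j : ℂ) * ψ y)) x * partialDeriv j η x := by
    intro j
    rw [← integral_sub (k2 j) (k4 j)]
    congr 1
    funext x
    rw [mollifyFlux]
    ring
  have rhs2 : ∫ x, mollifySource F ψ w n x * η x = (∫ x, zerothOrder F x * mollify n ψ x * η x) -
      (∫ x, mollify n (fun y => zerothOrder F y * ψ y) x * η x) + ∫ x, mollify n w x * η x := by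
    have k9 : Integrable fun x => zerothOrder F x * mollify n ψ x * η x -
        mollify n (fun y => zerothOrder F y * ψ y) x * η x := k3.sub k5
    rw [← integral_sub k3 k5, ← integral_add k9 k6]
    congr 1
    funext x
    rw [mollifySource]
    ring
  rw [lhs, rhs2, ← step]
  simp only [rhs1, Finset.sum_add_distrib, Finset.sum_sub_distrib, Finset.sum_neg_distrib]
  ring

end Mollified

/-! ### Local convergence in mean square -/

/-- Convergence in `L²` on all discs. -/
structure TendstoL2Loc (f : ℕ → Plane → ℂ) (f₀ : Plane → ℂ) : Prop where
  memL2Loc : ∀ n, MemL2Loc univ (f n)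
  memL2Loc_limit : MemL2Loc univ f₀
  tendsto : ∀ R, Tendsto (fun n => eLpNorm (f n - f₀) 2 (volume.restrict (univ ∩ Metric.ball 0 R)))
    atTop (𝓝 0)

theorem tendstoL2Loc_mollify {f : Plane → ℂ} (hf : MemL2Loc univ f) :
    TendstoL2Loc (fun n => mollify n f) f := by
  refine ⟨fun n => (continuous_mollify hf n).memL2Loc MeasurableSet.univ, hf, fun R => ?_⟩
  have hi := hf.memLp_indicator MeasurableSet.univ (R + 2)
  refine tendsto_of_tendsto_of_tendsto_of_le_of_le tendsto_const_nhds
    (tendsto_eLpNorm_mollify_sub hi) (fun _ => zero_le) fun n => ?_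
  refine le_trans (le_of_eq (eLpNorm_congr_ae ?_)) (eLpNorm_mono_measure _ Measure.restrict_le_self)
  have hm : MeasurableSet (univ ∩ Metric.ball (0 : Plane) R) :=
    MeasurableSet.univ.inter Metric.isOpen_ball.measurableSet
  refine (ae_restrict_iff' hm).2 (ae_of_all _ fun x hx => ?_)
  have hxR : ‖x‖ < R := mem_ball_zero_iff.1 hx.2
  have h1 : (univ ∩ Metric.ball (0 : Plane) (R + 2)).indicator f x = f x :=
    indicator_of_mem (show _ ∈ univ ∩ Metric.ball (0 : Plane) (R + 2) from
        ⟨mem_univ _, mem_ball_zero_iff.2 (by linarith)⟩) _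
  -- The kernel reaches at most distance 2, so on the disc of radius R only values of f within R + 2
  -- enter.
  have h2 : mollify n ((univ ∩ Metric.ball (0 : Plane) (R + 2)).indicator f) x =
      mollify n f x := by
    rw [mollify, mollify, smear_apply, smear_apply]
    congr 1
    funext t
    by_cases ht : leftKernel n t = 0
    · simp [ht]
    · have h3 := (tsupport_leftKernel_subset n (subset_tsupport _ ht)).2
      rw [mem_ball_zero_iff] at h3
      have h4 : 2 / ((n : ℝ) + 1) ≤ 2 := div_le_self zero_le_two (by
        linarith [Nat.cast_nonneg (α := ℝ) n])
      have h5 := norm_sub_le x t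
      rw [indicator_of_mem (show _ ∈ univ ∩ Metric.ball (0 : Plane) (R + 2) from
        ⟨mem_univ _, mem_ball_zero_iff.2 (by linarith)⟩)]
  simp only [Pi.sub_apply, h1, h2]

namespace TendstoL2Loc

variable {f g : ℕ → Plane → ℂ} {f₀ g₀ : Plane → ℂ}

theorem add (hf : TendstoL2Loc f f₀) (hg : TendstoL2Loc g g₀) :
    TendstoL2Loc (fun n x => f n x + g n x) fun x => f₀ x + g₀ x := by
  refine ⟨fun n => (hf.memL2Loc n).add (hg.memL2Loc n), hf.memL2Loc_limit.add hg.memL2Loc_limit,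
    fun R => ?_⟩
  refine tendsto_of_tendsto_of_tendsto_of_le_of_le tendsto_const_nhds
    (by simpa only [add_zero] using (hf.tendsto R).add (hg.tendsto R)) (fun _ => zero_le) fun n => ?_
  have e : (fun x => f n x + g n x) - (fun x => f₀ x + g₀ x) = (f n - f₀) + (g n - g₀) := by
    funext x
    simp only [Pi.sub_apply, Pi.add_apply]
    ring
  simp only [e]
  exact eLpNorm_add_le ((hf.memL2Loc n R).1.sub (hf.memL2Loc_limit R).1)
    ((hg.memL2Loc n R).1.sub (hg.memL2Loc_limit R).1) one_le_two

theorem continuous_mul (hf : TendstoL2Loc f f₀) {a : Plane → ℂ} (ha : Continuous a) :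
    TendstoL2Loc (fun n x => a x * f n x) fun x => a x * f₀ x := by
  refine ⟨fun n => (hf.memL2Loc n).continuous_mul MeasurableSet.univ ha,
    hf.memL2Loc_limit.continuous_mul MeasurableSet.univ ha, fun R => ?_⟩
  obtain ⟨C, hC⟩ := (isCompact_closedBall (0 : Plane) R).exists_bound_of_continuousOn
    ha.continuousOn
  have hm : MeasurableSet (univ ∩ Metric.ball (0 : Plane) R) :=
    MeasurableSet.univ.inter Metric.isOpen_ball.measurableSet
  have hlim := ENNReal.Tendsto.const_mul (a := ENNReal.ofReal C) (hf.tendsto R)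
    (Or.inr ENNReal.ofReal_ne_top)
  rw [mul_zero] at hlim
  refine tendsto_of_tendsto_of_tendsto_of_le_of_le tendsto_const_nhds hlim (fun _ => zero_le)
    fun n => eLpNorm_le_mul_eLpNorm_of_ae_le_mul ?_ 2
  refine (ae_restrict_iff' hm).2 (ae_of_all _ fun x hx => ?_)
  rw [Pi.sub_apply, Pi.sub_apply, ← mul_sub, norm_mul]
  exact mul_le_mul_of_nonneg_right (hC x (Metric.ball_subset_closedBall hx.2)) (norm_nonneg _)

theorem sub (hf : TendstoL2Loc f f₀) (hg : TendstoL2Loc g g₀) :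
    TendstoL2Loc (fun n x => f n x - g n x) fun x => f₀ x - g₀ x := by
  simpa [sub_eq_add_neg] using hf.add (hg.continuous_mul (continuous_const (y := -1)))

theorem tendsto_integral (hf : TendstoL2Loc f f₀) (hg : TendstoL2Loc g g₀) {a : Plane → ℂ}
    (ha : Continuous a) (hs : HasCompactSupport a) :
    Tendsto (fun n => ∫ x, a x * (f n x * conj (g n x))) atTop
      (𝓝 (∫ x, a x * (f₀ x * conj (g₀ x)))) := by
  obtain ⟨R, hR⟩ := hs.exists_eq_zero_of_norm_le
  have e : ∀ p q : Plane → ℂ, ∫ x, a x * (p x * conj (q x)) =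
      ∫ x in univ ∩ Metric.ball 0 R, a x * p x * conj (q x) := by
    intro p q
    rw [setIntegral_eq_integral_of_forall_compl_eq_zero]
    · congr 1
      funext x
      ring
    · intro x hx
      rw [hR x, zero_mul, zero_mul]
      simpa using hx
  simp only [e]
  have haf := hf.continuous_mul ha
  exact tendsto_integral_mul (fun n => haf.memL2Loc n R) (haf.memL2Loc_limit R)
    (fun n => (hg.memL2Loc n R).conj) (hg.memL2Loc_limit R).conj (haf.tendsto R)
    (by simpa only [eLpNorm_conj_sub] using hg.tendsto R)

end TendstoL2Loc

section Limits

variable {F : Plane → Plane} {ψ w : Plane → ℂ}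

/-- Both terms of the flux converge to 2iF_jψ, because F is continuous and does not depend on n. -/
theorem tendstoL2Loc_mollifyFlux (hF : IsUnitFieldPotential univ F) (hψ : MemL2Loc univ ψ)
    (j : Fin 2) : TendstoL2Loc (fun n => mollifyFlux F ψ n j) fun _ => 0 := by
  have h := ((tendstoL2Loc_mollify hψ).continuous_mul
    (hF.contDiff_coord j).continuous).continuous_mul (continuous_const (y := 2 * Complex.I))
  have := h.sub
    (tendstoL2Loc_mollify ((hF.memL2Loc_mul MeasurableSet.univ hψ j).const_mul (2 * Complex.I)))
  simp only [sub_self] at this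
  exact this

theorem tendstoL2Loc_mollifySource (hF : IsUnitFieldPotential univ F) (hψ : MemL2Loc univ ψ)
    (hw : MemL2Loc univ w) : TendstoL2Loc (mollifySource F ψ w) w := by
  have h := (tendstoL2Loc_mollify hψ).continuous_mul (continuous_zerothOrder hF)
  have := (h.sub (tendstoL2Loc_mollify (hψ.continuous_mul MeasurableSet.univ
    (continuous_zerothOrder hF)))).add (tendstoL2Loc_mollify hw)
  simp only [sub_self, zero_add] at this
  exact this

end Limits

/-! ### The energy inequality on the plane -/

theorem magneticTranspose_conj (F : Plane → Plane) (j : Fin 2) {g : Plane → ℂ}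
    (hg : ContDiff ℝ 1 g) (x : Plane) :
    magneticTranspose F j (fun y => conj (g y)) x = conj (magneticPartial F j g x) := by
  rw [magneticPartial, magneticTranspose, partialDeriv_conj (hg.differentiable one_ne_zero x)]
  simp

theorem magneticPartial_ofReal_mul (F : Plane → Plane) (j : Fin 2) {χ : Plane → ℝ}
    (hχ : ContDiff ℝ ∞ χ) {u : Plane → ℂ} (hu : ContDiff ℝ 1 u) (x : Plane) :
    magneticPartial F j (fun y => (χ y : ℂ) * u y) x =
      cutDeriv χ u (fun j => magneticPartial F j u) j x := by
  have hd : DifferentiableAt ℝ χ x := hχ.differentiable (by simp) x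
  have hd' : DifferentiableAt ℝ (fun y => (χ y : ℂ)) x := by fun_prop
  rw [magneticPartial, cutDeriv, magneticPartial,
    partialDeriv_mul hd' (hu.differentiable one_ne_zero x), partialDeriv_ofReal hd]
  ring

/-- The weight of the flux in the energy inequality. -/
def fluxWeight (F : Plane → Plane) (χ : Plane → ℝ) (j : Fin 2) (x : Plane) : ℂ :=
  (χ x * fderiv ℝ χ x (EuclideanSpace.single j 1) : ℝ) +
    Complex.I * (F x j : ℂ) * ((χ x ^ 2 : ℝ) : ℂ)

/-- The gradient of u enters only through D_j(χu), with a factor χ to spare; the remainder has a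
continuous compactly supported weight. Thus the flux can be absorbed into the energy. -/
theorem partialDeriv_conj_sq_mul (F : Plane → Plane) (j : Fin 2) {χ : Plane → ℝ}
    (hχ : ContDiff ℝ ∞ χ) {u : Plane → ℂ} (hu : ContDiff ℝ 1 u) (x : Plane) :
    partialDeriv j (fun y => conj (((χ y ^ 2 : ℝ) : ℂ) * u y)) x =
      -Complex.I * χ x * conj (cutDeriv χ u (fun j => magneticPartial F j u) j x) +
        fluxWeight F χ j x * conj (u x) := by
  have hχ2 : ContDiff ℝ ∞ fun y => χ y ^ 2 := hχ.pow 2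
  have hd : DifferentiableAt ℝ χ x := hχ.differentiable (by simp) x
  have hd2 : DifferentiableAt ℝ (fun y => χ y ^ 2) x := hχ2.differentiable (by simp) x
  have hd' : DifferentiableAt ℝ (fun y => ((χ y ^ 2 : ℝ) : ℂ)) x := by fun_prop
  have hux := hu.differentiable one_ne_zero x
  have hm : DifferentiableAt ℝ (fun y => ((χ y ^ 2 : ℝ) : ℂ) * u y) x := hd'.mul hux
  rw [partialDeriv_conj hm, partialDeriv_mul hd' hux, partialDeriv_ofReal hd2,
    fderiv_sq_apply hd, fluxWeight, cutDeriv, magneticPartial]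
  simp only [map_add, map_mul, map_sub, map_neg, Complex.conj_ofReal, Complex.conj_I]
  push_cast
  linear_combination ((χ x : ℂ) ^ 2 * conj (partialDeriv j u x) +
    (χ x : ℂ) * (fderiv ℝ χ x (EuclideanSpace.single j 1) : ℂ) * conj (u x)) * Complex.I_sq

section Energy

variable {F : Plane → Plane} {χ : Plane → ℝ}

theorem isTestFunction_conj_ofReal_mul (hχ : ContDiff ℝ ∞ χ) (hs : HasCompactSupport χ)
    {u : Plane → ℂ} (hu : ContDiff ℝ ∞ u) : IsTestFunction fun y => conj ((χ y : ℂ) * u y) := by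
  have hc : ContDiff ℝ ∞ fun y => (χ y : ℂ) := Complex.ofRealCLM.contDiff.comp hχ
  refine ⟨Complex.conjCLE.contDiff.comp (hc.mul hu), hs.mono fun x hx => ?_⟩
  contrapose! hx
  simp only [Function.mem_support, not_not] at hx ⊢
  simp [hx]

theorem continuous_fluxWeight (hF : IsUnitFieldPotential univ F) (hχ : ContDiff ℝ ∞ χ)
    (j : Fin 2) : Continuous (fluxWeight F χ j) := by
  have h1 := (continuous_fderiv_apply hχ (EuclideanSpace.single j 1)).continuous
  exact (Complex.continuous_ofReal.comp (hχ.continuous.mul h1)).add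
    ((continuous_const.mul (hF.contDiff_coord j).continuous).mul
      (Complex.continuous_ofReal.comp (hχ.continuous.pow 2)))

theorem hasCompactSupport_fluxWeight (hs : HasCompactSupport χ) (j : Fin 2) :
    HasCompactSupport (fluxWeight F χ j) := hs.mono fun x hx => by
  contrapose! hx
  simp only [Function.mem_support, not_not] at hx ⊢
  simp [fluxWeight, hx]

theorem hasCompactSupport_ofReal_sq (hs : HasCompactSupport χ) :
    HasCompactSupport fun x => ((χ x ^ 2 : ℝ) : ℂ) := hs.mono fun x hx => by
  contrapose! hx
  simp only [Function.mem_support, not_not] at hx ⊢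
  simp [hx]

theorem re_integral_ofReal_mul_conj_self (a : Plane → ℝ) (u : Plane → ℂ) :
    (∫ x, (a x : ℂ) * (u x * conj (u x))).re = ∫ x, a x * ‖u x‖ ^ 2 := by
  rw [← Complex.ofReal_re (∫ x, a x * ‖u x‖ ^ 2), ← integral_complex_ofReal]
  congr 2
  funext x
  rw [Complex.mul_conj, Complex.normSq_eq_norm_sq]
  push_cast
  ring

/-- The weak equation is tested with the conjugate of χ²u. The gradient part of the flux costs
1/(2s) of the energy, and the rest of the energy is bounded below by ∫|χu|². -/
theorem energy_le_of_flux (hF : IsUnitFieldPotential univ F) (hχ : ContDiff ℝ ∞ χ)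
    (hs : HasCompactSupport χ) {u k : Plane → ℂ} {P : Fin 2 → Plane → ℂ} (hu : ContDiff ℝ ∞ u)
    (hP : ∀ j, Continuous (P j))
    (h : ∀ η, IsTestFunction η →
      ∑ j, ∫ x, magneticPartial F j u x * magneticTranspose F j η x =
        (∑ j, ∫ x, P j x * partialDeriv j η x) + ∫ x, k x * η x)
    {s : ℝ} (hs1 : 1 ≤ s) :
    (1 - 1 / (2 * s)) * (∫ x, ((χ x ^ 2 : ℝ) : ℂ) * (u x * conj (u x))).re ≤
      s / 2 * (∑ j, (∫ x, ((χ x ^ 2 : ℝ) : ℂ) * (P j x * conj (P j x))).re) +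
        (∑ j, (∫ x, fluxWeight F χ j x * (P j x * conj (u x))).re) +
        (∫ x, ((χ x ^ 2 : ℝ) : ℂ) * (k x * conj (u x))).re +
        (∫ x, (gradSq χ x : ℂ) * (u x * conj (u x))).re := by
  have hu1 : ContDiff ℝ 1 u := hu.of_le (by simp)
  have hχ2 : ContDiff ℝ ∞ fun y => χ y ^ 2 := hχ.pow 2
  have hs2 : HasCompactSupport fun y => χ y ^ 2 := hs.comp_left (g := fun t : ℝ => t ^ 2) (by simp)
  set V : Fin 2 → Plane → ℂ := fun j => magneticPartial F j u
  have hVc : ∀ j, Continuous (V j) := continuous_magneticPartial hF hu1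
  have hχc : Continuous fun x => (χ x : ℂ) := Complex.continuous_ofReal.comp hχ.continuous
  have hcutc : ∀ {ξ : Plane → ℝ}, ContDiff ℝ ∞ ξ → ∀ j, Continuous (cutDeriv ξ u V j) := by
    intro ξ hξ j
    have h1 := (continuous_fderiv_apply hξ (EuclideanSpace.single j 1)).continuous
    have h2 := hξ.continuous
    have h3 := hu.continuous
    have h4 := hVc j
    unfold cutDeriv
    fun_prop
  have hcuts : ∀ {ξ : Plane → ℝ}, HasCompactSupport ξ → ∀ j,
      HasCompactSupport (cutDeriv ξ u V j) := fun hξ j =>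
    hξ.of_isClosed_subset (isClosed_tsupport _) (closure_minimal
      (fun x hx => by
        contrapose! hx
        simpa using cutDeriv_eq_zero hx u V j) (isClosed_tsupport _))
  have hD2 : ∀ j, MemLp (cutDeriv χ u V j) 2 := fun j =>
    (hcutc hχ j).memLp_of_hasCompactSupport (hcuts hs j)
  have hDi : ∀ j, Integrable fun x => ‖cutDeriv χ u V j x‖ ^ 2 := fun j =>
    (hD2 j).integrable_norm_sq
  -- The lower bound is stated for the transposed derivatives, so it is applied to the conjugate of
  -- χu.
  have hlow : (∫ x, ((χ x ^ 2 : ℝ) : ℂ) * (u x * conj (u x))).re ≤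
      ∑ j, ∫ x, ‖cutDeriv χ u V j x‖ ^ 2 := by
    have := integral_norm_sq_le_magneticTranspose hF (isTestFunction_conj_ofReal_mul hχ hs hu)
    rw [re_integral_ofReal_mul_conj_self]
    have hc1 : ContDiff ℝ 1 fun y => (χ y : ℂ) * u y :=
      (Complex.ofRealCLM.contDiff.comp (hχ.of_le (by simp))).mul hu1
    simpa only [magneticTranspose_conj F _ hc1, magneticPartial_ofReal_mul F _ hχ hu1,
      RCLike.norm_conj, norm_mul, Complex.norm_real, mul_pow, Real.norm_eq_abs, sq_abs] using this
  have hE : (∑ j, ∫ x, ‖cutDeriv χ u V j x‖ ^ 2) -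
      (∫ x, (gradSq χ x : ℂ) * (u x * conj (u x))).re =
      (∑ j, ∫ x, magneticPartial F j u x *
        magneticTranspose F j (fun y => conj (((χ y ^ 2 : ℝ) : ℂ) * u y)) x).re := by
    have hgi : ∀ j : Fin 2, Integrable fun x =>
        fderiv ℝ χ x (EuclideanSpace.single j 1) ^ 2 * ‖u x‖ ^ 2 := fun j =>
      integrableOn_univ.1 ((hu.continuous.memL2Loc MeasurableSet.univ).integrableOn_grad_sq_mul
        MeasurableSet.univ hχ hs j)
    rw [re_integral_ofReal_mul_conj_self, Complex.re_sum]
    simp only [gradSq, Finset.sum_mul]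
    rw [integral_finsetSum _ fun j _ => hgi j, ← Finset.sum_sub_distrib]
    refine Finset.sum_congr rfl fun j _ => ?_
    have hc2 : ContDiff ℝ 1 fun y => ((χ y ^ 2 : ℝ) : ℂ) * u y :=
      (Complex.ofRealCLM.contDiff.comp (hχ2.of_le (by simp))).mul hu1
    simp only [magneticTranspose_conj F _ hc2, magneticPartial_ofReal_mul F _ hχ2 hu1]
    have hi : Integrable fun x => V j x * conj (cutDeriv (fun y => χ y ^ 2) u V j x) :=
      integrable_mul_of_hasCompactSupport (hVc j) (Complex.continuous_conj.comp (hcutc hχ2 j))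
        ((hcuts hs2 j).comp_left (map_zero _))
    rw [re_integral_eq hi, ← integral_sub (hDi j) (hgi j)]
    congr 1
    funext x
    rw [mul_conj_cutDeriv_sq hχ]
    simp only [Complex.add_re, Complex.ofReal_re, Complex.I_mul_re, Complex.ofReal_im]
    ring
  rw [h _ (isTestFunction_conj_ofReal_mul hχ2 hs2 hu), Complex.add_re, Complex.re_sum] at hE
  have hkint : ∫ x, k x * conj (((χ x ^ 2 : ℝ) : ℂ) * u x) =
      ∫ x, ((χ x ^ 2 : ℝ) : ℂ) * (k x * conj (u x)) := by
    congr 1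
    funext x
    rw [map_mul, Complex.conj_ofReal]
    ring
  rw [hkint] at hE
  have hflux : ∀ j, (∫ x, P j x * partialDeriv j (fun y => conj (((χ y ^ 2 : ℝ) : ℂ) * u y)) x).re ≤
      s / 2 * (∫ x, ((χ x ^ 2 : ℝ) : ℂ) * (P j x * conj (P j x))).re +
        1 / (2 * s) * (∫ x, ‖cutDeriv χ u V j x‖ ^ 2) +
        (∫ x, fluxWeight F χ j x * (P j x * conj (u x))).re := by
    intro j
    have hW : Integrable fun x => fluxWeight F χ j x * (P j x * conj (u x)) :=
      ((continuous_fluxWeight hF hχ j).mul ((hP j).mul (Complex.continuous_conj.comp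
        hu.continuous))).integrable_of_hasCompactSupport
          (hasCompactSupport_fluxWeight hs j).mul_right
    have hX : Integrable fun x => -Complex.I * χ x * P j x * conj (cutDeriv χ u V j x) :=
      integrable_mul_of_hasCompactSupport ((continuous_const.mul hχc).mul (hP j))
        (Complex.continuous_conj.comp (hcutc hχ j)) ((hcuts hs j).comp_left (map_zero _))
    have hQ : Integrable fun x => χ x ^ 2 * ‖P j x‖ ^ 2 :=
      ((hχ.continuous.pow 2).mul ((hP j).norm.pow 2)).integrable_of_hasCompactSupport hs2.mul_right
    have e : ∀ x, P j x * partialDeriv j (fun y => conj (((χ y ^ 2 : ℝ) : ℂ) * u y)) x =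
        -Complex.I * χ x * P j x * conj (cutDeriv χ u V j x) +
          fluxWeight F χ j x * (P j x * conj (u x)) := by
      intro x
      rw [partialDeriv_conj_sq_mul F j hχ hu1]
      ring
    have hXr : Integrable fun x => (-Complex.I * χ x * P j x * conj (cutDeriv χ u V j x)).re :=
      hX.re
    simp only [e]
    rw [integral_add hX hW, Complex.add_re, re_integral_ofReal_mul_conj_self, re_integral_eq hX,
      ← integral_const_mul, ← integral_const_mul,
      ← integral_add (hQ.const_mul _) ((hDi j).const_mul _)]
    refine add_le_add_left (integral_mono hXr ((hQ.const_mul _).add ((hDi j).const_mul _))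
      fun x => ?_) _
    -- Young's inequality with weight s on the flux; after halving, the energy carries the factor
    -- 1/(2s).
    have h2 := two_mul_re_mul_conj_le (zero_lt_one.trans_le hs1) (-Complex.I * χ x * P j x)
      (cutDeriv χ u V j x)
    have h3 : ‖-Complex.I * χ x * P j x‖ ^ 2 = χ x ^ 2 * ‖P j x‖ ^ 2 := by
      simp [mul_pow]
    rw [h3] at h2
    have h4 : ‖cutDeriv χ u V j x‖ ^ 2 / s = 2 * (1 / (2 * s) * ‖cutDeriv χ u V j x‖ ^ 2) := by
      field_simp
    show (-Complex.I * χ x * P j x * conj (cutDeriv χ u V j x)).re ≤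
      s / 2 * (χ x ^ 2 * ‖P j x‖ ^ 2) + 1 / (2 * s) * ‖cutDeriv χ u V j x‖ ^ 2
    linarith
  have hsum := Finset.sum_le_sum fun j (_ : j ∈ Finset.univ) => hflux j
  rw [Finset.sum_add_distrib, Finset.sum_add_distrib, ← Finset.mul_sum, ← Finset.mul_sum] at hsum
  have h5 : 0 ≤ 1 - 1 / (2 * s) := by
    rw [sub_nonneg, div_le_one (by linarith)]
    linarith
  have := mul_le_mul_of_nonneg_left hlow h5
  linarith

/-- In `energy_le_of_flux` for the mollifications, n → ∞ at fixed s kills every flux term, including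
the one with factor s/2. Only then s → ∞ restores the constant 1. -/
theorem HasMagneticLaplacian.energy_le (hF : IsUnitFieldPotential univ F) {ψ w : Plane → ℂ}
    (hψ : MemL2Loc univ ψ) (hw : MemL2Loc univ w) (h : HasMagneticLaplacian univ F ψ w)
    (hχ : ContDiff ℝ ∞ χ) (hs : HasCompactSupport χ) :
    ∫ x, ‖(χ x : ℂ) * ψ x‖ ^ 2 ≤ (∫ x, w x * conj (((χ x ^ 2 : ℝ) : ℂ) * ψ x)).re +
      ∫ x, gradSq χ x * ‖ψ x‖ ^ 2 := by
  have hχ2 : Continuous fun x => ((χ x ^ 2 : ℝ) : ℂ) :=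
    Complex.continuous_ofReal.comp (hχ.continuous.pow 2)
  have hχs := hasCompactSupport_ofReal_sq hs
  have hg : Continuous fun x => (gradSq χ x : ℂ) :=
    Complex.continuous_ofReal.comp (continuous_gradSq hχ)
  have hgs : HasCompactSupport fun x => (gradSq χ x : ℂ) :=
    (hasCompactSupport_gradSq hs).comp_left Complex.ofReal_zero
  have tu := tendstoL2Loc_mollify hψ
  have tP := tendstoL2Loc_mollifyFlux hF hψ
  have tk := tendstoL2Loc_mollifySource hF hψ hw
  have hlim : ∀ s : ℝ, 1 ≤ s →
      (1 - 1 / (2 * s)) * (∫ x, ((χ x ^ 2 : ℝ) : ℂ) * (ψ x * conj (ψ x))).re ≤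
        (∫ x, ((χ x ^ 2 : ℝ) : ℂ) * (w x * conj (ψ x))).re +
          (∫ x, (gradSq χ x : ℂ) * (ψ x * conj (ψ x))).re := by
    intro s hs1
    have re : ∀ {z : ℕ → ℂ} {z₀ : ℂ}, Tendsto z atTop (𝓝 z₀) →
        Tendsto (fun n => (z n).re) atTop (𝓝 z₀.re) := fun hz =>
      (Complex.continuous_re.tendsto _).comp hz
    have l1 := (re (tu.tendsto_integral tu hχ2 hχs)).const_mul (1 - 1 / (2 * s))
    have l2 := (tendsto_finsetSum Finset.univ fun j _ =>
      re ((tP j).tendsto_integral (tP j) hχ2 hχs)).const_mul (s / 2)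
    have l3 := tendsto_finsetSum Finset.univ fun j _ => re ((tP j).tendsto_integral tu
      (continuous_fluxWeight hF hχ j) (hasCompactSupport_fluxWeight hs j))
    have l4 := re (tk.tendsto_integral tu hχ2 hχs)
    have l5 := re (tu.tendsto_integral tu hg hgs)
    have := le_of_tendsto_of_tendsto' l1 (((l2.add l3).add l4).add l5) fun n =>
      energy_le_of_flux hF hχ hs (contDiff_mollify hψ.locallyIntegrable n)
        (continuous_mollifyFlux hF hψ n)
        (fun η hη => integral_mollify_weak hF hψ hw h n hη) hs1
    simpa using this
  have hinv : Tendsto (fun n : ℕ => 1 - 1 / (2 * ((n : ℝ) + 1))) atTop (𝓝 1) := by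
    have := (tendsto_one_div_add_atTop_nhds_zero_nat (𝕜 := ℝ)).const_mul (1 / 2)
    rw [mul_zero] at this
    simpa [one_div, mul_inv, mul_comm] using (tendsto_const_nhds (x := (1 : ℝ))).sub this
  have hfin := le_of_tendsto' (hinv.mul_const _) fun n : ℕ =>
    hlim ((n : ℝ) + 1) (by linarith [Nat.cast_nonneg (α := ℝ) n])
  rw [one_mul, re_integral_ofReal_mul_conj_self, re_integral_ofReal_mul_conj_self] at hfin
  have e1 : ∀ x, ‖(χ x : ℂ) * ψ x‖ ^ 2 = χ x ^ 2 * ‖ψ x‖ ^ 2 := fun x => by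
    simp [mul_pow]
  have e2 : ∀ x, w x * conj (((χ x ^ 2 : ℝ) : ℂ) * ψ x) =
      ((χ x ^ 2 : ℝ) : ℂ) * (w x * conj (ψ x)) := fun x => by
    rw [map_mul, Complex.conj_ofReal]
    ring
  simpa only [e1, e2] using hfin

end Energy

/-! ### Conclusion on the plane and the four cases -/

theorem ae_eq_zero_of_hasMagneticLaplacian_univ {F : Plane → Plane}
    (hF : IsUnitFieldPotential univ F) {ψ : Plane → ℂ} (hψ : MemLp ψ ∞ volume) {l b : ℝ}
    (hb : 0 ≤ b) (hl : l ≤ 1) (hstrict : l = 1 → 0 < b)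
    (hL : HasMagneticLaplacian univ F ψ fun x => ((l - b * ‖ψ x‖ ^ 2 : ℝ) : ℂ) * ψ x) :
    ∀ᵐ x ∂volume, ψ x = 0 := by
  obtain ⟨M, hM0, hM⟩ := exists_ae_norm_le_of_memLp_top hψ
  have hm := hψ.1
  rw [← Measure.restrict_univ (μ := (volume : Measure Plane))] at hM hm ⊢
  have hloc := memL2Loc_of_ae_norm_le hm hM
  have hwm : AEStronglyMeasurable (fun x => ((l - b * ‖ψ x‖ ^ 2 : ℝ) : ℂ) * ψ x)
      (volume.restrict univ) :=
    (Complex.continuous_ofReal.comp_aestronglyMeasurable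
      (aestronglyMeasurable_const.sub ((hm.norm.pow 2).const_mul b))).mul hm
  have hw : MemL2Loc univ fun x => ((l - b * ‖ψ x‖ ^ 2 : ℝ) : ℂ) * ψ x := by
    refine memL2Loc_of_ae_norm_le (M := (|l| + b * M ^ 2) * M) hwm ?_
    filter_upwards [hM] with x hx
    rw [norm_mul, Complex.norm_real, Real.norm_eq_abs]
    have h1 : ‖ψ x‖ ^ 2 ≤ M ^ 2 := pow_le_pow_left₀ (norm_nonneg _) hx 2
    have h2 : |l - b * ‖ψ x‖ ^ 2| ≤ |l| + b * M ^ 2 := by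
      refine (abs_sub _ _).trans (add_le_add_right ?_ _)
      rw [abs_of_nonneg (by positivity)]
      exact mul_le_mul_of_nonneg_left h1 hb
    exact mul_le_mul h2 hx (norm_nonneg _) (by positivity)
  refine ae_eq_zero_of_energy_le MeasurableSet.univ hm hM hl hb hstrict fun χ hχ hs => ?_
  simpa only [Measure.restrict_univ, one_mul] using hL.energy_le hF hloc hw hχ hs

theorem proposition4p1 :
    -- the linear equation on the plane
    (∀ (F : Plane → Plane) (ψ : Plane → ℂ) (lam : ℝ),
      IsUnitFieldPotential univ F →
      MemLp ψ ∞ volume →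
      lam < 1 →
      HasMagneticLaplacian univ F ψ (fun x => (lam : ℂ) * ψ x) →
      ∀ᵐ x ∂volume, ψ x = 0) ∧
    -- the nonlinear equation on the plane
    (∀ (F : Plane → Plane) (ψ : Plane → ℂ) (lam S : ℝ),
      IsUnitFieldPotential univ F →
      MemLp ψ ∞ volume →
      0 ≤ lam → lam ≤ 1 → 0 ≤ S → (lam = 1 → S ≠ 0) →
      HasMagneticLaplacian univ F ψ
        (fun x => (lam : ℂ) * (1 - (S : ℂ) ^ 2 * (‖ψ x‖ : ℂ) ^ 2) * ψ x) →
      ∀ᵐ x ∂volume, ψ x = 0) ∧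
    -- the linear equation on the half-plane
    (∀ (F : Plane → Plane) (ψ : Plane → ℂ) (lam : ℝ),
      IsUnitFieldPotential halfPlane F →
      MemLp ψ ∞ (volume.restrict halfPlane) →
      MemH2Loc halfPlane ψ →
      lam < thetaZero F →
      HasMagneticLaplacian halfPlane F ψ (fun x => (lam : ℂ) * ψ x) →
      MagneticNeumann F ψ →
      ∀ᵐ x ∂volume.restrict halfPlane, ψ x = 0) ∧
    -- the nonlinear equation on the half-plane
    (∀ (F : Plane → Plane) (ψ : Plane → ℂ) (lam S : ℝ),
      IsUnitFieldPotential halfPlane F →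
      MemLp ψ ∞ (volume.restrict halfPlane) →
      MemH2Loc halfPlane ψ →
      0 ≤ lam → lam ≤ thetaZero F → 0 ≤ S → (lam = thetaZero F → S ≠ 0) →
      HasMagneticLaplacian halfPlane F ψ
        (fun x => (lam : ℂ) * (1 - (S : ℂ) ^ 2 * (‖ψ x‖ : ℂ) ^ 2) * ψ x) →
      MagneticNeumann F ψ →
      ∀ᵐ x ∂volume.restrict halfPlane, ψ x = 0) := by
  have coe : ∀ (ψ : Plane → ℂ) (lam S : ℝ),
      (fun x => (lam : ℂ) * (1 - (S : ℂ) ^ 2 * (‖ψ x‖ : ℂ) ^ 2) * ψ x) =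
        fun x => ((lam - lam * S ^ 2 * ‖ψ x‖ ^ 2 : ℝ) : ℂ) * ψ x := by
    intro ψ lam S
    funext x
    push_cast
    ring
  have coe_zero : ∀ (ψ : Plane → ℂ) (lam : ℝ), (fun x => (lam : ℂ) * ψ x) =
      fun x => ((lam - 0 * ‖ψ x‖ ^ 2 : ℝ) : ℂ) * ψ x := by
    intro ψ lam
    simp
  refine ⟨fun F ψ lam hF hψ hlam hL => ?_, fun F ψ lam S hF hψ h0 h1 hS hstrict hL => ?_,
    fun F ψ lam hF hψ _ hlam hL hN => ?_, fun F ψ lam S hF hψ _ h0 h1 hS hstrict hL hN => ?_⟩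
  · rw [coe_zero] at hL
    exact ae_eq_zero_of_hasMagneticLaplacian_univ hF hψ le_rfl hlam.le
      (fun h => absurd h hlam.ne) hL
  · rw [coe] at hL
    refine ae_eq_zero_of_hasMagneticLaplacian_univ hF hψ (by positivity) h1 (fun h => ?_) hL
    have := hstrict h
    rw [h]
    positivity
  · rw [coe_zero] at hL
    -- The inequality is strict whatever the sign of Θ₀.
    have hlt : lam < max (thetaZero F) 0 := hlam.trans_le (le_max_left _ _)
    exact ae_eq_zero_of_neumann hF hψ le_rfl hlt.le (fun h => absurd h hlt.ne) hL hN
  · rw [coe] at hL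
    refine ae_eq_zero_of_neumann hF hψ (by positivity) (h1.trans (le_max_left _ _))
      (fun h hb => ?_) hL hN
    -- Here λ = Θ₀, so S ≠ 0, and λS² = 0 leaves only λ = 0.
    rw [max_eq_left (h0.trans h1)] at h
    simpa [hstrict h] using hb

end
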